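/- **Conventions.** Let $\sigma:Y\to X$ be a good cover, i.e. a surjective submersion of (smooth, finite-dimensional, Hausdorff, $\sigma$-compact) manifolds such that every fibre power $Y^{[n]}=Y\times_X\cdots\times_XY$, $n\ge1$, is a disjoint union of contractible spaces. Let $G$ be a connected finite-dimensional Lie group with Lie algebra $\mathfrak g$, and let $\wp\in C^\infty([0,1],\mathbb R)$ satisfy $\wp(0)=0$, $\wp(1)=1$. Let $P_0G=\{\gamma\in C^\infty([0,1],G):\gamma(0)=1\}$ with pointwise product, $\flat:P_0G\to G$, $\gamma\mapsto\gamma(1)$, and $L_0G=\ker\flat$; similarly $P_0\mathfrak g$, $L_0\mathfrak g$, $\flat$. Smooth maps into $P_0G$ and $P_0\mathfrak g$-valued forms are those depending smoothly on $t\in[0,1]$ and the point jointly. $P_0G$ acts on $L_0G$ by conjugation, $g\triangleright h=ghg^{-1}$, and $\triangleright$ also denotes the induced actions on Lie algebras and forms; $L_0G\subseteq P_0G$, $L_0\mathfrak g\subseteq P_0\mathfrak g$ are treated as inclusions. Put $P=\mathrm{id}-\wp\cdot\flat:P_0\mathfrak g\to L_0\mathfrak g$ and $\kappa(g,V)=P(gVg^{-1}-V)$.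 *Descent data of a principal $G$-bundle with connection*: $g\in C^\infty(Y^{[2]},G)$, $A\in\Omega^1(Y,\mathfrak g)$ with $g_{ik}=g_{ij}g_{jk}$ and $A_j=g_{ij}^{-1}A_ig_{ij}+g_{ij}^{-1}dg_{ij}$. A *gauge transformation* $(g,A)\to(\tilde g,\tilde A)$ is $a\in C^\infty(Y,G)$ with $\tilde g_{ij}=a_i^{-1}g_{ij}a_j$ and $\tilde A_i=a_i^{-1}A_ia_i+a_i^{-1}da_i$. *Descent data of a principal $\mathcal LG=(L_0G\hookrightarrow P_0G)$-bundle with adjusted connection*: $h^\circ\in C^\infty(Y^{[3]},L_0G)$, $g^\circ\in C^\infty(Y^{[2]},P_0G)$, $\Lambda^\circ\in\Omega^1(Y^{[2]},L_0\mathfrak g)$, $A^\circ\in\Omega^1(Y,P_0\mathfrak g)$, $B^\circ\in\Omega^2(Y,L_0\mathfrak g)$ such that, with $F_i^\circ=dA_i^\circ+\frac12[A_i^\circ,A_i^\circ]+B_i^\circ$ and $h\nabla_ih^{-1}=h\,dh^{-1}+hA_i^\circ h^{-1}-A_i^\circ$, $$\begin{aligned} h^\circ_{ikl}h^\circ_{ijk}&=h^\circ_{ijl}(g^\circ_{ij}\triangleright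 h^\circ_{jkl}),\qquad g^\circ_{ik}=h^\circ_{ijk}g^\circ_{ij}g^\circ_{jk},\\ \Lambda^\circ_{ik}&=\Lambda^\circ_{jk}+g_{jk}^{\circ-1}\triangleright\Lambda^\circ_{ij}-g_{ik}^{\circ-1}\triangleright(h^\circ_{ijk}\nabla_ih_{ijk}^{\circ-1}),\\ A^\circ_j&=g_{ij}^{\circ-1}A^\circ_ig^\circ_{ij}+g_{ij}^{\circ-1}dg^\circ_{ij}-\Lambda^\circ_{ij},\\ B^\circ_j&=g_{ij}^{\circ-1}\triangleright B^\circ_i+d\Lambda^\circ_{ij}+A^\circ_j\triangleright\Lambda^\circ_{ij}+\tfrac12[\Lambda^\circ_{ij},\Lambda^\circ_{ij}]-\kappa(g_{ij}^{\circ-1},F^\circ_i). \end{aligned}$$ The *adjusted fake-curvature condition* is $P(F^\circ_i)=(\mathrm{id}-\wp\cdot\flat)(F_i^\circ)=0$. An *adjusted gauge transformation* to $(\tilde h^\circ,\tilde g^\circ,\tilde\Lambda^\circ,\tilde A^\circ,\tilde B^\circ)$ is $(a^\circ,b^\circ,\lambda^\circ)$ with $a^\circ\in C^\infty(Y,P_0G)$,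 $b^\circ\in C^\infty(Y^{[2]},L_0G)$, $\lambda^\circ\in\Omega^1(Y,L_0\mathfrak g)$ and (all $\circ$ omitted) $$\begin{aligned} \tilde h_{ijk}&=a_i^{-1}\triangleright\big(b_{ik}h_{ijk}(g_{ij}\triangleright b_{jk}^{-1})b_{ij}^{-1}\big),\qquad \tilde g_{ij}=a_i^{-1}b_{ij}g_{ij}a_j,\\ \tilde\Lambda_{ij}&=a_j^{-1}\triangleright\Lambda_{ij}+\lambda_j-\tilde g_{ij}^{-1}\triangleright\lambda_i+(a_j^{-1}g_{ij}^{-1})\triangleright(b_{ij}^{-1}\nabla_ib_{ij}),\\ \tilde A_i&=a_i^{-1}A_ia_i+a_i^{-1}da_i-\lambda_i,\\ \tilde B_i&=a_i^{-1}\triangleright B_i+d\lambda_i+\tilde A_i\triangleright\lambda_i+\tfrac12[\lambda_i,\lambda_i]-\kappa(a_i^{-1},F_i). \end{aligned}$$ An *adjusted higher gauge transformation* $(a,b,\lambda)\Rightarrow(\tilde a,\tilde b,\tilde\lambda)$ between two such gauge transformations with the same source and target is $m\in C^\infty(Y,L_0G)$ with $\tilde b_{ij}=m_ib_{ij}(g_{ij}\triangleright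 m_j^{-1})$, $\tilde a_i=m_ia_i$, $\tilde\lambda_i=\lambda_i+a_i^{-1}\triangleright(m_i^{-1}\nabla_im_i)$. **Proposition.** Descent data of principal $G$-bundles with connection and descent data of principal $\mathcal LG$-bundles with adjusted connection satisfying the adjusted fake-curvature condition are equivalent, in the following sense. 1. (*Lifting.*) Let $(g,A)$ be descent data of a principal $G$-bundle with connection. There is $g^\circ\in C^\infty(Y^{[2]},P_0G)$ with $\flat(g^\circ)=g$, and for every such $g^\circ$, $$h^\circ_{ijk}=g^\circ_{ik}g_{jk}^{\circ-1}g_{ij}^{\circ-1},\quad A_i^\circ=\wp A_i,\quad B_i^\circ=\tfrac12(\wp-\wp^2)[A_i,A_i],\quad \Lambda^\circ_{ij}=g_{ij}^{\circ-1}A^\circ_ig^\circ_{ij}+g_{ij}^{\circ-1}dg^\circ_{ij}-A^\circ_j$$ defines descent data of a principal $\mathcal LG$-bundle with adjusted connection satisfying the adjusted fake-curvature condition. 2. (*Projecting.*) If $(h^\circ,g^\circ,\Lambda^\circ,A^\circ,B^\circ)$ are descent data of a principal $\mathcal LG$-bundle with adjusted connection satisfying the adjusted fake-curvature condition, then $g=\flat(g^\circ)$,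 $A=\flat(A^\circ)$ are descent data of a principal $G$-bundle with connection. 3. Projecting any lift of $(g,A)$ gives back $(g,A)$. 4. If $(\tilde h^\circ,\tilde g^\circ,\tilde\Lambda^\circ,\tilde A^\circ,\tilde B^\circ)$ is any lift of the projection of descent data $(h^\circ,g^\circ,\Lambda^\circ,A^\circ,B^\circ)$ satisfying the adjusted fake-curvature condition, then $a^\circ_i=1$, $b^\circ_{ij}=\tilde g^\circ_{ij}g_{ij}^{\circ-1}$, $\lambda^\circ_i=(\mathrm{id}-\wp\cdot\flat)(A_i^\circ)$ is an adjusted gauge transformation from the latter to the former. 5. (*Gauge and higher gauge transformations.*) Let $D^\circ=(h^\circ,g^\circ,\Lambda^\circ,A^\circ,B^\circ)$ and $\tilde D^\circ=(\tilde h^\circ,\tilde g^\circ,\tilde\Lambda^\circ,\tilde A^\circ,\tilde B^\circ)$ satisfy the adjusted fake-curvature condition, with projections $D$, $\tilde D$. Then $D^\circ,\tilde D^\circ$ are linked by an adjusted gauge transformation iff $D,\tilde D$ are linked by a gauge transformation. More precisely: (a) if $(a^\circ,b^\circ,\lambda^\circ):D^\circ\to\tilde D^\circ$ is an adjusted gauge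 transformation, then $\flat(a^\circ):D\to\tilde D$ is a gauge transformation; (b) for every gauge transformation $a:D\to\tilde D$ there is $a^\circ\in C^\infty(Y,P_0G)$ with $\flat(a^\circ)=a$, and every such $a^\circ$ is the first component of exactly one adjusted gauge transformation $D^\circ\to\tilde D^\circ$, namely the one with $b^\circ_{ij}=a^\circ_i\tilde g^\circ_{ij}a_j^{\circ-1}g_{ij}^{\circ-1}$ and $\lambda^\circ_i=a_i^{\circ-1}A^\circ_ia^\circ_i+a_i^{\circ-1}da^\circ_i-\tilde A^\circ_i$; (c) two adjusted gauge transformations $(a^\circ,b^\circ,\lambda^\circ),(\tilde a^\circ,\tilde b^\circ,\tilde\lambda^\circ):D^\circ\to\tilde D^\circ$ satisfy $\flat(a^\circ)=\flat(\tilde a^\circ)$ iff they are linked by an adjusted higher gauge transformation, which is then $m^\circ_i=\tilde a^\circ_i(a_i^\circ)^{-1}$. -/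

import Mathlib

open scoped Manifold ContDiff

noncomputable section

namespace LoopBundle

/-! ### Fibre powers of a cover, and their smooth parametrisations -/

/-- The Cartesian spaces `ℝᵐ`. -/
abbrev TestSpace (m : ℕ) : Type := EuclideanSpace ℝ (Fin m)

section FibrePowers

variable {EY HY : Type*} [NormedAddCommGroup EY] [NormedSpace ℝ EY] [TopologicalSpace HY]
  (IY : ModelWithCorners ℝ EY HY)
  {Y X : Type*} [TopologicalSpace Y] [ChartedSpace HY Y]

/-- The fibre product `Y^{[n]} = Y ×_X ⋯ ×_X Y` (`n` factors) of a map `σ : Y → X`. The model `IY`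
is recorded because it determines which maps into `Y^{[n]}` are smooth. -/
def FibrePower (_IY : ModelWithCorners ℝ EY HY) (σ : Y → X) (n : ℕ) : Type _ :=
  {y : Fin n → Y // ∀ i j, σ (y i) = σ (y j)}

instance (σ : Y → X) (n : ℕ) : TopologicalSpace (FibrePower IY σ n) :=
  inferInstanceAs (TopologicalSpace {y : Fin n → Y // ∀ i j, σ (y i) = σ (y j)})

/-- The smooth structure of `Y^{[n]}`, as a subspace of `Y^n`: a map `ℝᵐ → Y^{[n]}` is smooth iff
its `n` components `ℝᵐ → Y` are. For a submersion `σ` this is the smooth structure of the embedded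
submanifold `Y^{[n]} ⊆ Y^n`. -/
instance (σ : Y → X) (n : ℕ) : DiffeologicalSpace (FibrePower IY σ n) :=
  .ofCorePlotsOn {
    isPlotOn := fun {m u} _ p => ∀ i, ContMDiffOn 𝓘(ℝ, TestSpace m) IY ∞ (fun x => (p x).1 i) u
    isPlotOn_congr := fun {_ u} _ p q h =>
      forall_congr' fun i => contMDiffOn_congr fun x hx => by simp only [h hx]
    isPlot := fun {m} p => ∀ i, ContMDiff 𝓘(ℝ, TestSpace m) IY ∞ (fun x => (p x).1 i)
    isPlotOn_univ := forall_congr' fun _ => contMDiffOn_univ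
    isPlot_const := fun _ _ => contMDiff_const
    isPlotOn_reparam := fun _ _ _ h hp hf i =>
      (hp i).comp hf.contMDiffOn h.subset_preimage
    locality := fun _ _ h i x hx => by
      obtain ⟨v, hv, hxv, hv'⟩ := h x hx
      exact ((hv' i x hxv).contMDiffAt (hv.mem_nhds hxv)).contMDiffWithinAt }

variable {IY}

/-- `(y₀, …, y_{n-1}) ↦ (y_{s 0}, …, y_{s (m-1)})`; these are the projections by means of which
data on `Y^{[m]}` are pulled back to `Y^{[n]}`. -/
def FibrePower.sub {σ : Y → X} {n m : ℕ} (y : FibrePower IY σ n) (s : Fin m → Fin n) :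
    FibrePower IY σ m :=
  ⟨fun i => y.1 (s i), fun _ _ => y.2 _ _⟩

end FibrePowers

/-- A smooth map `ℝᵐ → M`. -/
def Plot (M : Type*) [DiffeologicalSpace M] (m : ℕ) : Type _ :=
  {p : TestSpace m → M // Diffeology.IsPlot p}

instance (M : Type*) [DiffeologicalSpace M] (m : ℕ) :
    CoeFun (Plot M m) (fun _ => TestSpace m → M) := ⟨Subtype.val⟩

/-- Precomposition with a smooth map between Cartesian spaces. -/
def Plot.comp {M : Type*} [DiffeologicalSpace M] {m n : ℕ} (p : Plot M m)
    (f : TestSpace n → TestSpace m) (hf : ContDiff ℝ ∞ f) : Plot M n :=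
  ⟨p.1 ∘ f, Diffeology.isPlot_reparam p.2 hf⟩

section

variable {EY HY : Type*} [NormedAddCommGroup EY] [NormedSpace ℝ EY] [TopologicalSpace HY]
  {IY : ModelWithCorners ℝ EY HY}
  {Y X : Type*} [TopologicalSpace Y] [ChartedSpace HY Y]

/-- Postcomposition of a smooth map `ℝᵐ → Y^{[n]}` with a projection `Y^{[n]} → Y^{[k]}`. -/
def Plot.sub {σ : Y → X} {m n k : ℕ} (p : Plot (FibrePower IY σ n) m) (s : Fin k → Fin n) :
    Plot (FibrePower IY σ k) m :=
  ⟨fun u => (p u).sub s, fun i => p.2 (s i)⟩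

variable {EX HX : Type*} [NormedAddCommGroup EX] [NormedSpace ℝ EX] [TopologicalSpace HX]
  [TopologicalSpace X] [ChartedSpace HX X]

/-- A topological space that is a disjoint union of contractible (open) subspaces. -/
def IsDisjointUnionOfContractibles (M : Type*) [TopologicalSpace M] : Prop :=
  ∃ 𝒰 : Set (Set M), (∀ U ∈ 𝒰, IsOpen U ∧ ContractibleSpace U) ∧
    𝒰.PairwiseDisjoint id ∧ ⋃₀ 𝒰 = Set.univ

/-- A good cover: a surjective submersion `σ : Y → X` all of whose fibre powers `Y^{[n]}`, `n ≥ 1`,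
are disjoint unions of contractible spaces. -/
structure IsGoodCover (IY : ModelWithCorners ℝ EY HY) (IX : ModelWithCorners ℝ EX HX)
    (σ : Y → X) : Prop where
  submersion : Manifold.IsSubmersion IY IX ∞ σ
  surjective : Function.Surjective σ
  contractible : ∀ n, 1 ≤ n → IsDisjointUnionOfContractibles (FibrePower IY σ n)

end

/-! ### Differential forms -/

/-- A smooth differential `k`-form on `M` with values in `V`, given by its pullbacks along all
smooth maps `ℝᵐ → M`: these are smooth forms on `ℝᵐ`, compatible with reparametrisation. -/
structure DForm (M : Type*) [DiffeologicalSpace M] (k : ℕ)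
    (V : Type*) [NormedAddCommGroup V] [NormedSpace ℝ V] where
  toFun : ∀ {m : ℕ}, Plot M m → TestSpace m → TestSpace m [⋀^Fin k]→L[ℝ] V
  smooth : ∀ {m : ℕ} (p : Plot M m), ContDiff ℝ ∞ (toFun p)
  natural : ∀ {m n : ℕ} (p : Plot M m) (f : TestSpace n → TestSpace m) (hf : ContDiff ℝ ∞ f)
    (u : TestSpace n),
    toFun (p.comp f hf) u = (toFun p (f u)).compContinuousLinearMap (fderiv ℝ f u)

/-- `Ω^k(M, P₀V)` for the path space `P₀V = {γ ∈ C^∞([0,1], V) | γ(0) = 0}`: a family of `V`-valued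
`k`-forms that depends smoothly on `t ∈ [0,1]` (jointly with the point), and vanishes at `t = 0`. -/
structure PathForm (M : Type*) [DiffeologicalSpace M] (k : ℕ)
    (V : Type*) [NormedAddCommGroup V] [NormedSpace ℝ V] where
  at' : unitInterval → DForm M k V
  smooth : ∀ {m : ℕ} (p : Plot M m),
    ContMDiff (𝓘(ℝ, TestSpace m).prod (𝓡∂ 1)) 𝓘(ℝ, TestSpace m [⋀^Fin k]→L[ℝ] V) ∞
      (fun z : TestSpace m × unitInterval => (at' z.2).toFun p z.1)
  start : ∀ {m : ℕ} (p : Plot M m) (u : TestSpace m), (at' 0).toFun p u = 0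

/-- `Ω^k(M, L₀V)` for the loop space `L₀V = {γ ∈ P₀V | γ(1) = 0}`. The inclusion `L₀V ↪ P₀V` is
`LoopForm.toPathForm`. -/
structure LoopForm (M : Type*) [DiffeologicalSpace M] (k : ℕ)
    (V : Type*) [NormedAddCommGroup V] [NormedSpace ℝ V] extends PathForm M k V where
  endpoint : ∀ {m : ℕ} (p : Plot M m) (u : TestSpace m), (at' 1).toFun p u = 0

instance (M : Type*) [DiffeologicalSpace M] (k : ℕ)
    (V : Type*) [NormedAddCommGroup V] [NormedSpace ℝ V] :
    CoeFun (DForm M k V)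
      (fun _ => ∀ {m : ℕ}, Plot M m → TestSpace m → TestSpace m [⋀^Fin k]→L[ℝ] V) :=
  ⟨DForm.toFun⟩

instance (M : Type*) [DiffeologicalSpace M] (k : ℕ)
    (V : Type*) [NormedAddCommGroup V] [NormedSpace ℝ V] :
    CoeFun (PathForm M k V) (fun _ => unitInterval → DForm M k V) := ⟨PathForm.at'⟩

instance (M : Type*) [DiffeologicalSpace M] (k : ℕ)
    (V : Type*) [NormedAddCommGroup V] [NormedSpace ℝ V] :
    CoeFun (LoopForm M k V) (fun _ => unitInterval → DForm M k V) := ⟨fun η => η.at'⟩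

/-! ### The Lie group `G` and its Lie algebra -/

section LieGroupCalculus

variable {EG HG : Type*} [NormedAddCommGroup EG] [NormedSpace ℝ EG] [TopologicalSpace HG]
  (IG : ModelWithCorners ℝ EG HG)
  {G : Type*} [TopologicalSpace G] [ChartedSpace HG G] [Group G]

variable (G) in
/-- The Lie bracket of `𝔤 = T₁G`, which as a vector space is the model space `EG`. -/
def bracket (v w : EG) : EG :=
  Bracket.bracket (L := GroupLieAlgebra IG G) (M := GroupLieAlgebra IG G) v w

/-- The adjoint action `V ↦ g V g⁻¹` of `g ∈ G` on `𝔤`. -/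
def Ad (g : G) : EG →L[ℝ] EG :=
  (mfderiv IG IG (fun x : G => g * x * g⁻¹) 1 :)

/-- The adjoint action on `𝔤`-valued forms. -/
def adForm (g : G) {m k : ℕ} (η : TestSpace m [⋀^Fin k]→L[ℝ] EG) :
    TestSpace m [⋀^Fin k]→L[ℝ] EG :=
  (Ad IG g).compContinuousAlternatingMap η

/-- The `𝔤`-valued 1-form `g⁻¹ dg` of a smooth map `g : ℝᵐ → G`, at the point `u`. -/
def logForm {m : ℕ} (g : TestSpace m → G) (u : TestSpace m) :
    TestSpace m [⋀^Fin 1]→L[ℝ] EG :=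
  ContinuousAlternatingMap.ofSubsingleton ℝ (TestSpace m) EG (0 : Fin 1)
    (mfderiv 𝓘(ℝ, TestSpace m) IG (fun u' => (g u)⁻¹ * g u') u : TestSpace m →L[ℝ] EG)

/-- `g⁻¹ A g + g⁻¹ dg`, at the point `u`. -/
def gaugeTransform {m : ℕ} (g : TestSpace m → G)
    (A : TestSpace m → TestSpace m [⋀^Fin 1]→L[ℝ] EG) (u : TestSpace m) :
    TestSpace m [⋀^Fin 1]→L[ℝ] EG :=
  adForm IG (g u)⁻¹ (A u) + logForm IG g u

/-- `h⁻¹ ∇ h = h⁻¹ dh + h⁻¹ (A ▷ h)`, at the point `u`, where `∇ = d + A ▷` and `▷` is the linearised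
action of `𝔤` by conjugation, so that `h⁻¹ (A ▷ h) = h⁻¹ A h - A`. -/
def nablaLog {m : ℕ} (h : TestSpace m → G)
    (A : TestSpace m → TestSpace m [⋀^Fin 1]→L[ℝ] EG) (u : TestSpace m) :
    TestSpace m [⋀^Fin 1]→L[ℝ] EG :=
  logForm IG h u + (adForm IG (h u)⁻¹ (A u) - A u)

variable (G) in
/-- The value on a pair of tangent vectors of the 2-form `[α, β]` built from `𝔤`-valued 1-forms
by the wedge product and the Lie bracket. -/
def wedgeBracket {m : ℕ} (α β : TestSpace m [⋀^Fin 1]→L[ℝ] EG) (v : Fin 2 → TestSpace m) : EG :=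
  bracket IG G (α ![v 0]) (β ![v 1]) - bracket IG G (α ![v 1]) (β ![v 0])

variable (G) in
/-- The curvature `dA + ½[A, A]` at the point `u`, on a pair of tangent vectors. -/
def curvature {m : ℕ} (A : TestSpace m → TestSpace m [⋀^Fin 1]→L[ℝ] EG) (u : TestSpace m)
    (v : Fin 2 → TestSpace m) : EG :=
  extDeriv A u v + (1 / 2 : ℝ) • wedgeBracket IG G (A u) (A u) v

/-- The map `P = id - ℘ · ♭` on paths. -/
def loopPart (wp : unitInterval → ℝ) (V : unitInterval → EG) : unitInterval → EG :=
  fun t => V t - wp t • V 1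

/-- The adjustment `κ(g, V) = P(g V g⁻¹ - V)`. -/
def kappa (wp : unitInterval → ℝ) (g : unitInterval → G) (V : unitInterval → EG) :
    unitInterval → EG :=
  loopPart wp fun t => Ad IG (g t) (V t) - V t

/-! ### The based path and loop groups -/

variable [LieGroup IG ∞ G]

variable (G) in
/-- The based path group `P₀G = {γ ∈ C^∞([0,1], G) | γ(0) = 1}`, with the pointwise product. -/
def PathGroup : Subgroup (unitInterval → G) where
  carrier := {γ | ContMDiff (𝓡∂ 1) IG ∞ γ ∧ γ 0 = 1}
  mul_mem' := fun ha hb => ⟨ha.1.mul hb.1, by simp [ha.2, hb.2]⟩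
  one_mem' := ⟨contMDiff_const, rfl⟩
  inv_mem' := fun ha => ⟨ha.1.inv, by simp [ha.2]⟩

variable (G) in
/-- The endpoint evaluation `♭ : P₀G → G`, `γ ↦ γ(1)`. -/
def flat : PathGroup IG G →* G where
  toFun γ := γ.1 1
  map_one' := rfl
  map_mul' _ _ := rfl

variable (G) in
/-- The based loop group `L₀G = {γ ∈ P₀G | γ(1) = 1}`, a normal subgroup of `P₀G`. -/
abbrev LoopGroup : Subgroup (PathGroup IG G) := (flat IG G).ker

/-- The action `g ▷ h = g h g⁻¹` of `P₀G` on `L₀G`. -/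
def act (g : PathGroup IG G) (h : LoopGroup IG G) : LoopGroup IG G := MulAut.conjNormal g h

/-- Smoothness of a map into `G`. -/
def SmoothMap {M : Type*} [DiffeologicalSpace M] (f : M → G) : Prop :=
  ∀ (m : ℕ) (p : Plot M m), ContMDiff 𝓘(ℝ, TestSpace m) IG ∞ fun u => f (p u)

/-- Smoothness of a map into the Fréchet-Lie group `P₀G`: the value at time `t ∈ [0,1]` depends
smoothly on the point and on `t` jointly. -/
def SmoothPathMap {M : Type*} [DiffeologicalSpace M] (f : M → PathGroup IG G) : Prop :=
  ∀ (m : ℕ) (p : Plot M m), ContMDiff (𝓘(ℝ, TestSpace m).prod (𝓡∂ 1)) IG ∞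
    fun z : TestSpace m × unitInterval => (f (p z.1)).1 z.2

end LieGroupCalculus

/-! ### Descent data -/

section DescentData

variable {EY HY : Type*} [NormedAddCommGroup EY] [NormedSpace ℝ EY] [TopologicalSpace HY]
  (IY : ModelWithCorners ℝ EY HY)
  {Y X : Type*} [TopologicalSpace Y] [ChartedSpace HY Y] (σ : Y → X)
  {EG HG : Type*} [NormedAddCommGroup EG] [NormedSpace ℝ EG] [TopologicalSpace HG]
  (IG : ModelWithCorners ℝ EG HG)
  (G : Type*) [TopologicalSpace G] [ChartedSpace HG G] [Group G] [LieGroup IG ∞ G]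

/-- Descent data of an ordinary principal `G`-bundle with connection. -/
structure BundleData where
  g : FibrePower IY σ 2 → G
  A : DForm (FibrePower IY σ 1) 1 EG
  smooth_g : SmoothMap IG g
  /-- `g_ik = g_ij g_jk` -/
  cocycle_g : ∀ y : FibrePower IY σ 3, g (y.sub ![0, 2]) = g (y.sub ![0, 1]) * g (y.sub ![1, 2])
  /-- `A_j = g_ij⁻¹ A_i g_ij + g_ij⁻¹ dg_ij` -/
  cocycle_A : ∀ (m : ℕ) (p : Plot (FibrePower IY σ 2) m) (u : TestSpace m),
    A (p.sub ![1]) u = gaugeTransform IG (fun u => g (p u)) (A (p.sub ![0])) u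

variable {IY σ IG G}

/-- Gauge transformations between ordinary principal `G`-bundles with connection. -/
structure BundleGauge (D D' : BundleData IY σ IG G) where
  a : FibrePower IY σ 1 → G
  smooth_a : SmoothMap IG a
  /-- `g'_ij = a_i⁻¹ g_ij a_j` -/
  rel_g : ∀ y : FibrePower IY σ 2, D'.g y = (a (y.sub ![0]))⁻¹ * D.g y * a (y.sub ![1])
  /-- `A'_i = a_i⁻¹ A_i a_i + a_i⁻¹ da_i` -/
  rel_A : ∀ (m : ℕ) (p : Plot (FibrePower IY σ 1) m) (u : TestSpace m),
    D'.A p u = gaugeTransform IG (fun u => a (p u)) (D.A p) u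

variable (IG G) in
/-- The adjusted curvature 2-form `F = dA + ½[A, A] + t(B)` of `(A, B)`, at the point `u`, on a pair
of tangent vectors, as a path in `𝔤`. -/
def fakeCurvature (A : PathForm (FibrePower IY σ 1) 1 EG) (B : LoopForm (FibrePower IY σ 1) 2 EG)
    {m : ℕ} (p : Plot (FibrePower IY σ 1) m) (u : TestSpace m) (v : Fin 2 → TestSpace m) :
    unitInterval → EG :=
  fun t => curvature IG G (A t p) u v + B t p u v

variable (IY σ IG G)

/-- Descent data of a principal `𝓛G`-bundle with adjusted connection, for the crossed module
`𝓛G = (L₀G ↪ P₀G, Ad)` with the adjustment `κ` determined by `wp`. Equations between path-valued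
forms are stated at each time `t`. -/
structure AdjustedData (wp : unitInterval → ℝ) where
  h : FibrePower IY σ 3 → LoopGroup IG G
  g : FibrePower IY σ 2 → PathGroup IG G
  Λ : LoopForm (FibrePower IY σ 2) 1 EG
  A : PathForm (FibrePower IY σ 1) 1 EG
  B : LoopForm (FibrePower IY σ 1) 2 EG
  smooth_h : SmoothPathMap IG fun y => (h y : PathGroup IG G)
  smooth_g : SmoothPathMap IG g
  /-- `h_ikl h_ijk = h_ijl (g_ij ▷ h_jkl)` -/
  cocycle_h : ∀ y : FibrePower IY σ 4,
    h (y.sub ![0, 2, 3]) * h (y.sub ![0, 1, 2]) =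
      h (y.sub ![0, 1, 3]) * act IG (g (y.sub ![0, 1])) (h (y.sub ![1, 2, 3]))
  /-- `g_ik = t(h_ijk) g_ij g_jk` -/
  cocycle_g : ∀ y : FibrePower IY σ 3,
    g (y.sub ![0, 2]) = (h y : PathGroup IG G) * g (y.sub ![0, 1]) * g (y.sub ![1, 2])
  /-- `Λ_ik = Λ_jk + g_jk⁻¹ ▷ Λ_ij - g_ik⁻¹ ▷ (h_ijk ∇_i h_ijk⁻¹)` -/
  cocycle_Λ : ∀ (m : ℕ) (p : Plot (FibrePower IY σ 3) m) (u : TestSpace m) (t : unitInterval),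
    Λ t (p.sub ![0, 2]) u =
      Λ t (p.sub ![1, 2]) u
        + adForm IG ((g ((p u).sub ![1, 2])).1 t)⁻¹ (Λ t (p.sub ![0, 1]) u)
        - adForm IG ((g ((p u).sub ![0, 2])).1 t)⁻¹
            (nablaLog IG (fun u => ((h (p u)).1.1 t)⁻¹) (A t (p.sub ![0])) u)
  /-- `A_j = g_ij⁻¹ A_i g_ij + g_ij⁻¹ dg_ij - t(Λ_ij)` -/
  cocycle_A : ∀ (m : ℕ) (p : Plot (FibrePower IY σ 2) m) (u : TestSpace m) (t : unitInterval),
    A t (p.sub ![1]) u =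
      gaugeTransform IG (fun u => (g (p u)).1 t) (A t (p.sub ![0])) u - Λ t p u
  /-- `B_j = g_ij⁻¹ ▷ B_i + dΛ_ij + A_j ▷ Λ_ij + ½[Λ_ij, Λ_ij] - κ(g_ij⁻¹, F_i)` -/
  cocycle_B : ∀ (m : ℕ) (p : Plot (FibrePower IY σ 2) m) (u : TestSpace m)
      (v : Fin 2 → TestSpace m) (t : unitInterval),
    B t (p.sub ![1]) u v =
      Ad IG ((g (p u)).1 t)⁻¹ (B t (p.sub ![0]) u v)
        + extDeriv (Λ t p) u v
        + wedgeBracket IG G (A t (p.sub ![1]) u) (Λ t p u) v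
        + (1 / 2 : ℝ) • wedgeBracket IG G (Λ t p u) (Λ t p u) v
        - kappa IG wp (fun s => ((g (p u)).1 s)⁻¹)
            (fakeCurvature IG G A B (p.sub ![0]) u v) t

variable {IY σ IG G} {wp : unitInterval → ℝ}

/-- The adjusted fake-curvature condition `(id - ℘ · ♭)(F) = 0`. -/
def AdjustedData.FakeFlat (D : AdjustedData IY σ IG G wp) : Prop :=
  ∀ (m : ℕ) (p : Plot (FibrePower IY σ 1) m) (u : TestSpace m) (v : Fin 2 → TestSpace m),
    loopPart wp (fakeCurvature IG G D.A D.B p u v) = 0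

/-- Adjusted gauge transformations (coboundaries) `(a, b, l) : D → D'`. -/
structure AdjustedGauge (D D' : AdjustedData IY σ IG G wp) where
  a : FibrePower IY σ 1 → PathGroup IG G
  b : FibrePower IY σ 2 → LoopGroup IG G
  l : LoopForm (FibrePower IY σ 1) 1 EG
  smooth_a : SmoothPathMap IG a
  smooth_b : SmoothPathMap IG fun y => (b y : PathGroup IG G)
  /-- `h'_ijk = a_i⁻¹ ▷ (b_ik h_ijk (g_ij ▷ b_jk⁻¹) b_ij⁻¹)` -/
  rel_h : ∀ y : FibrePower IY σ 3,
    D'.h y = act IG (a (y.sub ![0]))⁻¹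
      (b (y.sub ![0, 2]) * D.h y * act IG (D.g (y.sub ![0, 1])) (b (y.sub ![1, 2]))⁻¹
        * (b (y.sub ![0, 1]))⁻¹)
  /-- `g'_ij = a_i⁻¹ t(b_ij) g_ij a_j` -/
  rel_g : ∀ y : FibrePower IY σ 2,
    D'.g y = (a (y.sub ![0]))⁻¹ * (b y : PathGroup IG G) * D.g y * a (y.sub ![1])
  /-- `Λ'_ij = a_j⁻¹ ▷ Λ_ij + l_j - g'_ij⁻¹ ▷ l_i + (a_j⁻¹ g_ij⁻¹) ▷ (b_ij⁻¹ ∇_i b_ij)` -/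
  rel_Λ : ∀ (m : ℕ) (p : Plot (FibrePower IY σ 2) m) (u : TestSpace m) (t : unitInterval),
    D'.Λ t p u =
      adForm IG ((a ((p u).sub ![1])).1 t)⁻¹ (D.Λ t p u)
        + l t (p.sub ![1]) u
        - adForm IG ((D'.g (p u)).1 t)⁻¹ (l t (p.sub ![0]) u)
        + adForm IG (((a ((p u).sub ![1])).1 t)⁻¹ * ((D.g (p u)).1 t)⁻¹)
            (nablaLog IG (fun u => (b (p u)).1.1 t) (D.A t (p.sub ![0])) u)
  /-- `A'_i = a_i⁻¹ A_i a_i + a_i⁻¹ da_i - t(l_i)` -/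
  rel_A : ∀ (m : ℕ) (p : Plot (FibrePower IY σ 1) m) (u : TestSpace m) (t : unitInterval),
    D'.A t p u = gaugeTransform IG (fun u => (a (p u)).1 t) (D.A t p) u - l t p u
  /-- `B'_i = a_i⁻¹ ▷ B_i + dl_i + A'_i ▷ l_i + ½[l_i, l_i] - κ(a_i⁻¹, F_i)` -/
  rel_B : ∀ (m : ℕ) (p : Plot (FibrePower IY σ 1) m) (u : TestSpace m)
      (v : Fin 2 → TestSpace m) (t : unitInterval),
    D'.B t p u v =
      Ad IG ((a (p u)).1 t)⁻¹ (D.B t p u v)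
        + extDeriv (l t p) u v
        + wedgeBracket IG G (D'.A t p u) (l t p u) v
        + (1 / 2 : ℝ) • wedgeBracket IG G (l t p u) (l t p u) v
        - kappa IG wp (fun s => ((a (p u)).1 s)⁻¹) (fakeCurvature IG G D.A D.B p u v) t

/-- `n` is an adjusted higher gauge transformation from `c = (a, b, l)` to `c' = (a', b', l')`. -/
structure IsHigherGauge {D D' : AdjustedData IY σ IG G wp} (c c' : AdjustedGauge D D')
    (n : FibrePower IY σ 1 → LoopGroup IG G) : Prop where
  smooth : SmoothPathMap IG fun y => (n y : PathGroup IG G)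
  /-- `b'_ij = n_i b_ij (g_ij ▷ n_j⁻¹)` -/
  rel_b : ∀ y : FibrePower IY σ 2,
    c'.b y = n (y.sub ![0]) * c.b y * act IG (D.g y) (n (y.sub ![1]))⁻¹
  /-- `a'_i = t(n_i) a_i` -/
  rel_a : ∀ y : FibrePower IY σ 1, c'.a y = (n y : PathGroup IG G) * c.a y
  /-- `l'_i = l_i + a_i⁻¹ ▷ (n_i⁻¹ ∇_i n_i)` -/
  rel_l : ∀ (m : ℕ) (p : Plot (FibrePower IY σ 1) m) (u : TestSpace m) (t : unitInterval),
    c'.l t p u = c.l t p u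
      + adForm IG ((c.a (p u)).1 t)⁻¹ (nablaLog IG (fun u => (n (p u)).1.1 t) (D.A t p) u)

/-! ### Lifting and projecting descent data -/

/-- `D°` is a lift of `D` along endpoint evaluation: `♭(g°) = g`,
`h°_ijk = g°_ik g°_jk⁻¹ g°_ij⁻¹`, `A° = ℘ A`, `B° = ½(℘ - ℘²)[A, A]` and
`Λ°_ij = g°_ij⁻¹ A°_i g°_ij + g°_ij⁻¹ dg°_ij - A°_j`. -/
structure IsLift (D : BundleData IY σ IG G) (D' : AdjustedData IY σ IG G wp) : Prop where
  g_eq : ∀ y, flat IG G (D'.g y) = D.g y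
  h_eq : ∀ y : FibrePower IY σ 3, (D'.h y : PathGroup IG G) =
    D'.g (y.sub ![0, 2]) * (D'.g (y.sub ![1, 2]))⁻¹ * (D'.g (y.sub ![0, 1]))⁻¹
  A_eq : ∀ (m : ℕ) (p : Plot (FibrePower IY σ 1) m) (u : TestSpace m) (t : unitInterval),
    D'.A t p u = wp t • D.A p u
  B_eq : ∀ (m : ℕ) (p : Plot (FibrePower IY σ 1) m) (u : TestSpace m)
      (v : Fin 2 → TestSpace m) (t : unitInterval),
    D'.B t p u v = ((1 / 2 : ℝ) * (wp t - wp t ^ 2)) • wedgeBracket IG G (D.A p u) (D.A p u) v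
  Λ_eq : ∀ (m : ℕ) (p : Plot (FibrePower IY σ 2) m) (u : TestSpace m) (t : unitInterval),
    D'.Λ t p u = gaugeTransform IG (fun u => (D'.g (p u)).1 t) (D'.A t (p.sub ![0])) u
      - D'.A t (p.sub ![1]) u

/-- `D` is the projection of `D°` by endpoint evaluation: `g = ♭(g°)` and `A = ♭(A°)`. -/
structure IsProjection (D' : AdjustedData IY σ IG G wp) (D : BundleData IY σ IG G) : Prop where
  g_eq : ∀ y, D.g y = flat IG G (D'.g y)
  A_eq : ∀ (m : ℕ) (p : Plot (FibrePower IY σ 1) m) (u : TestSpace m), D.A p u = D'.A 1 p u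

end DescentData

end LoopBundle

end

/-!
Four mechanisms make the endpoint evaluation `♭ : P₀G → G` an equivalence on descent data.

*Forced components.* In adjusted descent data, the equations `g_ik = h_ijk g_ij g_jk` and
`A_j = g_ij⁻¹ A_i g_ij + g_ij⁻¹ dg_ij - Λ_ij` determine `h` and `Λ` by `g` and `A`; likewise, `b`
and `l` of a gauge transformation are determined by `a`, and a higher gauge transformation by the two
gauge transformations that it links. All laws for the forced components then hold identically: those
for the group-valued ones are identities in a group, and those for the 1-forms express that gauge
transformations form a right action (`gaugeTransform_cocycle`, `gaugeTransform_coboundary`,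
`gaugeTransform_higher`). That the forced components are loops, i.e. trivial at `t = 1`, is the
corresponding equation for the data of the principal `G`-bundle.

*The adjustment.* The law for the 2-form `B` amounts to the gauge covariance of the curvature
`F = dA + ½[A, A] + B`, corrected by `κ`. Fake flatness says that `F(t) = ℘(t) F(1)`, so that `F` is
determined by its value at the endpoint, where `B` vanishes and the curvature of `A` is gauge
covariant (`transform_B`). The lift `(℘ A, ½(℘ - ℘²)[A, A])` is fake flat as its curvature is `℘`
times that of `A` (`curvature_smul`). Covariance of the curvature follows from the Maurer–Cartan
equation (`maurerCartan`), which also yields the derivative of the adjoint representation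
(`fderiv_Ad_inv`) and its compatibility with the bracket (`bracketL_Ad`).

*Lifting.* A smooth map from the double fibre product to `G` is continuous
(`SmoothMap.continuous`), hence homotopic to the constant map `1` on each contractible component.
The homotopy, which may be taken to be constant near both ends, is a continuous map from
`Y^{[2]} × ℝ` to `G` that is smooth outside of a closed time interval; it is made smooth by
modifications in charts of `G` (`exists_smoothing`), without changing it at the ends. Restriction to
the diagonal gives the analogous statement over `Y` (`exists_smoothPathMap_one`).

*Smoothness without a manifold structure.* The fibre product is only a closed subspace of `Y × Y`
with a notion of smooth maps from `ℝᵐ`. The smooth cutoff functions and approximations that the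
smoothing procedure needs are restricted from the ambient manifold `(Y × Y) × ℝ`.
-/

noncomputable section

namespace LoopBundle

open Filter Topology

set_option linter.unusedSectionVars false

/-! ### Derivatives of maps to a Lie group at the identity -/

section

variable {EG HG : Type*} [NormedAddCommGroup EG] [NormedSpace ℝ EG] [TopologicalSpace HG]
  {IG : ModelWithCorners ℝ EG HG}
  {G : Type*} [TopologicalSpace G] [ChartedSpace HG G] [Group G]
  {E' : Type*} [NormedAddCommGroup E'] [NormedSpace ℝ E']
  {E'' : Type*} [NormedAddCommGroup E''] [NormedSpace ℝ E'']

variable (IG) in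
/-- The derivative at `u` of a map `f` from a normed space to `G` with `f u = 1`, as a map into the
model space of `G`. The definition does not depend on `f u = 1`, but it is meaningful only then:
in general the value of `mfderiv` lies in another tangent space. -/
def derivOne (f : E' → G) (u : E') : E' →L[ℝ] EG := (mfderiv 𝓘(ℝ, E') IG f u :)

variable (IG) in
/-- The pullback `g⁻¹ dg` of the Maurer–Cartan form along a map `g` from a normed space to `G`. -/
def mcForm (g : E' → G) (u : E') : E' →L[ℝ] EG := derivOne IG (fun u' => (g u)⁻¹ * g u') u

variable (IG G) in
/-- The preferred chart of `G` at the identity. -/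
def oneChart : PartialEquiv G EG := extChartAt IG (1 : G)

lemma derivOne_eq_fderiv {f : E' → G} {u : E'} (h : f u = 1)
    (hf : MDifferentiableAt 𝓘(ℝ, E') IG f u) :
    derivOne IG f u = fderiv ℝ (fun x => oneChart IG G (f x)) u := by
  unfold derivOne mfderiv
  refine (if_pos hf).trans ?_
  simp only [writtenInExtChartAt, h, extChartAt_model_space_eq_id, oneChart]
  simp [fderivWithin_univ, Function.comp_def]

lemma derivOne_comp {f : E' → G} {k : E'' → E'} {u : E''}
    (hf : MDifferentiableAt 𝓘(ℝ, E') IG f (k u))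
    (hk : DifferentiableAt ℝ k u) :
    derivOne IG (fun x => f (k x)) u = (derivOne IG f (k u)).comp (fderiv ℝ k u) := by
  have := mfderiv_comp (I := 𝓘(ℝ, E'')) (I' := 𝓘(ℝ, E')) (I'' := IG) u hf hk.mdifferentiableAt
  rw [mfderiv_eq_fderiv] at this
  exact this

lemma derivOne_congr {f f' : E' → G} {u : E'} (h : f =ᶠ[𝓝 u] f') :
    derivOne IG f u = derivOne IG f' u := by
  exact h.mfderiv_eq

lemma derivOne_const (c : G) (u : E') : derivOne IG (fun _ : E' => c) u = 0 :=
  mfderiv_const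

lemma oneChart_left_inv : ∀ᶠ g in 𝓝 (1 : G), (oneChart IG G).symm (oneChart IG G g) = g := by
  filter_upwards [extChartAt_source_mem_nhds (I := IG) (1 : G)] with g hg
  exact (extChartAt IG (1 : G)).left_inv hg

@[simp] lemma oneChart_symm_apply_one : (oneChart IG G).symm (oneChart IG G 1) = 1 :=
  extChartAt_to_inv (I := IG) (1 : G)

section
variable [IG.Boundaryless]

lemma oneChart_target_mem_nhds : (oneChart IG G).target ∈ 𝓝 (oneChart IG G 1) :=
  extChartAt_target_mem_nhds (I := IG) (1 : G)

lemma isOpen_oneChart_target : IsOpen (oneChart IG G).target :=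
  isOpen_extChartAt_target (I := IG) (1 : G)

variable [LieGroup IG ∞ G]

lemma contMDiffAt_oneChart_symm {x : EG} (hx : x ∈ (oneChart IG G).target) :
    ContMDiffAt 𝓘(ℝ, EG) IG ∞ (oneChart IG G).symm x :=
  (contMDiffOn_extChartAt_symm (n := ∞) (I := IG) (1 : G)).contMDiffAt
    (isOpen_oneChart_target.mem_nhds hx)

lemma contMDiffAt_oneChart_symm_one :
    ContMDiffAt 𝓘(ℝ, EG) IG ∞ (oneChart IG G).symm (oneChart IG G 1) :=
  contMDiffAt_oneChart_symm (mem_of_mem_nhds oneChart_target_mem_nhds)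

lemma mdifferentiableAt_oneChart_symm_one :
    MDifferentiableAt 𝓘(ℝ, EG) IG (oneChart IG G).symm (oneChart IG G 1) :=
  contMDiffAt_oneChart_symm_one.mdifferentiableAt (by simp)

omit [IG.Boundaryless] in
lemma contMDiffAt_oneChart : ContMDiffAt IG 𝓘(ℝ, EG) ∞ (oneChart IG G) 1 :=
  contMDiffAt_extChartAt (n := ∞)

lemma derivOne_oneChart_symm :
    derivOne IG (oneChart IG G).symm (oneChart IG G 1) = ContinuousLinearMap.id ℝ EG := by
  rw [derivOne_eq_fderiv (by simp) mdifferentiableAt_oneChart_symm_one]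
  have : (fun x => oneChart IG G ((oneChart IG G).symm x)) =ᶠ[𝓝 (oneChart IG G 1)] id := by
    filter_upwards [oneChart_target_mem_nhds (IG := IG) (G := G)] with x hx
    exact (oneChart IG G).right_inv hx
  rw [this.fderiv_eq, fderiv_id]

omit [IG.Boundaryless] in
lemma differentiableAt_oneChart_comp {f : E' → G} {u : E'} (h : f u = 1)
    (hf : MDifferentiableAt 𝓘(ℝ, E') IG f u) :
    DifferentiableAt ℝ (fun x => oneChart IG G (f x)) u := by
  have h1 : MDifferentiableAt IG 𝓘(ℝ, EG) (oneChart IG G) (f u) := by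
    rw [h]; exact contMDiffAt_oneChart.mdifferentiableAt (by simp)
  exact (h1.comp u hf).differentiableAt

/-- A map `F ∘ f` with `f u = 1` and `F` defined near the identity is differentiated by passing to
the chart at the identity. -/
lemma derivOne_comp_chart {F : G → G} {f : E' → G} {u : E'} (h : f u = 1)
    (hF : MDifferentiableAt IG IG F 1) (hf : MDifferentiableAt 𝓘(ℝ, E') IG f u) :
    derivOne IG (fun x => F (f x)) u =
      (derivOne IG (fun y => F ((oneChart IG G).symm y)) (oneChart IG G 1)).comp
        (derivOne IG f u) := by
  have e : (fun x => F (f x)) =ᶠ[𝓝 u]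
      fun x => F ((oneChart IG G).symm (oneChart IG G (f x))) := by
    have := hf.continuousAt.eventually (h ▸ oneChart_left_inv (IG := IG) (G := G))
    filter_upwards [this] with x hx
    rw [hx]
  rw [derivOne_congr e, derivOne_eq_fderiv h hf]
  have hF' : MDifferentiableAt 𝓘(ℝ, EG) IG (fun y => F ((oneChart IG G).symm y))
      (oneChart IG G (f u)) := by
    rw [h]
    refine MDifferentiableAt.comp (I' := IG) (oneChart IG G 1) ?_
      mdifferentiableAt_oneChart_symm_one
    rwa [oneChart_symm_apply_one]
  have := derivOne_comp (k := fun x => oneChart IG G (f x)) hF'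
    (differentiableAt_oneChart_comp h hf)
  rw [this, h]

/-- The derivative of the multiplication at `(1, 1)` is the addition: in the chart at the identity,
it restricts to the identity on both factors. -/
lemma derivOne_mul {f g : E' → G} {u : E'} (hf : MDifferentiableAt 𝓘(ℝ, E') IG f u)
    (hg : MDifferentiableAt 𝓘(ℝ, E') IG g u) (hfu : f u = 1) (hgu : g u = 1) :
    derivOne IG (fun u => f u * g u) u = derivOne IG f u + derivOne IG g u := by
  set e := oneChart IG G 1
  set ψ := (oneChart IG G).symm
  have hψ : MDifferentiableAt 𝓘(ℝ, EG) IG ψ e := mdifferentiableAt_oneChart_symm_one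
  have hψe : ψ e = 1 := oneChart_symm_apply_one
  let m : EG × EG → G := fun z => ψ z.1 * ψ z.2
  have hm : MDifferentiableAt 𝓘(ℝ, EG × EG) IG m (e, e) := by
    have h1 : MDifferentiableAt 𝓘(ℝ, EG × EG) IG (fun z : EG × EG => ψ z.1) (e, e) :=
      MDifferentiableAt.comp (I' := 𝓘(ℝ, EG)) (e, e) hψ differentiableAt_fst.mdifferentiableAt
    have h2 : MDifferentiableAt 𝓘(ℝ, EG × EG) IG (fun z : EG × EG => ψ z.2) (e, e) :=
      MDifferentiableAt.comp (I' := 𝓘(ℝ, EG)) (e, e) hψ differentiableAt_snd.mdifferentiableAt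
    have h3 : MDifferentiableAt (IG.prod IG) IG (fun z : G × G => z.1 * z.2) (ψ e, ψ e) :=
      (contMDiff_mul IG ∞).mdifferentiable (by simp) _
    exact MDifferentiableAt.comp (I' := IG.prod IG) (e, e) h3 (h1.prodMk h2)
  have e1 : (fun u => f u * g u) =ᶠ[𝓝 u]
      fun x => m ((oneChart IG G (f x)), (oneChart IG G (g x))) := by
    have h1 := hf.continuousAt.eventually (hfu ▸ oneChart_left_inv (IG := IG) (G := G))
    have h2 := hg.continuousAt.eventually (hgu ▸ oneChart_left_inv (IG := IG) (G := G))
    filter_upwards [h1, h2] with x h1 h2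
    simp [m, ψ, h1, h2]
  have hdf := differentiableAt_oneChart_comp hfu hf
  have hdg := differentiableAt_oneChart_comp hgu hg
  have h0 := derivOne_comp (IG := IG) (f := m)
    (k := fun x => (oneChart IG G (f x), oneChart IG G (g x))) (u := u)
    (by simpa [hfu, hgu] using hm) (hdf.prodMk hdg)
  have hl : (derivOne IG m (e, e)).comp (ContinuousLinearMap.inl ℝ EG EG) =
      ContinuousLinearMap.id ℝ EG := by
    have hk : HasFDerivAt (fun x : EG => (x, e)) (ContinuousLinearMap.inl ℝ EG EG) e :=
      hasFDerivAt_prodMk_left e e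
    have := derivOne_comp (IG := IG) (f := m) (k := fun x : EG => (x, e)) (u := e) hm
      hk.differentiableAt
    rw [hk.fderiv] at this
    rw [← this, ← derivOne_oneChart_symm (IG := IG) (G := G)]
    simp [m, hψe, ψ, e]
  have hr : (derivOne IG m (e, e)).comp (ContinuousLinearMap.inr ℝ EG EG) =
      ContinuousLinearMap.id ℝ EG := by
    have hk : HasFDerivAt (fun x : EG => (e, x)) (ContinuousLinearMap.inr ℝ EG EG) e :=
      hasFDerivAt_prodMk_right e e
    have := derivOne_comp (IG := IG) (f := m) (k := fun x : EG => (e, x)) (u := e) hm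
      hk.differentiableAt
    rw [hk.fderiv] at this
    rw [← this, ← derivOne_oneChart_symm (IG := IG) (G := G)]
    simp [m, hψe, ψ, e]
  rw [derivOne_congr e1, h0, (hdf.hasFDerivAt.prodMk hdg.hasFDerivAt).fderiv, hfu, hgu,
    derivOne_eq_fderiv hfu hf, derivOne_eq_fderiv hgu hg]
  ext v
  have h1 := fun w => DFunLike.congr_fun hl w
  have h2 := fun w => DFunLike.congr_fun hr w
  simp only [ContinuousLinearMap.comp_apply, ContinuousLinearMap.inl_apply,
    ContinuousLinearMap.inr_apply, ContinuousLinearMap.id_apply] at h1 h2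
  set a := (fderiv ℝ (fun x => (oneChart IG G) (f x)) u) v
  set b := (fderiv ℝ (fun x => (oneChart IG G) (g x)) u) v
  calc derivOne IG m (e, e) (a, b)
      = derivOne IG m (e, e) ((a, 0) + (0, b)) := by simp
    _ = a + b := by rw [map_add, h1, h2]

/-! ### The adjoint representation -/

omit [IG.Boundaryless] in
lemma mdifferentiable_conj (c : G) : MDifferentiable IG IG (fun x : G => c * x * c⁻¹) :=
  ((contMDiff_const (c := c)).mul contMDiff_id |>.mul (contMDiff_const (c := c⁻¹))
    : ContMDiff IG IG ∞ fun x : G => c * x * c⁻¹).mdifferentiable (by simp)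

/-- In the definition of `Ad`, the tangent space at `1` may be replaced by the chart at `1`. -/
lemma Ad_eq_derivOne (c : G) :
    Ad IG c = derivOne IG (fun y => c * (oneChart IG G).symm y * c⁻¹) (oneChart IG G 1) := by
  have h1 := mfderiv_comp (I := 𝓘(ℝ, EG)) (I' := IG) (I'' := IG) (oneChart IG G 1)
    (mdifferentiable_conj c _) (mdifferentiableAt_oneChart_symm_one (IG := IG) (G := G))
  have h2 := derivOne_oneChart_symm (IG := IG) (G := G)
  have key : ∀ x : G, x = 1 → ∀ L : EG →L[ℝ] EG, L = ContinuousLinearMap.id ℝ EG →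
      (show EG →L[ℝ] EG from mfderiv IG IG (fun x : G => c * x * c⁻¹) x).comp L = Ad IG c := by
    rintro x rfl L rfl
    rfl
  exact (key _ oneChart_symm_apply_one _ h2).symm.trans h1.symm

lemma derivOne_conj (c : G) {f : E' → G} {u : E'} (h : f u = 1)
    (hf : MDifferentiableAt 𝓘(ℝ, E') IG f u) :
    derivOne IG (fun x => c * f x * c⁻¹) u = (Ad IG c).comp (derivOne IG f u) := by
  rw [Ad_eq_derivOne]
  exact derivOne_comp_chart (F := fun x => c * x * c⁻¹) h (mdifferentiable_conj c _) hf

@[simp] lemma Ad_one : Ad IG (1 : G) = ContinuousLinearMap.id ℝ EG := by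
  rw [Ad_eq_derivOne, ← derivOne_oneChart_symm (IG := IG) (G := G)]
  simp

lemma Ad_mul (c d : G) : Ad IG (c * d) = (Ad IG c).comp (Ad IG d) := by
  rw [Ad_eq_derivOne (c * d), Ad_eq_derivOne d, ← derivOne_conj c]
  · congr 1; ext y; group
  · simp
  · refine MDifferentiableAt.comp (I' := IG) (oneChart IG G 1) (mdifferentiable_conj d _)
      mdifferentiableAt_oneChart_symm_one

/-! ### The Maurer–Cartan form -/

omit [IG.Boundaryless] in
lemma mdifferentiableAt_const_mul (c : G) {g : E' → G} {u : E'}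
    (hg : MDifferentiableAt 𝓘(ℝ, E') IG g u) :
    MDifferentiableAt 𝓘(ℝ, E') IG (fun x => c * g x) u :=
  MDifferentiableAt.comp (I' := IG) u
    ((contMDiff_mul_left (n := ∞) (a := c)).mdifferentiable (by simp) _) hg

/-- `(gh)⁻¹ d(gh) = h⁻¹ (g⁻¹ dg) h + h⁻¹ dh`. -/
lemma mcForm_mul {g h : E' → G} {u : E'} (hg : MDifferentiableAt 𝓘(ℝ, E') IG g u)
    (hh : MDifferentiableAt 𝓘(ℝ, E') IG h u) :
    mcForm IG (fun x => g x * h x) u = (Ad IG (h u)⁻¹).comp (mcForm IG g u) + mcForm IG h u := by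
  have hg' := mdifferentiableAt_const_mul (g u)⁻¹ hg
  have hh' := mdifferentiableAt_const_mul (h u)⁻¹ hh
  have h1 : MDifferentiableAt 𝓘(ℝ, E') IG (fun x => (h u)⁻¹ * ((g u)⁻¹ * g x) * (h u)⁻¹⁻¹) u :=
    MDifferentiableAt.comp (I' := IG) u (mdifferentiable_conj (h u)⁻¹ _) hg'
  unfold mcForm
  rw [← derivOne_conj _ (by simp) hg', ← derivOne_mul h1 hh' (by simp) (by simp)]
  congr 1; ext x; group

lemma mcForm_const_mul (c : G) (g : E' → G) (u : E') :
    mcForm IG (fun x => c * g x) u = mcForm IG g u := by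
  unfold mcForm; congr 1; ext x; group

lemma mcForm_const (c : G) (u : E') : mcForm IG (fun _ : E' => c) u = 0 :=
  derivOne_const _ _

lemma mcForm_comp {g : E' → G} {k : E'' → E'} {u : E''}
    (hg : MDifferentiableAt 𝓘(ℝ, E') IG g (k u)) (hk : DifferentiableAt ℝ k u) :
    mcForm IG (fun x => g (k x)) u = (mcForm IG g (k u)).comp (fderiv ℝ k u) :=
  derivOne_comp (mdifferentiableAt_const_mul _ hg) hk

lemma mcForm_congr {f f' : E' → G} {u : E'} (h : f =ᶠ[𝓝 u] f') :
    mcForm IG f u = mcForm IG f' u := by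
  unfold mcForm
  rw [h.self_of_nhds]
  exact derivOne_congr (h.mono fun x hx => by simp [hx])

end
end

section

variable {EG HG : Type*} [NormedAddCommGroup EG] [NormedSpace ℝ EG] [TopologicalSpace HG]
  {IG : ModelWithCorners ℝ EG HG}
  {G : Type*} [TopologicalSpace G] [ChartedSpace HG G] [Group G]
  {E' : Type*} [NormedAddCommGroup E'] [NormedSpace ℝ E']
  {E'' : Type*} [NormedAddCommGroup E''] [NormedSpace ℝ E'']
  [IG.Boundaryless] [LieGroup IG ∞ G]

/-! ### Smooth dependence on parameters -/

variable {EZ HZ : Type*} [NormedAddCommGroup EZ] [NormedSpace ℝ EZ] [TopologicalSpace HZ]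
  {IZ : ModelWithCorners ℝ EZ HZ} {Z : Type*} [TopologicalSpace Z] [ChartedSpace HZ Z]
  [IsManifold IZ ∞ Z]

/-- The condition `f z (p z) = 1` keeps the derivatives in the single tangent space `T₁G`, so that
no change of coordinates occurs. -/
lemma contMDiffAt_derivOne {f : Z → E' → G} {p : Z → E'} {z₀ : Z}
    (hf : ContMDiffAt (IZ.prod 𝓘(ℝ, E')) IG ∞ (Function.uncurry f) (z₀, p z₀))
    (hp : ContMDiffAt IZ 𝓘(ℝ, E') ∞ p z₀) (h1 : ∀ z, f z (p z) = 1) :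
    ContMDiffAt IZ 𝓘(ℝ, E' →L[ℝ] EG) ∞ (fun z => derivOne IG (f z) (p z)) z₀ := by
  have : IsManifold IG 1 G := .of_le (n := ∞) (by simp)
  have : IsManifold IZ 1 Z := .of_le (n := ∞) (by simp)
  have := ContMDiffAt.mfderiv (I := 𝓘(ℝ, E')) (I' := IG) (m := ∞) (n := ∞) f p hf hp (by simp)
  refine this.congr_of_eventuallyEq (Eventually.of_forall fun z => ?_)
  refine Eq.trans ?_ (inTangentCoordinates_eq (I := 𝓘(ℝ, E')) (I' := IG) p (fun x => f x (p x))
    (fun z => derivOne IG (f z) (p z)) (x₀ := z₀) (x := z)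
    (mem_chart_source E' (p z)) (by rw [h1, h1]; exact mem_chart_source HG 1)).symm
  ext v
  have key : ∀ (g g' : G), g = g' → ∀ w : EG,
      (tangentBundleCore IG G).coordChange (achart HG g) (achart HG g') g w = w := by
    rintro g _ rfl w
    exact (tangentBundleCore IG G).coordChange_self _ _ (mem_chart_source HG g) w
  have key2 : ∀ (u u' u'' : E') (w : E'),
      (tangentBundleCore 𝓘(ℝ, E') E').coordChange (achart E' u) (achart E' u') u'' w = w := by
    intro u u' u'' w
    simp
  have e1 := key (f z (p z)) (f z₀ (p z₀)) ((h1 z).trans (h1 z₀).symm) (derivOne IG (f z) (p z) v)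
  have e2 := key2 (p z₀) (p z) (p z) v
  refine e1.symm.trans ?_
  nth_rewrite 1 [← e2]
  rfl

lemma contMDiffAt_mcForm {f : Z → E' → G} {p : Z → E'} {z₀ : Z}
    (hf : ContMDiffAt (IZ.prod 𝓘(ℝ, E')) IG ∞ (Function.uncurry f) (z₀, p z₀))
    (hp : ContMDiffAt IZ 𝓘(ℝ, E') ∞ p z₀) :
    ContMDiffAt IZ 𝓘(ℝ, E' →L[ℝ] EG) ∞ (fun z => mcForm IG (f z) (p z)) z₀ := by
  unfold mcForm
  refine contMDiffAt_derivOne (f := fun z u => (f z (p z))⁻¹ * f z u) ?_ hp (by simp)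
  have h1 : ContMDiffAt IZ IG ∞ (fun z => f z (p z)) z₀ :=
    ContMDiffAt.comp (g := Function.uncurry f) (f := fun z => (z, p z)) z₀ hf
      (contMDiffAt_id.prodMk hp)
  have h2 : ContMDiffAt (IZ.prod 𝓘(ℝ, E')) IG ∞ (fun z : Z × E' => f z.1 (p z.1)) (z₀, p z₀) :=
    ContMDiffAt.comp (g := fun z => f z (p z)) (f := Prod.fst) (z₀, p z₀) h1 contMDiffAt_fst
  exact h2.inv.mul hf

lemma contMDiffAt_Ad {c : Z → G} {z₀ : Z} (hc : ContMDiffAt IZ IG ∞ c z₀) :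
    ContMDiffAt IZ 𝓘(ℝ, EG →L[ℝ] EG) ∞ (fun z => Ad IG (c z)) z₀ := by
  simp_rw [Ad_eq_derivOne]
  refine contMDiffAt_derivOne (f := fun z y => c z * (oneChart IG G).symm y * (c z)⁻¹)
    (p := fun _ => oneChart IG G 1) ?_ contMDiffAt_const (by simp)
  have h2 : ContMDiffAt (IZ.prod 𝓘(ℝ, EG)) IG ∞ (fun z : Z × EG => c z.1)
      (z₀, oneChart IG G 1) :=
    ContMDiffAt.comp (g := c) (f := Prod.fst) (z₀, oneChart IG G 1) hc contMDiffAt_fst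
  have h3 : ContMDiffAt (IZ.prod 𝓘(ℝ, EG)) IG ∞ (fun z : Z × EG => (oneChart IG G).symm z.2)
      (z₀, oneChart IG G 1) :=
    ContMDiffAt.comp (g := (oneChart IG G).symm) (f := Prod.snd) (z₀, oneChart IG G 1)
      contMDiffAt_oneChart_symm_one contMDiffAt_snd
  exact (h2.mul h3).mul h2.inv

lemma contDiffAt_mcForm {g : E' → G} {u : E'} (hg : ContMDiffAt 𝓘(ℝ, E') IG ∞ g u) :
    ContDiffAt ℝ ∞ (mcForm IG g) u := by
  have := contMDiffAt_mcForm (IZ := 𝓘(ℝ, E')) (f := fun _ : E' => g) (p := id) (z₀ := u)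
    (ContMDiffAt.comp (g := g) (f := Prod.snd) (u, u) hg contMDiffAt_snd) contMDiffAt_id
  exact this.contDiffAt

/-! ### The Maurer–Cartan equation -/

/-- The Maurer–Cartan form in the chart at the identity. -/
def chartForm (IG : ModelWithCorners ℝ EG HG) (G : Type*) [TopologicalSpace G] [ChartedSpace HG G]
    [Group G] : EG → EG →L[ℝ] EG := mcForm IG (oneChart IG G).symm

lemma contDiffAt_chartForm : ContDiffAt ℝ ∞ (chartForm IG G) (oneChart IG G 1) :=
  contDiffAt_mcForm contMDiffAt_oneChart_symm_one

lemma chartForm_one : chartForm IG G (oneChart IG G 1) = ContinuousLinearMap.id ℝ EG := by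
  rw [chartForm, mcForm, ← derivOne_oneChart_symm (IG := IG) (G := G)]
  simp

variable (IG G) in
/-- The left-invariant vector field of `v`, in the chart at the identity. -/
def leftField (v x : EG) : EG :=
  VectorField.mpullback 𝓘(ℝ, EG) IG (oneChart IG G).symm
    (fun g : G => mulInvariantVectorField (I := IG) (G := G) v g) x

/-- The Maurer–Cartan form sends the left-invariant vector field of `v` to the constant `v`. -/
lemma chartForm_leftField {x : EG} (hx : x ∈ (oneChart IG G).target) (v : EG) :
    chartForm IG G x (leftField IG G v x) = v := by
  have : IsManifold IG 1 G := .of_le (n := ∞) (by simp)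
  set ψ := (oneChart IG G).symm
  have hψ : MDifferentiableAt 𝓘(ℝ, EG) IG ψ x :=
    (contMDiffAt_oneChart_symm hx).mdifferentiableAt (by simp)
  have hinv : (mfderiv 𝓘(ℝ, EG) IG ψ x).IsInvertible := by
    have := isInvertible_mfderivWithin_extChartAt_symm (I := IG) (x := (1 : G)) hx
    rw [IG.range_eq_univ, mfderivWithin_univ] at this
    exact this
  have hl : MDifferentiable IG IG (fun z : G => (ψ x)⁻¹ * z) :=
    (contMDiff_mul_left (n := ∞)).mdifferentiable (by simp)
  have hr : MDifferentiable IG IG (fun z : G => (ψ x) * z) :=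
    (contMDiff_mul_left (n := ∞)).mdifferentiable (by simp)
  have h1 := mfderiv_comp (I := 𝓘(ℝ, EG)) (I' := IG) (I'' := IG) x (hl _) hψ
  have h2 := mfderiv_comp_of_eq (I := IG) (I' := IG) (I'' := IG) (x := (1 : G)) (y := ψ x)
    (hl _) (hr _) (mul_one _)
  have h3 : ((fun z : G => (ψ x)⁻¹ * z) ∘ fun z : G => (ψ x) * z) = id := by ext; simp
  rw [h3, mfderiv_id] at h2
  have h4 : (mfderiv 𝓘(ℝ, EG) IG ψ x) ((mfderiv 𝓘(ℝ, EG) IG ψ x).inverse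
    (mulInvariantVectorField (I := IG) (G := G) v (ψ x))) =
      mulInvariantVectorField (I := IG) (G := G) v (ψ x) := hinv.self_apply_inverse _
  have h5 := congrArg (mfderiv IG IG (fun z : G => (ψ x)⁻¹ * z) (ψ x)) h4
  have h6 := DFunLike.congr_fun h1 ((mfderiv 𝓘(ℝ, EG) IG ψ x).inverse
    (mulInvariantVectorField (I := IG) (G := G) v (ψ x)))
  have h7 := DFunLike.congr_fun h2 v
  have h8 : ∀ y : G, y = ψ x → ∀ w : EG,
      (show EG →L[ℝ] EG from mfderiv IG IG (fun z : G => (ψ x)⁻¹ * z) y) w =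
        (show EG →L[ℝ] EG from mfderiv IG IG (fun z : G => (ψ x)⁻¹ * z) (ψ x)) w := by
    rintro _ rfl w
    rfl
  exact (h6.trans h5).trans ((h8 _ (mul_one _) _).symm.trans h7.symm)

/-- The bracket of `𝔤` is the Lie bracket at the identity of left-invariant vector fields, written
in the chart at the identity, whose derivative there is the identity of the model space. -/
lemma bracket_eq_chart (v w : EG) :
    bracket IG G v w = VectorField.lieBracket ℝ
      (leftField IG G v) (leftField IG G w) (oneChart IG G 1) := by
  have : IsManifold IG 1 G := .of_le (n := ∞) (by simp)
  have h2 : ∀ L : EG →L[ℝ] EG, L = ContinuousLinearMap.id ℝ EG → ∀ x, L.inverse x = x := by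
    rintro _ rfl x
    simp
  have h3 : (show EG →L[ℝ] EG from mfderiv IG 𝓘(ℝ, EG) (extChartAt IG (1 : G)) 1) =
      ContinuousLinearMap.id ℝ EG := by
    have h1 : MDifferentiableAt IG 𝓘(ℝ, EG) (extChartAt IG (1 : G)) 1 :=
      contMDiffAt_oneChart.mdifferentiableAt (by simp)
    unfold mfderiv
    refine (if_pos h1).trans ?_
    have h4 : writtenInExtChartAt IG 𝓘(ℝ, EG) (1 : G) (extChartAt IG (1 : G))
        =ᶠ[𝓝 (extChartAt IG (1 : G) 1)] id := by
      filter_upwards [oneChart_target_mem_nhds (IG := IG) (G := G)] with x hx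
      exact (oneChart IG G).right_inv hx
    rw [IG.range_eq_univ, fderivWithin_univ]
    exact h4.fderiv_eq.trans fderiv_id
  refine Eq.trans (h2 _ h3 _) ?_
  simp only [IG.range_eq_univ, Set.preimage_univ, Set.inter_univ,
    VectorField.mpullbackWithin_univ]
  exact congrFun VectorField.lieBracketWithin_univ _

/-- The Lie bracket of `𝔤` in terms of the derivative of the Maurer–Cartan form `θ` at the identity:
the left-invariant vector field of `v` is `θ⁻¹ v`, whose derivative at the identity is `-(dθ) v`. -/
lemma bracket_eq_fderiv_chartForm (v w : EG) [FiniteDimensional ℝ EG] :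
    bracket IG G v w = fderiv ℝ (chartForm IG G) (oneChart IG G 1) w v
      - fderiv ℝ (chartForm IG G) (oneChart IG G 1) v w := by
  have := FiniteDimensional.complete ℝ EG
  set e := oneChart IG G 1
  set θ := chartForm IG G
  have hθ : ContDiffAt ℝ ∞ θ e := contDiffAt_chartForm
  have hθ1 : θ e = ContinuousLinearMap.id ℝ EG := chartForm_one
  have hinv : ∀ᶠ x in 𝓝 e, (θ x).IsInvertible := by
    have h1 : {L : EG →L[ℝ] EG | L.IsInvertible} ∈ 𝓝 (θ e) := by
      rw [hθ1]
      exact (ContinuousLinearEquiv.nhds (ContinuousLinearEquiv.refl ℝ EG))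
    exact hθ.continuousAt.eventually h1
  have hV : ∀ v : EG, (leftField IG G v) =ᶠ[𝓝 e]
      fun x => (θ x).inverse v := by
    intro v
    filter_upwards [hinv, oneChart_target_mem_nhds (IG := IG) (G := G)] with x hx hx'
    exact ((hx.inverse_apply_eq).2 (chartForm_leftField hx' v).symm).symm
  have hd : ∀ v w : EG, fderiv ℝ (fun x => (θ x).inverse v) e w = - fderiv ℝ θ e w v := by
    intro v w
    have h1 : DifferentiableAt ℝ (fun x => (θ x).inverse) e := by
      have h2 : DifferentiableAt ℝ (ContinuousLinearMap.inverse : (EG →L[ℝ] EG) → _) (θ e) := by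
        rw [hθ1]
        exact (contDiffAt_map_inverse (n := ∞) (ContinuousLinearEquiv.refl ℝ EG)).differentiableAt
          (by simp)
      exact h2.comp e (hθ.differentiableAt (by simp))
    have h3 : (fun x => θ x ((θ x).inverse v)) =ᶠ[𝓝 e] fun _ => v := by
      filter_upwards [hinv] with x hx
      exact hx.self_apply_inverse v
    have h4 := h3.fderiv_eq (𝕜 := ℝ)
    have h5 : DifferentiableAt ℝ (fun x => (θ x).inverse v) e := h1.clm_apply (by fun_prop)
    rw [fderiv_clm_apply (hθ.differentiableAt (by simp)) h5] at h4
    have h6 := DFunLike.congr_fun h4 w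
    simp [hθ1] at h6
    exact eq_neg_of_add_eq_zero_left h6
  rw [bracket_eq_chart]
  change fderiv ℝ _ e _ - fderiv ℝ _ e _ = _
  rw [(hV v).fderiv_eq, (hV w).fderiv_eq,
    (hV v).eq_of_nhds, (hV w).eq_of_nhds, hd, hd]
  simp [hθ1]
  abel

variable [FiniteDimensional ℝ EG]

variable (IG G) in
/-- The Lie bracket of `𝔤` as a continuous bilinear map. -/
def bracketL : EG →L[ℝ] EG →L[ℝ] EG :=
  (fderiv ℝ (chartForm IG G) (oneChart IG G 1)).flip - fderiv ℝ (chartForm IG G) (oneChart IG G 1)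

lemma bracket_eq_bracketL (v w : EG) : bracket IG G v w = bracketL IG G v w :=
  bracket_eq_fderiv_chartForm v w

lemma bracketL_swap (v w : EG) : bracketL IG G v w = - bracketL IG G w v := by
  simp [bracketL]

lemma contMDiffAt_const_mul (c : G) {g : E' → G} {u : E'}
    (hg : ContMDiffAt 𝓘(ℝ, E') IG ∞ g u) : ContMDiffAt 𝓘(ℝ, E') IG ∞ (fun x => c * g x) u :=
  contMDiffAt_const.mul hg

/-- The Maurer–Cartan equation `dθ + ½[θ, θ] = 0` for `θ = g⁻¹ dg`. -/
lemma maurerCartan {g : E' → G} {u : E'} (hg : ContMDiffAt 𝓘(ℝ, E') IG ∞ g u) (v w : E') :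
    fderiv ℝ (mcForm IG g) u v w - fderiv ℝ (mcForm IG g) u w v
      + bracketL IG G (mcForm IG g u v) (mcForm IG g u w) = 0 := by
  -- Left translation reduces to the case `g u = 1`, in which the chart at the identity applies.
  wlog h1 : g u = 1 generalizing g
  · have := this (contMDiffAt_const_mul (g u)⁻¹ hg) (by simp)
    have h2 : mcForm IG (fun x => (g u)⁻¹ * g x) = mcForm IG g := by
      ext1 x; exact mcForm_const_mul _ _ _
    rwa [h2] at this
  set k : E' → EG := fun x => oneChart IG G (g x)
  have hk : ContDiffAt ℝ ∞ k u := by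
    have h2 : ContMDiffAt IG 𝓘(ℝ, EG) ∞ (oneChart IG G) (g u) := h1 ▸ contMDiffAt_oneChart
    exact (ContMDiffAt.comp (I' := IG) u h2 hg).contDiffAt
  have hku : k u = oneChart IG G 1 := by simp [k, h1]
  have e1 : g =ᶠ[𝓝 u] fun x => (oneChart IG G).symm (k x) := by
    have := hg.continuousAt.eventually (h1 ▸ oneChart_left_inv (IG := IG) (G := G))
    filter_upwards [this] with x hx using hx.symm
  have e2 : mcForm IG g =ᶠ[𝓝 u] fun x => (chartForm IG G (k x)).comp (fderiv ℝ k x) := by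
    have h2 : ∀ᶠ x in 𝓝 u, k x ∈ (oneChart IG G).target :=
      hk.continuousAt.eventually (by rw [hku]; exact oneChart_target_mem_nhds)
    have h3 : ∀ᶠ x in 𝓝 u, DifferentiableAt ℝ k x :=
      ((hk.of_le (m := 1) (by simp)).eventually (by simp)).mono
        fun x hx => hx.differentiableAt (by simp)
    filter_upwards [e1.eventually_nhds, h2, h3] with x hx h2 h3
    rw [mcForm_congr hx,
      mcForm_comp ((contMDiffAt_oneChart_symm h2).mdifferentiableAt (by simp)) h3]
    rfl
  have hθ : DifferentiableAt ℝ (chartForm IG G) (k u) := by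
    rw [hku]; exact contDiffAt_chartForm.differentiableAt (by simp)
  have hdk : DifferentiableAt ℝ (fderiv ℝ k) u :=
    (hk.fderiv_right (m := 1) (by norm_cast)).differentiableAt (by simp)
  have hkd : DifferentiableAt ℝ k u := hk.differentiableAt (by simp)
  have hsymm : fderiv ℝ (fderiv ℝ k) u v w = fderiv ℝ (fderiv ℝ k) u w v :=
    (hk.isSymmSndFDerivAt
    (by rw [minSmoothness_of_isRCLikeNormedField]; exact WithTop.coe_le_coe.2 le_top)).eq v w
  have h3 : ∀ v w, fderiv ℝ (mcForm IG g) u v w =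
      fderiv ℝ (chartForm IG G) (oneChart IG G 1) (fderiv ℝ k u v) (fderiv ℝ k u w)
        + fderiv ℝ (fderiv ℝ k) u v w := by
    intro v w
    have h4 : HasFDerivAt (fun x => chartForm IG G (k x))
        ((fderiv ℝ (chartForm IG G) (k u)).comp (fderiv ℝ k u)) u :=
      hθ.hasFDerivAt.comp u hkd.hasFDerivAt
    rw [e2.fderiv_eq, (h4.clm_comp hdk.hasFDerivAt).fderiv]
    simp [hku, chartForm_one, add_comm]
  rw [h3, h3, hsymm, e2.eq_of_nhds, hku, chartForm_one]
  simp only [bracketL, ContinuousLinearMap.coe_comp, Function.comp_apply,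
    ContinuousLinearMap.id_apply, sub_apply, ContinuousLinearMap.flip_apply]
  abel

end

section

variable {EG HG : Type*} [NormedAddCommGroup EG] [NormedSpace ℝ EG] [TopologicalSpace HG]
  {IG : ModelWithCorners ℝ EG HG}
  {G : Type*} [TopologicalSpace G] [ChartedSpace HG G] [Group G]
  {E' : Type*} [NormedAddCommGroup E'] [NormedSpace ℝ E']
  [IG.Boundaryless] [LieGroup IG ∞ G] [FiniteDimensional ℝ EG]

/-! ### The derivative of the adjoint representation -/

lemma eventually_mdifferentiableAt {g : E' → G} {u : E'} (hg : ContMDiffAt 𝓘(ℝ, E') IG ∞ g u) :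
    ∀ᶠ x in 𝓝 u, MDifferentiableAt 𝓘(ℝ, E') IG g x :=
  have : IsManifold IG 1 G := .of_le (n := ∞) (by simp)
  ((contMDiffAt_iff_contMDiffAt_nhds (n := 1) (by simp)).1 (hg.of_le (by simp))).mono
    fun _ hx => hx.mdifferentiableAt (by simp)

lemma contDiffAt_Ad_inv {k : E' → G} {u : E'} (hk : ContMDiffAt 𝓘(ℝ, E') IG ∞ k u) :
    ContDiffAt ℝ ∞ (fun x => Ad IG (k x)⁻¹) u :=
  (contMDiffAt_Ad (IZ := 𝓘(ℝ, E')) hk.inv).contDiffAt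

/-- `d(Ad(k⁻¹) X) = -[k⁻¹ dk, Ad(k⁻¹) X]`: this is the Maurer–Cartan equation for
`(x, y) ↦ y * k x`, evaluated on one vector tangent to each factor. -/
lemma fderiv_Ad_inv {k : E' → G} {u : E'} (hk : ContMDiffAt 𝓘(ℝ, E') IG ∞ k u) (v : E') (X : EG) :
    fderiv ℝ (fun x => Ad IG (k x)⁻¹) u v X
      = - bracketL IG G (mcForm IG k u v) (Ad IG (k u)⁻¹ X) := by
  set ψ := (oneChart IG G).symm
  set e := oneChart IG G 1
  let F : E' × EG → G := fun z => ψ z.2 * k z.1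
  have hψ2 : ContMDiffAt 𝓘(ℝ, E' × EG) IG ∞ (fun z : E' × EG => ψ z.2) (u, e) :=
    ContMDiffAt.comp (I' := 𝓘(ℝ, EG)) (u, e) contMDiffAt_oneChart_symm_one
      contDiff_snd.contDiffAt.contMDiffAt
  have hk1 : ContMDiffAt 𝓘(ℝ, E' × EG) IG ∞ (fun z : E' × EG => k z.1) (u, e) :=
    ContMDiffAt.comp (I' := 𝓘(ℝ, E')) (u, e) hk contDiff_fst.contDiffAt.contMDiffAt
  have hF : ContMDiffAt 𝓘(ℝ, E' × EG) IG ∞ F (u, e) := hψ2.mul hk1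
  have hΦ : ∀ᶠ z in 𝓝 (u, e), ∀ (v : E') (X : EG), mcForm IG F z (v, X) =
      Ad IG (k z.1)⁻¹ (chartForm IG G z.2 X) + mcForm IG k z.1 v := by
    filter_upwards [eventually_mdifferentiableAt hψ2, eventually_mdifferentiableAt hk1,
      continuousAt_fst.eventually (eventually_mdifferentiableAt hk),
      continuousAt_snd.eventually (eventually_mdifferentiableAt
        (contMDiffAt_oneChart_symm_one (IG := IG) (G := G)))] with z h1 h2 h3 h4 v X
    rw [mcForm_mul h1 h2, mcForm_comp h4 differentiableAt_snd,
      mcForm_comp h3 differentiableAt_fst, fderiv_fst, fderiv_snd]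
    rfl
  have hd := (contDiffAt_mcForm hF).differentiableAt (by simp)
  have hk' := (contDiffAt_Ad_inv hk).differentiableAt (by simp)
  have h1 : fderiv ℝ (mcForm IG F) (u, e) (v, 0) (0, X) =
      fderiv ℝ (fun x => Ad IG (k x)⁻¹) u v X := by
    have h2 : (fun x => mcForm IG F (x, e) (0, X)) =ᶠ[𝓝 u] fun x => Ad IG (k x)⁻¹ X := by
      filter_upwards [(Continuous.prodMk_left e).continuousAt.eventually hΦ] with x hx
      rw [hx, map_zero, add_zero, chartForm_one]
      rfl
    have h3 : HasFDerivAt (fun x => mcForm IG F (x, e))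
        ((fderiv ℝ (mcForm IG F) (u, e)).comp (ContinuousLinearMap.inl ℝ E' EG)) u :=
      HasFDerivAt.comp (g := mcForm IG F) (f := fun x => (x, e)) u hd.hasFDerivAt
        (hasFDerivAt_prodMk_left u e)
    have h4 := (h3.clm_apply (hasFDerivAt_const ((0, X) : E' × EG) u)).fderiv
    have h5 := (hk'.hasFDerivAt.clm_apply (hasFDerivAt_const X u)).fderiv
    rw [h2.fderiv_eq, h5] at h4
    have h6 := DFunLike.congr_fun h4 v
    simp at h6
    exact h6.symm
  have h1' : fderiv ℝ (mcForm IG F) (u, e) (0, X) (v, 0) = 0 := by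
    have h2 : (fun y => mcForm IG F (u, y) (v, 0)) =ᶠ[𝓝 e] fun x => mcForm IG k u v := by
      filter_upwards [(Continuous.prodMk_right u).continuousAt.eventually hΦ] with x hx
      rw [hx, map_zero, map_zero, zero_add]
    have h3 : HasFDerivAt (fun x => mcForm IG F (u, x))
        ((fderiv ℝ (mcForm IG F) (u, e)).comp (ContinuousLinearMap.inr ℝ E' EG)) e :=
      HasFDerivAt.comp (g := mcForm IG F) (f := fun x => (u, x)) e hd.hasFDerivAt
        (hasFDerivAt_prodMk_right u e)
    have h4 := (h3.clm_apply (hasFDerivAt_const ((v, 0) : E' × EG) e)).fderiv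
    rw [h2.fderiv_eq, fderiv_const_apply] at h4
    have h6 := DFunLike.congr_fun h4 X
    simp at h6
    exact h6.symm
  have hmc := maurerCartan hF (v, 0) (0, X)
  have h7 := hΦ.self_of_nhds
  rw [h1, h1', h7, h7, map_zero, map_zero, zero_add, map_zero, add_zero, sub_zero,
    chartForm_one] at hmc
  exact eq_neg_of_add_eq_zero_left hmc

/-- `Ad(c)` is a Lie algebra homomorphism: compare the Maurer–Cartan equations of a chart and of
its conjugate by `c`. -/
lemma bracketL_Ad (c : G) (v w : EG) :
    bracketL IG G (Ad IG c v) (Ad IG c w) = Ad IG c (bracketL IG G v w) := by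
  set ψ := (oneChart IG G).symm
  set e := oneChart IG G 1
  have hψ : ContMDiffAt 𝓘(ℝ, EG) IG ∞ ψ e := contMDiffAt_oneChart_symm_one
  have hF : ContMDiffAt 𝓘(ℝ, EG) IG ∞ (fun x => c * (ψ x * c⁻¹)) e :=
    contMDiffAt_const.mul (hψ.mul contMDiffAt_const)
  have h1 : mcForm IG (fun x => c * (ψ x * c⁻¹)) =ᶠ[𝓝 e]
      fun x => (Ad IG c).comp (chartForm IG G x) := by
    filter_upwards [eventually_mdifferentiableAt hψ] with x hx
    rw [mcForm_const_mul, mcForm_mul hx mdifferentiableAt_const, mcForm_const, add_zero, inv_inv]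
    rfl
  have hc := contDiffAt_chartForm (IG := IG) (G := G) |>.differentiableAt (by simp)
  have h2 := ((hasFDerivAt_const (Ad IG c) e).clm_comp hc.hasFDerivAt).fderiv
  have h3 := maurerCartan hF v w
  have h4 := maurerCartan hψ v w
  rw [h1.fderiv_eq, h1.eq_of_nhds, h2, chartForm_one] at h3
  change fderiv ℝ (chartForm IG G) e v w - fderiv ℝ (chartForm IG G) e w v
    + bracketL IG G (chartForm IG G e v) (chartForm IG G e w) = 0 at h4
  rw [chartForm_one] at h4
  simp at h3 h4
  rw [eq_neg_of_add_eq_zero_right h4, eq_neg_of_add_eq_zero_right h3]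
  simp [e]

/-! ### Curvature -/

variable (IG G) in
/-- The curvature `dA + ½[A, A]`, on the vectors `v` and `w`, of a `𝔤`-valued 1-form regarded as a
map to the space of linear maps. -/
def curvL (A : E' → E' →L[ℝ] EG) (u v w : E') : EG :=
  fderiv ℝ A u v w - fderiv ℝ A u w v + bracketL IG G (A u v) (A u w)

/-- The curvature is gauge covariant. -/
lemma curvL_gauge {g : E' → G} {u : E'} (hg : ContMDiffAt 𝓘(ℝ, E') IG ∞ g u)
    {A : E' → E' →L[ℝ] EG} (hA : DifferentiableAt ℝ A u) (v w : E') :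
    curvL IG G (fun x => (Ad IG (g x)⁻¹).comp (A x) + mcForm IG g x) u v w =
      Ad IG (g u)⁻¹ (curvL IG G A u v w) := by
  have h1 := (contDiffAt_Ad_inv hg).differentiableAt (by simp)
  have h2 := (contDiffAt_mcForm hg).differentiableAt (by simp)
  have h3 := ((h1.hasFDerivAt.clm_comp hA.hasFDerivAt).add h2.hasFDerivAt).fderiv
  have h3' : fderiv ℝ (fun x => (Ad IG (g x)⁻¹).comp (A x) + mcForm IG g x) u = _ := h3
  have h4 := maurerCartan hg v w
  have h5 : ∀ v w, fderiv ℝ (fun x => (Ad IG (g x)⁻¹).comp (A x) + mcForm IG g x) u v w =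
      - bracketL IG G (mcForm IG g u v) (Ad IG (g u)⁻¹ (A u w))
        + Ad IG (g u)⁻¹ (fderiv ℝ A u v w) + fderiv ℝ (mcForm IG g) u v w := by
    intro v w
    rw [h3', ← fderiv_Ad_inv hg]
    simp [add_comm]
  simp only [curvL, h5]
  simp only [add_apply, ContinuousLinearMap.comp_apply, map_add, map_sub, ← bracketL_Ad]
  rw [bracketL_swap (Ad IG (g u)⁻¹ (A u v)) (mcForm IG g u w)]
  rw [← sub_eq_zero]
  refine Eq.trans ?_ h4
  abel

lemma curvL_add {A Λ : E' → E' →L[ℝ] EG} {u : E'} (hA : DifferentiableAt ℝ A u)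
    (hΛ : DifferentiableAt ℝ Λ u) (v w : E') :
    curvL IG G (fun x => A x + Λ x) u v w = curvL IG G A u v w
      + (fderiv ℝ Λ u v w - fderiv ℝ Λ u w v)
      + (bracketL IG G (A u v) (Λ u w) - bracketL IG G (A u w) (Λ u v))
      + bracketL IG G (Λ u v) (Λ u w) := by
  simp only [curvL, fderiv_fun_add hA hΛ, add_apply, map_add]
  rw [bracketL_swap (Λ u v) (A u w)]
  abel

end

/-! ### Gauge transformations of forms on Cartesian spaces -/

section

variable {EG HG : Type*} [NormedAddCommGroup EG] [NormedSpace ℝ EG] [TopologicalSpace HG]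
  {IG : ModelWithCorners ℝ EG HG}
  {G : Type*} [TopologicalSpace G] [ChartedSpace HG G] [Group G]
  {m : ℕ}

/-- A 1-form on `ℝᵐ` at a point, regarded as a linear map. -/
def oneFormEquiv (m : ℕ) (V : Type*) [NormedAddCommGroup V] [NormedSpace ℝ V] :
    (TestSpace m →L[ℝ] V) ≃L[ℝ] (TestSpace m [⋀^Fin 1]→L[ℝ] V) :=
  (ContinuousAlternatingMap.ofSubsingletonLIE (𝕜 := ℝ) (E := TestSpace m) (F := V)
    (i := (0 : Fin 1))).toContinuousLinearEquiv

@[simp] lemma oneFormEquiv_apply {V : Type*} [NormedAddCommGroup V] [NormedSpace ℝ V]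
    (L : TestSpace m →L[ℝ] V) (v : Fin 1 → TestSpace m) : oneFormEquiv m V L v = L (v 0) := rfl

@[simp] lemma oneFormEquiv_symm_apply {V : Type*} [NormedAddCommGroup V] [NormedSpace ℝ V]
    (α : TestSpace m [⋀^Fin 1]→L[ℝ] V) (v : TestSpace m) :
    (oneFormEquiv m V).symm α v = α ![v] := by
  obtain ⟨L, rfl⟩ := (oneFormEquiv m V).surjective α
  simp

lemma logForm_eq (g : TestSpace m → G) (u : TestSpace m) :
    logForm IG g u = oneFormEquiv m EG (mcForm IG g u) := rfl

lemma adForm_eq (c : G) (α : TestSpace m [⋀^Fin 1]→L[ℝ] EG) :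
    adForm IG c α = oneFormEquiv m EG ((Ad IG c).comp ((oneFormEquiv m EG).symm α)) := by
  obtain ⟨L, rfl⟩ := (oneFormEquiv m EG).surjective α
  rw [ContinuousLinearEquiv.symm_apply_apply]
  rfl

@[simp] lemma adForm_add (c : G) {k : ℕ} (α β : TestSpace m [⋀^Fin k]→L[ℝ] EG) :
    adForm IG c (α + β) = adForm IG c α + adForm IG c β := by ext; simp [adForm]

@[simp] lemma adForm_sub (c : G) {k : ℕ} (α β : TestSpace m [⋀^Fin k]→L[ℝ] EG) :
    adForm IG c (α - β) = adForm IG c α - adForm IG c β := by ext; simp [adForm]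

lemma gaugeTransform_eq (g : TestSpace m → G) (A : TestSpace m → TestSpace m [⋀^Fin 1]→L[ℝ] EG)
    (u : TestSpace m) : gaugeTransform IG g A u = oneFormEquiv m EG
      ((Ad IG (g u)⁻¹).comp ((oneFormEquiv m EG).symm (A u)) + mcForm IG g u) := by
  rw [gaugeTransform, adForm_eq, logForm_eq, map_add]

/-- `h⁻¹ ∇ h` measures how the connection changes under `h`. -/
lemma nablaLog_eq (h : TestSpace m → G) (A : TestSpace m → TestSpace m [⋀^Fin 1]→L[ℝ] EG)
    (u : TestSpace m) : nablaLog IG h A u = gaugeTransform IG h A u - A u := by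
  rw [nablaLog, gaugeTransform]; abel

variable [IG.Boundaryless] [LieGroup IG ∞ G]

@[simp] lemma adForm_one {k : ℕ} (α : TestSpace m [⋀^Fin k]→L[ℝ] EG) :
    adForm IG (1 : G) α = α := by ext; simp [adForm]

lemma adForm_mul (c d : G) {k : ℕ} (α : TestSpace m [⋀^Fin k]→L[ℝ] EG) :
    adForm IG (c * d) α = adForm IG c (adForm IG d α) := by ext; simp [adForm, Ad_mul]

lemma logForm_const (c : G) (u : TestSpace m) : logForm IG (fun _ => c) u = 0 := by
  rw [logForm_eq, mcForm_const, map_zero]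

lemma gaugeTransform_one (A : TestSpace m → TestSpace m [⋀^Fin 1]→L[ℝ] EG) (u : TestSpace m) :
    gaugeTransform IG (fun _ => (1 : G)) A u = A u := by
  rw [gaugeTransform, inv_one, adForm_one, logForm_const, add_zero]

/-- Gauge transformations form a right action. -/
lemma gaugeTransform_mul {g h : TestSpace m → G} {u : TestSpace m}
    (hg : MDifferentiableAt 𝓘(ℝ, TestSpace m) IG g u)
    (hh : MDifferentiableAt 𝓘(ℝ, TestSpace m) IG h u)
    (A : TestSpace m → TestSpace m [⋀^Fin 1]→L[ℝ] EG) :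
    gaugeTransform IG (fun x => g x * h x) A u =
      adForm IG (h u)⁻¹ (gaugeTransform IG g A u) + logForm IG h u := by
  have : logForm IG (fun x => g x * h x) u =
      adForm IG (h u)⁻¹ (logForm IG g u) + logForm IG h u := by
    rw [logForm_eq, mcForm_mul hg hh, map_add, adForm_eq]
    rfl
  rw [gaugeTransform, this, gaugeTransform, adForm_add, mul_inv_rev, adForm_mul, add_assoc]

lemma gaugeTransform_comp {n : ℕ} {g : TestSpace m → G} {f : TestSpace n → TestSpace m}
    {u : TestSpace n} (hg : MDifferentiableAt 𝓘(ℝ, TestSpace m) IG g (f u))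
    (hf : DifferentiableAt ℝ f u) {A : TestSpace m → TestSpace m [⋀^Fin 1]→L[ℝ] EG}
    {A' : TestSpace n → TestSpace n [⋀^Fin 1]→L[ℝ] EG}
    (hA : A' u = (A (f u)).compContinuousLinearMap (fderiv ℝ f u)) :
    gaugeTransform IG (fun x => g (f x)) A' u =
      (gaugeTransform IG g A (f u)).compContinuousLinearMap (fderiv ℝ f u) := by
  rw [gaugeTransform, gaugeTransform, hA, logForm_eq, logForm_eq, mcForm_comp hg hf]
  rfl

variable {EZ HZ : Type*} [NormedAddCommGroup EZ] [NormedSpace ℝ EZ] [TopologicalSpace HZ]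
  {IZ : ModelWithCorners ℝ EZ HZ} {Z : Type*} [TopologicalSpace Z] [ChartedSpace HZ Z]
  [IsManifold IZ ∞ Z]

lemma contMDiff_gaugeTransform {f : TestSpace m × Z → G}
    {A : Z → TestSpace m → TestSpace m [⋀^Fin 1]→L[ℝ] EG}
    (hf : ContMDiff (𝓘(ℝ, TestSpace m).prod IZ) IG ∞ f)
    (hA : ContMDiff (𝓘(ℝ, TestSpace m).prod IZ) 𝓘(ℝ, TestSpace m [⋀^Fin 1]→L[ℝ] EG) ∞
      fun z : TestSpace m × Z => A z.2 z.1) :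
    ContMDiff (𝓘(ℝ, TestSpace m).prod IZ) 𝓘(ℝ, TestSpace m [⋀^Fin 1]→L[ℝ] EG) ∞
      fun z : TestSpace m × Z => gaugeTransform IG (fun u => f (u, z.2)) (A z.2) z.1 := by
  simp_rw [gaugeTransform_eq]
  have h1 : ContMDiff (𝓘(ℝ, TestSpace m).prod IZ) 𝓘(ℝ, TestSpace m →L[ℝ] EG) ∞
      fun z : TestSpace m × Z => (oneFormEquiv m EG).symm (A z.2 z.1) :=
    (oneFormEquiv m EG).symm.contDiff.contMDiff.comp hA
  have h2 : ContMDiff (𝓘(ℝ, TestSpace m).prod IZ) 𝓘(ℝ, EG →L[ℝ] EG) ∞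
      fun z : TestSpace m × Z => Ad IG (f z)⁻¹ := fun z => contMDiffAt_Ad (hf.inv z)
  have h3 : ContMDiff (𝓘(ℝ, TestSpace m).prod IZ) 𝓘(ℝ, TestSpace m →L[ℝ] EG) ∞
      fun z : TestSpace m × Z => mcForm IG (fun u => f (u, z.2)) z.1 := by
    intro z
    refine contMDiffAt_mcForm (f := fun (z : TestSpace m × Z) u => f (u, z.2)) (p := Prod.fst) ?_
      contMDiffAt_fst
    exact (hf.comp (contMDiff_snd.prodMk (contMDiff_snd.comp contMDiff_fst))).contMDiffAt
  exact (oneFormEquiv m EG).contDiff.contMDiff.comp ((h2.clm_comp h1).add h3)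

variable [FiniteDimensional ℝ EG]

lemma removeNth_zero_fin_two {α : Type*} (v : Fin 2 → α) : Fin.removeNth 0 v = ![v 1] := by
  ext1 i; fin_cases i; rfl

lemma removeNth_one_fin_two {α : Type*} (v : Fin 2 → α) : Fin.removeNth 1 v = ![v 0] := by
  ext1 i; fin_cases i; rfl

lemma extDeriv_oneForm {A : TestSpace m → TestSpace m [⋀^Fin 1]→L[ℝ] EG} {u : TestSpace m}
    (hA : DifferentiableAt ℝ A u) (v : Fin 2 → TestSpace m) :
    extDeriv A u v = fderiv ℝ (fun x => (oneFormEquiv m EG).symm (A x)) u (v 0) (v 1) -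
      fderiv ℝ (fun x => (oneFormEquiv m EG).symm (A x)) u (v 1) (v 0) := by
  have h1 : HasFDerivAt (fun x => (oneFormEquiv m EG).symm (A x))
      ((oneFormEquiv m EG).symm.toContinuousLinearMap.comp (fderiv ℝ A u)) u :=
    (oneFormEquiv m EG).symm.toContinuousLinearMap.hasFDerivAt.comp u hA.hasFDerivAt
  rw [h1.fderiv, extDeriv, ContinuousAlternatingMap.alternatizeUncurryFin_apply, Fin.sum_univ_two,
    removeNth_zero_fin_two, removeNth_one_fin_two]
  simp [sub_eq_add_neg]

lemma curvature_eq {A : TestSpace m → TestSpace m [⋀^Fin 1]→L[ℝ] EG} {u : TestSpace m}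
    (hA : DifferentiableAt ℝ A u) (v : Fin 2 → TestSpace m) :
    curvature IG G A u v = curvL IG G (fun x => (oneFormEquiv m EG).symm (A x)) u (v 0) (v 1) := by
  rw [curvature, curvL, extDeriv_oneForm hA, wedgeBracket, bracket_eq_bracketL,
    bracket_eq_bracketL, bracketL_swap (A u ![v 1]), sub_neg_eq_add,
    ← two_smul ℝ (bracketL IG G (A u ![v 0]) _), smul_smul]
  simp

/-- The gauge covariance of the curvature, for a gauge transformation that is modified by a shift
`Λ`: this is what makes the transformation laws of the 2-forms `B` consistent. -/
lemma curvature_gaugeTransform_sub {g : TestSpace m → G}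
    {A A' Λ : TestSpace m → TestSpace m [⋀^Fin 1]→L[ℝ] EG} {u : TestSpace m}
    (hg : ContMDiffAt 𝓘(ℝ, TestSpace m) IG ∞ g u) (hA : DifferentiableAt ℝ A u)
    (hA' : DifferentiableAt ℝ A' u) (hΛ : DifferentiableAt ℝ Λ u)
    (h : ∀ x, A' x = gaugeTransform IG g A x - Λ x) (v : Fin 2 → TestSpace m) :
    extDeriv Λ u v + wedgeBracket IG G (A' u) (Λ u) v
      + (1 / 2 : ℝ) • wedgeBracket IG G (Λ u) (Λ u) v =
    Ad IG (g u)⁻¹ (curvature IG G A u v) - curvature IG G A' u v := by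
  set e := (oneFormEquiv m EG).symm
  have he : ∀ {B : TestSpace m → TestSpace m [⋀^Fin 1]→L[ℝ] EG}, DifferentiableAt ℝ B u →
      DifferentiableAt ℝ (fun x => e (B x)) u :=
    fun hB => e.differentiable.differentiableAt.comp u hB
  have h1 : (fun x => (Ad IG (g x)⁻¹).comp (e (A x)) + mcForm IG g x) =
      fun x => e (A' x) + e (Λ x) := by
    ext1 x
    rw [h, ← map_add, sub_add_cancel, gaugeTransform_eq, ContinuousLinearEquiv.symm_apply_apply]
  have h2 := curvL_gauge hg (he hA) (v 0) (v 1)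
  rw [h1, curvL_add (he hA') (he hΛ)] at h2
  rw [curvature_eq hA, curvature_eq hA', ← h2, extDeriv_oneForm hΛ]
  simp only [wedgeBracket, bracket_eq_bracketL]
  rw [bracketL_swap (Λ u ![v 1]), sub_neg_eq_add,
    ← two_smul ℝ (bracketL IG G (Λ u ![v 0]) _), smul_smul]
  simp [e]
  abel

lemma curvature_gaugeTransform {g : TestSpace m → G}
    {A A' : TestSpace m → TestSpace m [⋀^Fin 1]→L[ℝ] EG} {u : TestSpace m}
    (hg : ContMDiffAt 𝓘(ℝ, TestSpace m) IG ∞ g u) (hA : DifferentiableAt ℝ A u)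
    (hA' : DifferentiableAt ℝ A' u) (h : ∀ x, A' x = gaugeTransform IG g A x)
    (v : Fin 2 → TestSpace m) :
    curvature IG G A' u v = Ad IG (g u)⁻¹ (curvature IG G A u v) := by
  have := curvature_gaugeTransform_sub hg hA hA' (differentiableAt_const 0) (by simpa using h) v
  have h0 : ∀ X : EG, bracketL IG G X 0 = 0 := fun X => map_zero _
  simp [wedgeBracket, bracket_eq_bracketL, h0, extDeriv,
    ← ContinuousAlternatingMap.alternatizeUncurryFinCLM_apply] at this
  exact (sub_eq_zero.1 this.symm).symm

/-! ### The 2-form `[A, A]` -/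

variable (IG G) in
/-- The 2-form `[α, α]` of a 1-form `α`, as an alternating map. -/
def wedgeForm (α : TestSpace m [⋀^Fin 1]→L[ℝ] EG) : TestSpace m [⋀^Fin 2]→L[ℝ] EG :=
  ContinuousAlternatingMap.alternatizeUncurryFinCLM ℝ (TestSpace m) EG
    ((oneFormEquiv m EG).toContinuousLinearMap.comp
      (((ContinuousLinearMap.compL ℝ (TestSpace m) EG EG).flip ((oneFormEquiv m EG).symm α)).comp
        ((bracketL IG G).comp ((oneFormEquiv m EG).symm α))))

@[simp] lemma wedgeForm_apply (α : TestSpace m [⋀^Fin 1]→L[ℝ] EG) (v : Fin 2 → TestSpace m) :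
    wedgeForm IG G α v = wedgeBracket IG G α α v := by
  rw [wedgeForm, ContinuousAlternatingMap.alternatizeUncurryFinCLM_apply,
    ContinuousAlternatingMap.alternatizeUncurryFin_apply, Fin.sum_univ_two,
    removeNth_zero_fin_two, removeNth_one_fin_two]
  simp [wedgeBracket, bracket_eq_bracketL, sub_eq_add_neg]

lemma contDiff_wedgeForm : ContDiff ℝ ∞ (wedgeForm (m := m) IG G) := by
  unfold wedgeForm
  have h1 : ContDiff ℝ ∞ (oneFormEquiv m EG).symm := (oneFormEquiv m EG).symm.contDiff
  refine (ContinuousLinearMap.contDiff _).comp (contDiff_const.clm_comp (ContDiff.clm_comp ?_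
    (contDiff_const.clm_comp h1)))
  exact (ContinuousLinearMap.contDiff _).comp h1

lemma wedgeForm_compContinuousLinearMap {n : ℕ} (α : TestSpace m [⋀^Fin 1]→L[ℝ] EG)
    (f : TestSpace n →L[ℝ] TestSpace m) :
    wedgeForm IG G (α.compContinuousLinearMap f) =
      (wedgeForm IG G α).compContinuousLinearMap f := by
  have h : ∀ x : TestSpace n, f ∘ ![x] = ![f x] := fun x => by ext1 i; fin_cases i; rfl
  ext v
  simp [wedgeBracket, h]

end

/-! ### Path-valued forms -/

section

variable {M : Type*} [DiffeologicalSpace M] {k : ℕ}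
  {V : Type*} [NormedAddCommGroup V] [NormedSpace ℝ V]

lemma DForm.ext' {η θ : DForm M k V}
    (h : ∀ (m : ℕ) (p : Plot M m) (u : TestSpace m), η p u = θ p u) : η = θ := by
  obtain ⟨f, hf, hf'⟩ := η
  obtain ⟨g, hg, hg'⟩ := θ
  have : @f = @g := by
    funext m p u; exact h m p u
  subst this
  rfl

lemma PathForm.ext' {η θ : PathForm M k V}
    (h : ∀ (m : ℕ) (p : Plot M m) (u : TestSpace m) (t : unitInterval), η t p u = θ t p u) :
    η = θ := by
  obtain ⟨f, hf, hf'⟩ := η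
  obtain ⟨g, hg, hg'⟩ := θ
  have : f = g := by
    funext t; exact DForm.ext' fun m p u => h m p u t
  subst this
  rfl

lemma LoopForm.ext' {η θ : LoopForm M k V}
    (h : ∀ (m : ℕ) (p : Plot M m) (u : TestSpace m) (t : unitInterval), η t p u = θ t p u) :
    η = θ := by
  obtain ⟨f, hf⟩ := η
  obtain ⟨g, hg⟩ := θ
  have : f = g := PathForm.ext' h
  subst this
  rfl

/-- A family of forms, given on all plots, that is jointly smooth in the point and in time. -/
def PathForm.ofJoint
    (T : unitInterval → ∀ {m : ℕ}, Plot M m → TestSpace m → TestSpace m [⋀^Fin k]→L[ℝ] V)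
    (smooth : ∀ {m : ℕ} (p : Plot M m),
      ContMDiff (𝓘(ℝ, TestSpace m).prod (𝓡∂ 1)) 𝓘(ℝ, TestSpace m [⋀^Fin k]→L[ℝ] V) ∞
        (fun z : TestSpace m × unitInterval => T z.2 p z.1))
    (natural : ∀ (t : unitInterval) {m n : ℕ} (p : Plot M m) (f : TestSpace n → TestSpace m)
      (hf : ContDiff ℝ ∞ f) (u : TestSpace n),
      T t (p.comp f hf) u = (T t p (f u)).compContinuousLinearMap (fderiv ℝ f u))
    (start : ∀ {m : ℕ} (p : Plot M m) (u : TestSpace m), T 0 p u = 0) : PathForm M k V where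
  at' t :=
    { toFun := T t
      smooth := fun {m} p => ((smooth p).comp
        (contMDiff_id.prodMk (contMDiff_const (c := t)) :
          ContMDiff 𝓘(ℝ, TestSpace m) (𝓘(ℝ, TestSpace m).prod (𝓡∂ 1)) ∞
            fun u : TestSpace m => (u, t))).contDiff
      natural := natural t }
  smooth := smooth
  start := start

/-- A path of forms that ends at `0` is a loop of forms. -/
def PathForm.toLoopForm (η : PathForm M k V)
    (h : ∀ {m : ℕ} (p : Plot M m) (u : TestSpace m), η 1 p u = 0) : LoopForm M k V :=
  { η with endpoint := h }

/-- The pointwise difference of paths of forms. -/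
def PathForm.sub (η θ : PathForm M k V) : PathForm M k V :=
  PathForm.ofJoint (fun t _ p u => η t p u - θ t p u) (fun p => (η.smooth p).sub (θ.smooth p))
    (fun t _ _ p f hf u => by
      simp only [DForm.natural]
      ext v
      simp)
    (fun p u => by simp [η.start, θ.start])

end

section

variable {EG HG : Type*} [NormedAddCommGroup EG] [NormedSpace ℝ EG] [TopologicalSpace HG]
  {IG : ModelWithCorners ℝ EG HG}
  {G : Type*} [TopologicalSpace G] [ChartedSpace HG G] [Group G]
  [IG.Boundaryless] [LieGroup IG ∞ G]
  {M : Type*} [DiffeologicalSpace M]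

lemma SmoothPathMap.mul {f g : M → PathGroup IG G} (hf : SmoothPathMap IG f)
    (hg : SmoothPathMap IG g) : SmoothPathMap IG fun y => f y * g y :=
  fun m p => (hf m p).mul (hg m p)

lemma SmoothPathMap.inv {f : M → PathGroup IG G} (hf : SmoothPathMap IG f) :
    SmoothPathMap IG fun y => (f y)⁻¹ :=
  fun m p => (hf m p).inv

lemma SmoothPathMap.contMDiff_at {f : M → PathGroup IG G} (hf : SmoothPathMap IG f) {m : ℕ}
    (p : Plot M m) (t : unitInterval) :
    ContMDiff 𝓘(ℝ, TestSpace m) IG ∞ fun u => (f (p u)).1 t :=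
  (hf m p).comp (contMDiff_id.prodMk contMDiff_const)

lemma SmoothPathMap.mdifferentiableAt {f : M → PathGroup IG G} (hf : SmoothPathMap IG f) {m : ℕ}
    (p : Plot M m) (t : unitInterval) (u : TestSpace m) :
    MDifferentiableAt 𝓘(ℝ, TestSpace m) IG (fun u => (f (p u)).1 t) u :=
  (hf.contMDiff_at p t).mdifferentiableAt (by simp)

/-- The gauge transform `g⁻¹ A g + g⁻¹ dg` of a path of 1-forms by a path-valued map. -/
def PathForm.gauge (A : PathForm M 1 EG) (g : M → PathGroup IG G) (hg : SmoothPathMap IG g) :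
    PathForm M 1 EG :=
  PathForm.ofJoint (fun t _ p u => gaugeTransform IG (fun u => (g (p u)).1 t) (A t p) u)
    (fun p => contMDiff_gaugeTransform (f := fun z => (g (p z.1)).1 z.2)
      (A := fun t => A t p) (hg _ p) (A.smooth p))
    (fun t _ _ p f hf u => by
      have h := gaugeTransform_comp (IG := IG) (hg.mdifferentiableAt p t (f u))
        (hf.differentiable (by simp) u) (A := A t p) (A' := A t (p.comp f hf))
        ((A t).natural p f hf u)
      exact h)
    (fun p u => by
      have h : (fun u => (g (p u)).1 0) = fun _ => (1 : G) := funext fun u => (g (p u)).2.2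
      simp only [h, gaugeTransform_one, A.start])

end

section

variable {EY HY : Type*} [NormedAddCommGroup EY] [NormedSpace ℝ EY] [TopologicalSpace HY]
  {IY : ModelWithCorners ℝ EY HY}
  {Y X : Type*} [TopologicalSpace Y] [ChartedSpace HY Y] {σ : Y → X}

/-- The pullback of a path of forms along a projection `Y^{[n]} → Y^{[k]}`. -/
def PathForm.pull {n k l : ℕ} {V : Type*} [NormedAddCommGroup V] [NormedSpace ℝ V]
    (A : PathForm (FibrePower IY σ k) l V) (s : Fin k → Fin n) :
    PathForm (FibrePower IY σ n) l V :=
  PathForm.ofJoint (fun t _ p u => A t (p.sub s) u) (fun p => A.smooth (p.sub s))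
    (fun t _ _ p f hf u => (A t).natural (p.sub s) f hf u) (fun p u => A.start (p.sub s) u)

variable {EG HG : Type*} [NormedAddCommGroup EG] [NormedSpace ℝ EG] [TopologicalSpace HG]
  {IG : ModelWithCorners ℝ EG HG}
  {G : Type*} [TopologicalSpace G] [ChartedSpace HG G] [Group G]
  [LieGroup IG ∞ G]

lemma SmoothPathMap.pull {n k : ℕ} {f : FibrePower IY σ k → PathGroup IG G}
    (hf : SmoothPathMap IG f) (s : Fin k → Fin n) :
    SmoothPathMap IG fun y : FibrePower IY σ n => f (y.sub s) :=
  fun m p => hf m (p.sub s)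

variable [IG.Boundaryless] [FiniteDimensional ℝ EG] {wp : unitInterval → ℝ}

lemma DForm.differentiableAt {M : Type*} [DiffeologicalSpace M] {k : ℕ} (η : DForm M k EG)
    {m : ℕ} (p : Plot M m) (u : TestSpace m) : DifferentiableAt ℝ (η p) u :=
  (η.smooth p).differentiable (by simp) u

variable (G) in
/-- Two paths of curvatures proportional to `℘` whose endpoints are related by `Ad` satisfy the
transformation law that involves the adjustment `κ`. -/
lemma sub_kappa_eq {g : unitInterval → G} {F F' : unitInterval → EG}
    (hF : loopPart wp F = 0) (hF' : loopPart wp F' = 0) (h1 : F' 1 = Ad IG (g 1) (F 1))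
    (t : unitInterval) :
    Ad IG (g t) (F t) - kappa IG wp g F t = F' t := by
  have h2 := congrFun hF t
  have h3 := congrFun hF' t
  simp only [loopPart, Pi.zero_apply] at h2 h3
  rw [sub_eq_zero] at h2 h3
  rw [h3, h1]
  simp only [kappa, loopPart, smul_sub]
  rw [h2]
  abel

/-- The transformation law of the 2-form `B` under a gauge transformation of path-valued forms
follows from that of the 1-form `A` if both curvatures are proportional to `℘`. -/
lemma transform_B {m : ℕ}
    {g : TestSpace m → PathGroup IG G}
    {A A' Λ : unitInterval → TestSpace m → TestSpace m [⋀^Fin 1]→L[ℝ] EG} {B B' : unitInterval → EG}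
    {u : TestSpace m} (v : Fin 2 → TestSpace m)
    (hg : ∀ t, ContMDiffAt 𝓘(ℝ, TestSpace m) IG ∞ (fun u => (g u).1 t) u)
    (hA : ∀ t, DifferentiableAt ℝ (A t) u) (hA' : ∀ t, DifferentiableAt ℝ (A' t) u)
    (hΛ : ∀ t, DifferentiableAt ℝ (Λ t) u) (hΛ1 : ∀ u, Λ 1 u = 0) (hB : B 1 = 0) (hB' : B' 1 = 0)
    (h : ∀ t x, A' t x = gaugeTransform IG (fun u => (g u).1 t) (A t) x - Λ t x)
    (hF : loopPart wp (fun t => curvature IG G (A t) u v + B t) = 0)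
    (hF' : loopPart wp (fun t => curvature IG G (A' t) u v + B' t) = 0) (t : unitInterval) :
    B' t = Ad IG ((g u).1 t)⁻¹ (B t) + extDeriv (Λ t) u v + wedgeBracket IG G (A' t u) (Λ t u) v
      + (1 / 2 : ℝ) • wedgeBracket IG G (Λ t u) (Λ t u) v
      - kappa IG wp (fun s => ((g u).1 s)⁻¹) (fun t => curvature IG G (A t) u v + B t) t := by
  have h1 := curvature_gaugeTransform_sub (hg t) (hA t) (hA' t) (hΛ t) (h t) v
  have h2 : curvature IG G (A' 1) u v = Ad IG ((g u).1 1)⁻¹ (curvature IG G (A 1) u v) :=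
    curvature_gaugeTransform (hg 1) (hA 1) (hA' 1) (fun x => by rw [h, hΛ1, sub_zero]) v
  have h3 := sub_kappa_eq G (IG := IG) (g := fun s => ((g u).1 s)⁻¹) hF hF'
    (by simp only [hB, hB', add_zero, h2]) t
  rw [add_assoc, add_assoc, ← add_assoc (extDeriv _ _ _), h1]
  simp only [map_add] at h3
  rw [← add_sub_cancel_left (curvature IG G (A' t) u v) (B' t), ← h3]
  abel

end

/-! ### Pointwise transformation laws of the 1-forms -/

section

variable {EG HG : Type*} [NormedAddCommGroup EG] [NormedSpace ℝ EG] [TopologicalSpace HG]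
  {IG : ModelWithCorners ℝ EG HG}
  {G : Type*} [TopologicalSpace G] [ChartedSpace HG G] [Group G]
  [IG.Boundaryless] [LieGroup IG ∞ G] {m : ℕ} {u : TestSpace m}

/-- The cocycle law of the 1-forms `Λ_ij = g_ij⁻¹ A_i g_ij + g_ij⁻¹ dg_ij - A_j`, with
`k = h_ijk⁻¹`. -/
lemma gaugeTransform_cocycle {gij gjk gik k : TestSpace m → G}
    {Ai Aj : TestSpace m → TestSpace m [⋀^Fin 1]→L[ℝ] EG}
    {Ak : TestSpace m [⋀^Fin 1]→L[ℝ] EG}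
    (hij : MDifferentiableAt 𝓘(ℝ, TestSpace m) IG gij u)
    (hjk : MDifferentiableAt 𝓘(ℝ, TestSpace m) IG gjk u)
    (hik : MDifferentiableAt 𝓘(ℝ, TestSpace m) IG gik u)
    (hk : MDifferentiableAt 𝓘(ℝ, TestSpace m) IG k u)
    (h : ∀ x, k x * gik x = gij x * gjk x) :
    gaugeTransform IG gik Ai u - Ak =
      (gaugeTransform IG gjk Aj u - Ak) +
        adForm IG (gjk u)⁻¹ (gaugeTransform IG gij Ai u - Aj u) -
        adForm IG (gik u)⁻¹ (nablaLog IG k Ai u) := by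
  have h1 := gaugeTransform_mul hk hik Ai
  rw [funext h, gaugeTransform_mul hij hjk Ai] at h1
  rw [nablaLog_eq, adForm_sub, adForm_sub, ← sub_eq_iff_eq_add.2 h1]
  simp only [gaugeTransform]
  abel

/-- The change of the 1-forms `Λ_ij` under a gauge transformation with 1-forms
`l_i = a_i⁻¹ A_i a_i + a_i⁻¹ da_i - A'_i`. -/
lemma gaugeTransform_coboundary {gij gij' ai aj b : TestSpace m → G}
    {Ai Aj : TestSpace m → TestSpace m [⋀^Fin 1]→L[ℝ] EG}
    {Ai' : TestSpace m → TestSpace m [⋀^Fin 1]→L[ℝ] EG} {Aj' : TestSpace m [⋀^Fin 1]→L[ℝ] EG}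
    (hg : MDifferentiableAt 𝓘(ℝ, TestSpace m) IG gij u)
    (hg' : MDifferentiableAt 𝓘(ℝ, TestSpace m) IG gij' u)
    (hai : MDifferentiableAt 𝓘(ℝ, TestSpace m) IG ai u)
    (haj : MDifferentiableAt 𝓘(ℝ, TestSpace m) IG aj u)
    (hb : MDifferentiableAt 𝓘(ℝ, TestSpace m) IG b u)
    (h : ∀ x, ai x * gij' x = b x * (gij x * aj x)) :
    gaugeTransform IG gij' Ai' u - Aj' =
      adForm IG (aj u)⁻¹ (gaugeTransform IG gij Ai u - Aj u)
        + (gaugeTransform IG aj Aj u - Aj')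
        - adForm IG (gij' u)⁻¹ (gaugeTransform IG ai Ai u - Ai' u)
        + adForm IG ((aj u)⁻¹ * (gij u)⁻¹) (nablaLog IG b Ai u) := by
  have hga : MDifferentiableAt 𝓘(ℝ, TestSpace m) IG (fun x => gij x * aj x) u :=
    MDifferentiableAt.comp (I' := IG.prod IG) (g := fun z : G × G => z.1 * z.2) u
      ((contMDiff_mul IG ∞).mdifferentiable (by simp) _) (hg.prodMk haj)
  have h1 := gaugeTransform_mul hai hg' Ai
  have h2 := gaugeTransform_mul hg haj Ai
  rw [funext h, gaugeTransform_mul hb hga Ai] at h1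
  have h3 : gaugeTransform IG (fun x => gij x * aj x) Ai u =
    adForm IG (gij u * aj u)⁻¹ (Ai u) + logForm IG (fun x => gij x * aj x) u := rfl
  rw [h3] at h2
  rw [nablaLog_eq, ← mul_inv_rev]
  simp only [adForm_sub]
  rw [← sub_eq_iff_eq_add.2 h1, ← sub_eq_iff_eq_add.2 h2]
  simp only [gaugeTransform]
  abel

/-- The change of the 1-form of a gauge transformation under a higher gauge transformation. -/
lemma gaugeTransform_higher {a a' n : TestSpace m → G}
    {A : TestSpace m → TestSpace m [⋀^Fin 1]→L[ℝ] EG} {A' : TestSpace m [⋀^Fin 1]→L[ℝ] EG}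
    (ha : MDifferentiableAt 𝓘(ℝ, TestSpace m) IG a u)
    (hn : MDifferentiableAt 𝓘(ℝ, TestSpace m) IG n u)
    (h : ∀ x, a' x = n x * a x) :
    gaugeTransform IG a' A u - A' =
      (gaugeTransform IG a A u - A') + adForm IG (a u)⁻¹ (nablaLog IG n A u) := by
  rw [funext h, gaugeTransform_mul hn ha, nablaLog_eq, adForm_sub]
  simp only [gaugeTransform]
  abel

end

section

variable {EY HY : Type*} [NormedAddCommGroup EY] [NormedSpace ℝ EY] [TopologicalSpace HY]
  {IY : ModelWithCorners ℝ EY HY}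
  {Y X : Type*} [TopologicalSpace Y] [ChartedSpace HY Y] {σ : Y → X}

lemma FibrePower.sub_sub {n m l : ℕ} (y : FibrePower IY σ n) (s : Fin m → Fin n)
    (r : Fin l → Fin m) : (y.sub s).sub r = y.sub (s ∘ r) := rfl

@[simp] lemma FibrePower.sub_zero (y : FibrePower IY σ 1) : y.sub ![0] = y := by
  apply Subtype.ext
  funext i
  fin_cases i
  rfl

lemma Plot.sub_sub {m n k l : ℕ} (p : Plot (FibrePower IY σ n) m) (s : Fin k → Fin n)
    (r : Fin l → Fin k) : (p.sub s).sub r = p.sub (s ∘ r) := rfl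

variable {EG HG : Type*} [NormedAddCommGroup EG] [NormedSpace ℝ EG] [TopologicalSpace HG]
  {IG : ModelWithCorners ℝ EG HG}
  {G : Type*} [TopologicalSpace G] [ChartedSpace HG G] [Group G]
  [LieGroup IG ∞ G]

@[simp] lemma coe_act (g : PathGroup IG G) (h : LoopGroup IG G) :
    (act IG g h : PathGroup IG G) = g * h * g⁻¹ := rfl

variable [IG.Boundaryless] [FiniteDimensional ℝ EG] {wp : unitInterval → ℝ}

/-! ### Lifting descent data -/

/-- The path of forms `℘ A`. -/
def DForm.smulPath {M : Type*} [DiffeologicalSpace M] {k : ℕ} (A : DForm M k EG)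
    (hwp : ContMDiff (𝓡∂ 1) 𝓘(ℝ, ℝ) ∞ wp) (hwp0 : wp 0 = 0) : PathForm M k EG :=
  PathForm.ofJoint (fun t _ p u => wp t • A p u)
    (fun p => (hwp.comp contMDiff_snd).smul ((A.smooth p).contMDiff.comp contMDiff_fst))
    (fun t _ _ p f hf u => by rw [A.natural]; ext v; simp)
    (fun p u => by rw [hwp0, zero_smul])

variable (IG G) in
/-- The loop of 2-forms `½ (℘ - ℘²) [A, A]`. -/
def DForm.wedgeLoop {M : Type*} [DiffeologicalSpace M] (A : DForm M 1 EG)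
    (hwp : ContMDiff (𝓡∂ 1) 𝓘(ℝ, ℝ) ∞ wp) (hwp0 : wp 0 = 0) (hwp1 : wp 1 = 1) :
    LoopForm M 2 EG :=
  PathForm.toLoopForm
    (PathForm.ofJoint (fun t _ p u => ((1 / 2 : ℝ) * (wp t - wp t ^ 2)) • wedgeForm IG G (A p u))
      (fun p => by
        have h1 : ContMDiff (𝓡∂ 1) 𝓘(ℝ, ℝ) ∞ fun t => (1 / 2 : ℝ) * (wp t - wp t ^ 2) :=
          (contDiff_const.mul (contDiff_id.sub (contDiff_id.pow 2)) :
            ContDiff ℝ ∞ fun x : ℝ => (1 / 2 : ℝ) * (x - x ^ 2)).contMDiff.comp hwp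
        exact (h1.comp contMDiff_snd).smul
          ((contDiff_wedgeForm.comp (A.smooth p)).contMDiff.comp contMDiff_fst))
      (fun t _ _ p f hf u => by
        rw [A.natural, wedgeForm_compContinuousLinearMap]; ext v; simp)
      (fun p u => by rw [hwp0]; simp))
    (fun p u => by
      change ((1 / 2 : ℝ) * (wp 1 - wp 1 ^ 2)) • wedgeForm IG G (A p u) = 0
      rw [hwp1]; simp)

/-- The curvature of `(℘ A, ½ (℘ - ℘²) [A, A])` is `℘` times the curvature of `A`. -/
lemma curvature_smul {m : ℕ} {A : TestSpace m → TestSpace m [⋀^Fin 1]→L[ℝ] EG} {u : TestSpace m}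
    (v : Fin 2 → TestSpace m) (c : ℝ) :
    curvature IG G (fun x => c • A x) u v
      + ((1 / 2 : ℝ) * (c - c ^ 2)) • wedgeBracket IG G (A u) (A u) v =
      c • curvature IG G A u v := by
  have h1 : wedgeBracket IG G (c • A u) (c • A u) v = c ^ 2 • wedgeBracket IG G (A u) (A u) v := by
    simp [wedgeBracket, bracket_eq_bracketL, smul_sub, smul_smul, pow_two]
  have h2 : extDeriv (fun x => c • A x) u = c • extDeriv A u := extDeriv_smul c A
  rw [curvature, curvature, h2, h1, smul_add, smul_smul, smul_smul, add_assoc,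
    ← add_smul, ContinuousAlternatingMap.smul_apply]
  congr 2
  ring

lemma IsLift.fakeFlat {D : BundleData IY σ IG G} {D' : AdjustedData IY σ IG G wp}
    (h : IsLift D D') (hwp1 : wp 1 = 1) : D'.FakeFlat := by
  intro m p u v
  have h1 : fakeCurvature IG G D'.A D'.B p u v = fun t => wp t • curvature IG G (D.A p) u v := by
    funext t
    have h2 : (D'.A t) p = fun x => wp t • D.A p x := funext fun x => h.A_eq m p x t
    rw [fakeCurvature, h2, h.B_eq, curvature_smul]
  rw [h1]
  funext t
  simp [loopPart, hwp1]

end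

section

variable {EY HY : Type*} [NormedAddCommGroup EY] [NormedSpace ℝ EY] [TopologicalSpace HY]
  {IY : ModelWithCorners ℝ EY HY}
  {Y X : Type*} [TopologicalSpace Y] [ChartedSpace HY Y] {σ : Y → X}
  {EG HG : Type*} [NormedAddCommGroup EG] [NormedSpace ℝ EG] [TopologicalSpace HG]
  {IG : ModelWithCorners ℝ EG HG}
  {G : Type*} [TopologicalSpace G] [ChartedSpace HG G] [Group G]
  [LieGroup IG ∞ G]
  [IG.Boundaryless] [FiniteDimensional ℝ EG] {wp : unitInterval → ℝ}

/-- The transformation law of `B` for path-valued forms whose curvatures are proportional to `℘`. -/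
lemma transform_loopForm_B {M : Type*} [DiffeologicalSpace M] {g : M → PathGroup IG G}
    (hg : SmoothPathMap IG g) (A A' : PathForm (FibrePower IY σ 1) 1 EG)
    (B B' : LoopForm (FibrePower IY σ 1) 2 EG) (Λ : LoopForm M 1 EG) {m : ℕ} (p : Plot M m)
    (q q' : Plot (FibrePower IY σ 1) m) (u : TestSpace m) (v : Fin 2 → TestSpace m)
    (h : ∀ t x, A' t q' x = gaugeTransform IG (fun u => (g (p u)).1 t) (A t q) x - Λ t p x)
    (hF : loopPart wp (fakeCurvature IG G A B q u v) = 0)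
    (hF' : loopPart wp (fakeCurvature IG G A' B' q' u v) = 0) (t : unitInterval) :
    B' t q' u v =
      Ad IG ((g (p u)).1 t)⁻¹ (B t q u v)
        + extDeriv (Λ t p) u v
        + wedgeBracket IG G (A' t q' u) (Λ t p u) v
        + (1 / 2 : ℝ) • wedgeBracket IG G (Λ t p u) (Λ t p u) v
        - kappa IG wp (fun s => ((g (p u)).1 s)⁻¹) (fakeCurvature IG G A B q u v) t := by
  have hB : (B 1).toFun q u v = 0 := by rw [B.endpoint]; rfl
  have hB' : (B' 1).toFun q' u v = 0 := by rw [B'.endpoint]; rfl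
  have key := @transform_B EG HG _ _ _ IG G _ _ _ _ _ _ wp m (fun u => g (p u)) (fun t => A t q)
    (fun t => A' t q') (fun t => Λ t p) (fun t => B t q u v) (fun t => B' t q' u v) u v
    (fun t => hg.contMDiff_at p t u) (fun t => (A t).differentiableAt q u)
    (fun t => (A' t).differentiableAt q' u) (fun t => (Λ t).differentiableAt p u)
    (fun x => Λ.endpoint p x) hB hB' h
  exact key hF hF' t

section
variable (D : BundleData IY σ IG G)
  (hwp : ContMDiff (𝓡∂ 1) 𝓘(ℝ, ℝ) ∞ wp) (hwp0 : wp 0 = 0) (hwp1 : wp 1 = 1)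
  (g' : FibrePower IY σ 2 → PathGroup IG G) (hg' : SmoothPathMap IG g')
  (hflat : ∀ y, flat IG G (g' y) = D.g y)

/-- The loop-valued cocycle `h_ijk = g_ik g_jk⁻¹ g_ij⁻¹` of a lift. -/
def liftH (y : FibrePower IY σ 3) : LoopGroup IG G :=
  ⟨g' (y.sub ![0, 2]) * (g' (y.sub ![1, 2]))⁻¹ * (g' (y.sub ![0, 1]))⁻¹, by
    rw [MonoidHom.mem_ker, map_mul, map_mul, map_inv, map_inv, hflat, hflat, hflat, D.cocycle_g]
    group⟩

/-- The loop of 1-forms `Λ_ij = g_ij⁻¹ A_i g_ij + g_ij⁻¹ dg_ij - A_j` of a lift, with `A_i` replaced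
by `℘ A_i`. -/
def liftΛ : LoopForm (FibrePower IY σ 2) 1 EG :=
  ((((D.A.smulPath hwp hwp0).pull ![0]).gauge g' hg').sub
    ((D.A.smulPath hwp hwp0).pull ![1])).toLoopForm fun {m} p u => by
    have h1 : (fun u => (g' (p u)).1 1) = fun u => D.g (p u) := funext fun u => hflat _
    have h2 : ∀ q : Plot (FibrePower IY σ 1) m,
        ((D.A.smulPath hwp hwp0) 1) q = D.A q := fun q => by
      funext x
      change wp 1 • D.A q x = _
      rw [hwp1, one_smul]
    change gaugeTransform IG (fun u => (g' (p u)).1 1) ((D.A.smulPath hwp hwp0) 1 (p.sub ![0])) u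
      - (D.A.smulPath hwp hwp0) 1 (p.sub ![1]) u = 0
    rw [h1, h2, h2, D.cocycle_A, sub_self]

lemma liftΛ_apply {m : ℕ} (p : Plot (FibrePower IY σ 2) m) (t : unitInterval) (u : TestSpace m) :
    (liftΛ D hwp hwp0 hwp1 g' hg' hflat) t p u =
      gaugeTransform IG (fun u => (g' (p u)).1 t) ((D.A.smulPath hwp hwp0) t (p.sub ![0])) u
        - (D.A.smulPath hwp hwp0) t (p.sub ![1]) u := rfl

/-- The law `A_j = g_ij⁻¹ A_i g_ij + g_ij⁻¹ dg_ij - Λ_ij` for lifted data. -/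
lemma sub_gauge_liftΛ {m : ℕ} (p : Plot (FibrePower IY σ 2) m) (t : unitInterval)
    (u : TestSpace m) :
    (D.A.smulPath hwp hwp0) t (p.sub ![1]) u =
      gaugeTransform IG (fun u => (g' (p u)).1 t) ((D.A.smulPath hwp hwp0) t (p.sub ![0])) u
        - (liftΛ D hwp hwp0 hwp1 g' hg' hflat) t p u := by
  rw [liftΛ_apply, sub_sub_self]

/-- The lifted forms `(℘ A, ½ (℘ - ℘²) [A, A])` satisfy the adjusted fake-curvature condition. -/
lemma loopPart_smulPath {m : ℕ} (q : Plot (FibrePower IY σ 1) m) (u : TestSpace m)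
    (v : Fin 2 → TestSpace m) :
    loopPart wp (fakeCurvature IG G (D.A.smulPath hwp hwp0) (D.A.wedgeLoop IG G hwp hwp0 hwp1)
      q u v) = 0 := by
  have h1 : fakeCurvature IG G (D.A.smulPath hwp hwp0) (D.A.wedgeLoop IG G hwp hwp0 hwp1) q u v =
      fun t => wp t • curvature IG G (D.A q) u v := by
    funext t
    rw [← curvature_smul v (wp t), ← wedgeForm_apply]
    rfl
  rw [h1]
  funext t
  simp [loopPart, hwp1]

/-- The lift of `D` with prescribed path-valued cocycle `g'`. -/
def liftData : AdjustedData IY σ IG G wp where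
  h := liftH D g' hflat
  g := g'
  Λ := liftΛ D hwp hwp0 hwp1 g' hg' hflat
  A := D.A.smulPath hwp hwp0
  B := D.A.wedgeLoop IG G hwp hwp0 hwp1
  smooth_h := ((hg'.pull ![0, 2]).mul (hg'.pull ![1, 2]).inv).mul (hg'.pull ![0, 1]).inv
  smooth_g := hg'
  cocycle_h y := by
    apply Subtype.ext
    have e1 : (![0, 2, 3] ∘ ![0, 2] : Fin 2 → Fin 4) = ![0, 3] := by decide
    have e2 : (![0, 2, 3] ∘ ![1, 2] : Fin 2 → Fin 4) = ![2, 3] := by decide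
    have e3 : (![0, 2, 3] ∘ ![0, 1] : Fin 2 → Fin 4) = ![0, 2] := by decide
    have e4 : (![0, 1, 2] ∘ ![0, 2] : Fin 2 → Fin 4) = ![0, 2] := by decide
    have e5 : (![0, 1, 2] ∘ ![1, 2] : Fin 2 → Fin 4) = ![1, 2] := by decide
    have e6 : (![0, 1, 2] ∘ ![0, 1] : Fin 2 → Fin 4) = ![0, 1] := by decide
    have e7 : (![0, 1, 3] ∘ ![0, 2] : Fin 2 → Fin 4) = ![0, 3] := by decide
    have e8 : (![0, 1, 3] ∘ ![1, 2] : Fin 2 → Fin 4) = ![1, 3] := by decide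
    have e9 : (![0, 1, 3] ∘ ![0, 1] : Fin 2 → Fin 4) = ![0, 1] := by decide
    have e10 : (![1, 2, 3] ∘ ![0, 2] : Fin 2 → Fin 4) = ![1, 3] := by decide
    have e11 : (![1, 2, 3] ∘ ![1, 2] : Fin 2 → Fin 4) = ![2, 3] := by decide
    have e12 : (![1, 2, 3] ∘ ![0, 1] : Fin 2 → Fin 4) = ![1, 2] := by decide
    simp only [liftH, Subgroup.coe_mul, coe_act, FibrePower.sub_sub, e1, e2, e3, e4, e5, e6, e7, e8,
      e9, e10, e11, e12]
    group
  cocycle_g y := by simp only [liftH]; group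
  cocycle_Λ m p u t := by
    have e1 : (![0, 2] ∘ ![0] : Fin 1 → Fin 3) = ![0] := by decide
    have e2 : (![0, 2] ∘ ![1] : Fin 1 → Fin 3) = ![2] := by decide
    have e3 : (![1, 2] ∘ ![0] : Fin 1 → Fin 3) = ![1] := by decide
    have e4 : (![1, 2] ∘ ![1] : Fin 1 → Fin 3) = ![2] := by decide
    have e5 : (![0, 1] ∘ ![0] : Fin 1 → Fin 3) = ![0] := by decide
    have e6 : (![0, 1] ∘ ![1] : Fin 1 → Fin 3) = ![1] := by decide
    have hh : SmoothPathMap IG fun y => (liftH D g' hflat y : PathGroup IG G) :=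
      ((hg'.pull ![0, 2]).mul (hg'.pull ![1, 2]).inv).mul (hg'.pull ![0, 1]).inv
    have key := gaugeTransform_cocycle (Ai := (D.A.smulPath hwp hwp0) t (p.sub ![0]))
      (Aj := (D.A.smulPath hwp hwp0) t (p.sub ![1]))
      (Ak := (D.A.smulPath hwp hwp0) t (p.sub ![2]) u)
      ((hg'.pull ![0, 1]).mdifferentiableAt p t u)
      ((hg'.pull ![1, 2]).mdifferentiableAt p t u) ((hg'.pull ![0, 2]).mdifferentiableAt p t u)
      (hh.inv.mdifferentiableAt p t u) (fun x => by
        change ((liftH D g' hflat (p x) : PathGroup IG G)⁻¹ * g' ((p x).sub ![0, 2])).1 t =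
          (g' ((p x).sub ![0, 1]) * g' ((p x).sub ![1, 2])).1 t
        simp only [liftH]; group)
    simp only [liftΛ_apply, Plot.sub_sub, e1, e2, e3, e4, e5, e6]
    exact key
  cocycle_A m p u t := sub_gauge_liftΛ D hwp hwp0 hwp1 g' hg' hflat p t u
  cocycle_B m p u v t :=
    transform_loopForm_B hg' _ _ _ _ _ p (p.sub ![0]) (p.sub ![1]) u v
      (sub_gauge_liftΛ D hwp hwp0 hwp1 g' hg' hflat p)
      (loopPart_smulPath D hwp hwp0 hwp1 _ u v) (loopPart_smulPath D hwp hwp0 hwp1 _ u v) t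

lemma isLift_liftData : IsLift D (liftData D hwp hwp0 hwp1 g' hg' hflat) where
  g_eq := hflat
  h_eq _ := rfl
  A_eq _ _ _ _ := rfl
  B_eq m p u v t := by rw [← wedgeForm_apply]; rfl
  Λ_eq _ _ _ _ := rfl

end

lemma AdjustedData.ext' {D D' : AdjustedData IY σ IG G wp} (hh : D.h = D'.h) (hg : D.g = D'.g)
    (hΛ : D.Λ = D'.Λ) (hA : D.A = D'.A) (hB : D.B = D'.B) : D = D' := by
  cases D; cases D'
  congr

lemma IsLift.unique {D : BundleData IY σ IG G} {D' D'' : AdjustedData IY σ IG G wp}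
    (h' : IsLift D D') (h'' : IsLift D D'') (hg : D''.g = D'.g) : D'' = D' := by
  have hA : D''.A = D'.A := PathForm.ext' fun m p u t => by rw [h'.A_eq, h''.A_eq]
  refine AdjustedData.ext' ?_ hg ?_ hA ?_
  · funext y
    apply Subtype.ext
    rw [h'.h_eq, h''.h_eq, hg]
  · exact LoopForm.ext' fun m p u t => by rw [h'.Λ_eq, h''.Λ_eq, hg, hA]
  · exact LoopForm.ext' fun m p u t => by ext v; rw [h'.B_eq, h''.B_eq]

/-! ### Projecting descent data -/

lemma BundleData.ext' {D D' : BundleData IY σ IG G} (hg : D.g = D'.g) (hA : D.A = D'.A) :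
    D = D' := by
  cases D; cases D'
  congr

/-- The projection of descent data by evaluation at the endpoint. -/
def projData (D' : AdjustedData IY σ IG G wp) : BundleData IY σ IG G where
  g y := flat IG G (D'.g y)
  A := D'.A 1
  smooth_g m p := D'.smooth_g.contMDiff_at p 1
  cocycle_g y := by
    rw [D'.cocycle_g, map_mul, map_mul, (D'.h y).2, one_mul]
  cocycle_A m p u := by
    rw [D'.cocycle_A, D'.Λ.endpoint, sub_zero]
    rfl

lemma existsUnique_isProjection (D' : AdjustedData IY σ IG G wp) :
    ∃! D : BundleData IY σ IG G, IsProjection D' D :=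
  ⟨projData D', ⟨fun _ => rfl, fun _ _ _ => rfl⟩, fun _ h =>
    BundleData.ext' (funext h.g_eq) (DForm.ext' h.A_eq)⟩

lemma IsLift.isProjection {D : BundleData IY σ IG G} {D' : AdjustedData IY σ IG G wp}
    (h : IsLift D D') (hwp1 : wp 1 = 1) : IsProjection D' D where
  g_eq y := (h.g_eq y).symm
  A_eq m p u := by rw [h.A_eq, hwp1, one_smul]

/-! ### Gauge transformations -/

section

/-- The identity gauge transformation. -/
def BundleGauge.refl (D : BundleData IY σ IG G) : BundleGauge D D where
  a _ := 1
  smooth_a _ _ := contMDiff_const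
  rel_g y := by simp
  rel_A m p u := (gaugeTransform_one _ _).symm

variable {D₁' D₂' : AdjustedData IY σ IG G wp} {D₁ D₂ : BundleData IY σ IG G}

/-- The endpoint of an adjusted gauge transformation. -/
def AdjustedGauge.proj (c : AdjustedGauge D₁' D₂') (h₁ : IsProjection D₁' D₁)
    (h₂ : IsProjection D₂' D₂) : BundleGauge D₁ D₂ where
  a y := flat IG G (c.a y)
  smooth_a m p := c.smooth_a.contMDiff_at p 1
  rel_g y := by
    rw [h₁.g_eq, h₂.g_eq, c.rel_g, map_mul, map_mul, map_mul, map_inv, (c.b y).2, mul_one]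
  rel_A m p u := by
    have h3 : D₁.A p = D₁'.A 1 p := funext fun x => h₁.A_eq m p x
    rw [h₂.A_eq, c.rel_A, c.l.endpoint, sub_zero, h3]
    rfl

lemma AdjustedData.h_eq (D : AdjustedData IY σ IG G wp) (y : FibrePower IY σ 3) :
    (D.h y : PathGroup IG G) =
      D.g (y.sub ![0, 2]) * (D.g (y.sub ![1, 2]))⁻¹ * (D.g (y.sub ![0, 1]))⁻¹ := by
  rw [D.cocycle_g]; group

lemma AdjustedData.Λ_eq (D : AdjustedData IY σ IG G wp) {m : ℕ} (p : Plot (FibrePower IY σ 2) m)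
    (u : TestSpace m) (t : unitInterval) :
    D.Λ t p u = gaugeTransform IG (fun u => (D.g (p u)).1 t) (D.A t (p.sub ![0])) u
      - D.A t (p.sub ![1]) u := by
  rw [D.cocycle_A, sub_sub_self]

/-- The loop of 1-forms `l_i = a_i⁻¹ A_i a_i + a_i⁻¹ da_i - A'_i`. -/
def liftL (h₁ : IsProjection D₁' D₁) (h₂ : IsProjection D₂' D₂) (α : BundleGauge D₁ D₂)
    (a' : FibrePower IY σ 1 → PathGroup IG G) (ha' : SmoothPathMap IG a')
    (hflat : ∀ y, flat IG G (a' y) = α.a y) : LoopForm (FibrePower IY σ 1) 1 EG :=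
  ((D₁'.A.gauge a' ha').sub D₂'.A).toLoopForm fun {m} p u => by
    change gaugeTransform IG (fun u => (a' (p u)).1 1) (D₁'.A 1 p) u - D₂'.A 1 p u = 0
    have h3 : D₁.A p = D₁'.A 1 p := funext fun x => h₁.A_eq m p x
    have h4 : (fun u => (a' (p u)).1 1) = fun u => α.a (p u) := funext fun u => hflat _
    rw [← h3, ← h₂.A_eq, α.rel_A, h4, sub_self]

lemma liftL_apply (h₁ : IsProjection D₁' D₁) (h₂ : IsProjection D₂' D₂) (α : BundleGauge D₁ D₂)
    (a' : FibrePower IY σ 1 → PathGroup IG G) (ha' : SmoothPathMap IG a')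
    (hflat : ∀ y, flat IG G (a' y) = α.a y) {m : ℕ} (p : Plot (FibrePower IY σ 1) m)
    (t : unitInterval) (u : TestSpace m) :
    liftL h₁ h₂ α a' ha' hflat t p u =
      gaugeTransform IG (fun u => (a' (p u)).1 t) (D₁'.A t p) u - D₂'.A t p u := rfl

/-- The adjusted gauge transformation whose first component is a given lift `a'` of a gauge
transformation: its other components are dictated by the transformation laws of `g` and `A`. -/
def liftGauge (hF₁ : D₁'.FakeFlat) (hF₂ : D₂'.FakeFlat) (h₁ : IsProjection D₁' D₁)
    (h₂ : IsProjection D₂' D₂) (α : BundleGauge D₁ D₂)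
    (a' : FibrePower IY σ 1 → PathGroup IG G) (ha' : SmoothPathMap IG a')
    (hflat : ∀ y, flat IG G (a' y) = α.a y) : AdjustedGauge D₁' D₂' where
  a := a'
  b y := ⟨a' (y.sub ![0]) * D₂'.g y * (a' (y.sub ![1]))⁻¹ * (D₁'.g y)⁻¹, by
    rw [MonoidHom.mem_ker, map_mul, map_mul, map_mul, map_inv, map_inv, hflat, hflat, ← h₁.g_eq,
      ← h₂.g_eq, α.rel_g]
    group⟩
  l := liftL h₁ h₂ α a' ha' hflat
  smooth_a := ha'
  smooth_b := (((ha'.pull ![0]).mul D₂'.smooth_g).mul (ha'.pull ![1]).inv).mul D₁'.smooth_g.inv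
  rel_h y := by
    apply Subtype.ext
    have e1 : (![0, 2] ∘ ![0] : Fin 1 → Fin 3) = ![0] := by decide
    have e2 : (![0, 2] ∘ ![1] : Fin 1 → Fin 3) = ![2] := by decide
    have e3 : (![1, 2] ∘ ![0] : Fin 1 → Fin 3) = ![1] := by decide
    have e4 : (![1, 2] ∘ ![1] : Fin 1 → Fin 3) = ![2] := by decide
    have e5 : (![0, 1] ∘ ![0] : Fin 1 → Fin 3) = ![0] := by decide
    have e6 : (![0, 1] ∘ ![1] : Fin 1 → Fin 3) = ![1] := by decide
    simp only [Subgroup.coe_mul, coe_act, AdjustedData.h_eq, FibrePower.sub_sub, e1, e2, e3, e4, e5,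
      e6, Subgroup.coe_inv]
    group
  rel_g y := by group
  rel_Λ m p u t := by
    rw [AdjustedData.Λ_eq, AdjustedData.Λ_eq]
    have hb := ((((ha'.pull ![0]).mul D₂'.smooth_g).mul (ha'.pull ![1]).inv).mul
        D₁'.smooth_g.inv).mdifferentiableAt p t u
    have key := gaugeTransform_coboundary (IG := IG) (Ai := D₁'.A t (p.sub ![0]))
      (Aj := D₁'.A t (p.sub ![1])) (Ai' := D₂'.A t (p.sub ![0])) (Aj' := D₂'.A t (p.sub ![1]) u)
      (D₁'.smooth_g.mdifferentiableAt p t u)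
      (D₂'.smooth_g.mdifferentiableAt p t u) ((ha'.pull ![0]).mdifferentiableAt p t u)
      ((ha'.pull ![1]).mdifferentiableAt p t u) hb fun x => by
        change (a' ((p x).sub ![0]) * D₂'.g (p x)).1 t = (a' ((p x).sub ![0]) * D₂'.g (p x) *
          (a' ((p x).sub ![1]))⁻¹ * (D₁'.g (p x))⁻¹ * (D₁'.g (p x) * a' ((p x).sub ![1]))).1 t
        refine congrArg (fun γ : PathGroup IG G => γ.1 t) ?_
        group
    exact key
  rel_A m p u t := by
    rw [liftL_apply, sub_sub_self]
  rel_B m p u v t :=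
    transform_loopForm_B ha' _ _ _ _ _ p p p u v
      (fun t x => by rw [liftL_apply, sub_sub_self])
      (hF₁ m p u v) (hF₂ m p u v) t

lemma AdjustedGauge.ext' {c c' : AdjustedGauge D₁' D₂'} (ha : c.a = c'.a) (hb : c.b = c'.b)
    (hl : c.l = c'.l) : c = c' := by
  cases c; cases c'
  congr

lemma AdjustedGauge.b_eq (c : AdjustedGauge D₁' D₂') (y : FibrePower IY σ 2) :
    (c.b y : PathGroup IG G) =
      c.a (y.sub ![0]) * D₂'.g y * (c.a (y.sub ![1]))⁻¹ * (D₁'.g y)⁻¹ := by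
  rw [c.rel_g]; group

lemma AdjustedGauge.l_eq (c : AdjustedGauge D₁' D₂') {m : ℕ} (p : Plot (FibrePower IY σ 1) m)
    (u : TestSpace m) (t : unitInterval) :
    c.l t p u = gaugeTransform IG (fun u => (c.a (p u)).1 t) (D₁'.A t p) u - D₂'.A t p u := by
  rw [c.rel_A, sub_sub_self]

/-- An adjusted gauge transformation is determined by its first component. -/
lemma AdjustedGauge.eq_of_a_eq {c c' : AdjustedGauge D₁' D₂'} (ha : c.a = c'.a) : c = c' := by
  refine AdjustedGauge.ext' ha ?_ ?_
  · funext y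
    apply Subtype.ext
    rw [b_eq, b_eq, ha]
  · exact LoopForm.ext' fun m p u t => by rw [l_eq, l_eq, ha]

/-! ### Higher gauge transformations -/

lemma isHigherGauge_of_flat_eq {c c' : AdjustedGauge D₁' D₂'}
    (h : ∀ y, flat IG G (c.a y) = flat IG G (c'.a y)) :
    IsHigherGauge c c' fun y => ⟨c'.a y * (c.a y)⁻¹, by
      rw [MonoidHom.mem_ker, map_mul, map_inv, h, mul_inv_cancel]⟩ where
  smooth := c'.smooth_a.mul c.smooth_a.inv
  rel_b y := by
    apply Subtype.ext
    simp only [Subgroup.coe_mul, coe_act, AdjustedGauge.b_eq, Subgroup.coe_inv]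
    group
  rel_a y := by group
  rel_l m p u t := by
    rw [AdjustedGauge.l_eq, AdjustedGauge.l_eq]
    refine gaugeTransform_higher (c.smooth_a.mdifferentiableAt p t u)
      ((c'.smooth_a.mul c.smooth_a.inv).mdifferentiableAt p t u) fun x => ?_
    change (c'.a (p x)).1 t = (c'.a (p x) * (c.a (p x))⁻¹ * c.a (p x)).1 t
    rw [inv_mul_cancel_right]

lemma IsHigherGauge.flat_eq {c c' : AdjustedGauge D₁' D₂'} {n : FibrePower IY σ 1 → LoopGroup IG G}
    (h : IsHigherGauge c c' n) (y : FibrePower IY σ 1) :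
    flat IG G (c.a y) = flat IG G (c'.a y) := by
  rw [h.rel_a, map_mul, (n y).2, one_mul]

end

end

/-! ### Smoothing continuous maps relative to a closed set -/

section

variable {EG HG : Type*} [NormedAddCommGroup EG] [NormedSpace ℝ EG] [TopologicalSpace HG]
  (IG : ModelWithCorners ℝ EG HG)
  {G : Type*} [TopologicalSpace G] [ChartedSpace HG G]
  {N : Type*} [TopologicalSpace N]

/-- Given a family `Q` of test maps into a space `N`, a map `f` out of `N` is smooth at `x` along
`Q` if its composition with every test map is smooth at all points that are sent to `x`. The test
maps are parametrised by `ℝᵐ × ℝ`, the last factor being the time parameter of a homotopy. -/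
def SmoothAlong (Q : ∀ m, Set (TestSpace m × ℝ → N)) (f : N → G) (x : N) : Prop :=
  ∀ m, ∀ q ∈ Q m, ∀ z, q z = x →
    ContMDiffAt (𝓘(ℝ, TestSpace m).prod 𝓘(ℝ, ℝ)) IG ∞ (fun z => f (q z)) z

variable {IG}

lemma SmoothAlong.congr {Q : ∀ m, Set (TestSpace m × ℝ → N)} (hQ : ∀ m, ∀ q ∈ Q m, Continuous q)
    {f f' : N → G} {x : N} (h : SmoothAlong IG Q f x) (hf : f' =ᶠ[𝓝 x] f) :
    SmoothAlong IG Q f' x := by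
  rintro m q hq z rfl
  exact (h m q hq z rfl).congr_of_eventuallyEq ((hQ m q hq).continuousAt.eventually hf)

variable {E𝒴 H𝒴 : Type*} [NormedAddCommGroup E𝒴] [NormedSpace ℝ E𝒴] [FiniteDimensional ℝ E𝒴]
  [TopologicalSpace H𝒴] (I𝒴 : ModelWithCorners ℝ E𝒴 H𝒴)
  {𝒴 : Type*} [TopologicalSpace 𝒴] [ChartedSpace H𝒴 𝒴] [IsManifold I𝒴 ∞ 𝒴] [T2Space 𝒴]
  [SigmaCompactSpace 𝒴]
  [FiniteDimensional ℝ EG] [IG.Boundaryless] [IsManifold IG ∞ G]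
  {e : N → 𝒴} (he : IsClosedEmbedding e)
  {Q : ∀ m, Set (TestSpace m × ℝ → N)}
  (hQ : ∀ m, ∀ q ∈ Q m,
    ContMDiff (𝓘(ℝ, TestSpace m).prod 𝓘(ℝ, ℝ)) I𝒴 ∞ (fun z => e (q z)))

/-- A continuous map stays within open constraints, imposed on a locally finite family of closed
sets, under small perturbations in a chart over a compact set. -/
lemma exists_perturbation_radius {W : ℕ → Set N} (hW : LocallyFinite W) {R : ℕ → Set G}
    (hR : ∀ i, IsOpen (R i)) {f : N → G} (hf : Continuous f)
    (hfR : ∀ i, ∀ x ∈ closure (W i), f x ∈ R i) (c : G) {K : Set N} (hK : IsCompact K)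
    (hKc : ∀ x ∈ K, f x ∈ (extChartAt IG c).source) :
    ∃ ε > 0, ∀ x ∈ K, ∀ δ : EG, ‖δ‖ < ε →
      extChartAt IG c (f x) + δ ∈ (extChartAt IG c).target ∧
      ∀ i, x ∈ closure (W i) → (extChartAt IG c).symm (extChartAt IG c (f x) + δ) ∈ R i := by
  have hWc := hW.closure
  have key := hK.eventually_forall_of_forall_eventually (x₀ := (0 : EG))
    (P := fun δ x => extChartAt IG c (f x) + δ ∈ (extChartAt IG c).target ∧
      ∀ i, x ∈ closure (W i) → (extChartAt IG c).symm (extChartAt IG c (f x) + δ) ∈ R i) ?_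
  · obtain ⟨ε, hε, h⟩ := Metric.eventually_nhds_iff.1 key
    exact ⟨ε, hε, fun x hx δ hδ => h (by simpa using hδ) x hx⟩
  intro x hx
  have hs := hKc x hx
  have h1 : Tendsto (fun z : EG × N => extChartAt IG c (f z.2) + z.1) (𝓝 (0, x))
      (𝓝 (extChartAt IG c (f x))) := by
    have h2 : ContinuousAt (fun z : EG × N => extChartAt IG c (f z.2)) (0, x) :=
      ContinuousAt.comp (g := extChartAt IG c) (continuousAt_extChartAt' hs)
        (hf.comp continuous_snd).continuousAt
    have h3 : Tendsto (fun z : EG × N => extChartAt IG c (f z.2) + z.1) (𝓝 (0, x))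
      (𝓝 (extChartAt IG c (f x) + 0)) := h2.add continuous_fst.continuousAt
    rwa [add_zero] at h3
  have h2 := h1.eventually (extChartAt_target_mem_nhds' ((extChartAt IG c).map_source hs))
  have h3 := (continuousAt_extChartAt_symm' hs).tendsto.comp h1
  rw [(extChartAt IG c).left_inv hs] at h3
  have h4 : ∀ᶠ w in 𝓝 (f x), ∀ i ∈ {i | x ∈ closure (W i)}, w ∈ R i :=
    (eventually_all_finite (hWc.point_finite x)).2 fun i hi => (hR i).mem_nhds (hfR i x hi)
  have h5 : ∀ᶠ z : EG × N in 𝓝 (0, x), {i | z.2 ∈ closure (W i)} ⊆ {i | x ∈ closure (W i)} :=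
    (continuous_snd.tendsto (0, x)).eventually
      (hWc.eventually_subset (fun _ => isClosed_closure) x)
  filter_upwards [h2, h3.eventually h4, h5] with z hz2 hz3 hz5
  exact ⟨hz2, fun i hi => hz3 i (hz5 hi)⟩

include he hQ in
/-- One step of the smoothing procedure: `f` is made smooth on the closed set `K` by a modification
in a chart, supported in the relatively compact open set `W k`. -/
lemma exists_smoothing_step {W : ℕ → Set N} (hW : LocallyFinite W) (hWo : ∀ i, IsOpen (W i))
    {c : ℕ → G} {f : N → G} (hf : Continuous f)
    (hfR : ∀ i, ∀ x ∈ closure (W i), f x ∈ (extChartAt IG (c i)).source) (k : ℕ)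
    (hWk : IsCompact (closure (W k))) {K : Set N} (hK : IsClosed K) (hKW : K ⊆ W k) :
    ∃ f' : N → G, Continuous f' ∧ (∀ i, ∀ x ∈ closure (W i), f' x ∈ (extChartAt IG (c i)).source) ∧
      (∀ x ∉ W k, f' x = f x) ∧ ∀ x, x ∈ K ∨ SmoothAlong IG Q f x → SmoothAlong IG Q f' x := by
  classical
  have : LocallyCompactSpace 𝒴 := Manifold.locallyCompact_of_finiteDimensional I𝒴
  have : TietzeExtension EG := TietzeExtension.of_tvs ℝ
  have hQc : ∀ m, ∀ q ∈ Q m, Continuous q := fun m q hq =>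
    he.isEmbedding.continuous_iff.2 (hQ m q hq).continuous
  set φ := extChartAt IG (c k) with hφ
  obtain ⟨ε, hε, hpert⟩ := exists_perturbation_radius (IG := IG) hW
    (fun i => isOpen_extChartAt_source (I := IG) (c i)) hf hfR (c k) hWk (hfR k)
  -- a continuous extension of `φ ∘ f` from the closure of `W k` to the ambient manifold
  obtain ⟨F₀, hF₀⟩ := ContinuousMap.exists_extension'
    (he.comp (isClosed_closure (s := W k)).isClosedEmbedding_subtypeVal)
    ⟨fun x : closure (W k) => φ (f x), (continuousOn_extChartAt (I := IG) (c k)).comp_continuous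
      (hf.comp continuous_subtype_val) fun x => hfR k x x.2⟩
  have hF₀' : ∀ x ∈ closure (W k), F₀ (e x) = φ (f x) := fun x hx => congrFun hF₀ ⟨x, hx⟩
  obtain ⟨F₁, hF₁, -⟩ := Continuous.exists_contMDiff_approx I𝒴 (ε := fun _ => ε) ⊤ F₀.continuous
    continuous_const fun _ => hε
  obtain ⟨χ, hχ0, hχ1, hχ⟩ := exists_contMDiffMap_zero_one_nhds_of_isClosed I𝒴 (n := ⊤)
    (he.isClosedMap _ (hWo k).isClosed_compl) (he.isClosedMap _ hK)
    (Set.disjoint_image_of_injective he.injective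
      (Set.disjoint_left.2 fun x hx hxK => hx (hKW hxK)))
  have hχ0' : ∀ x ∉ W k, ∀ᶠ y in 𝓝 x, χ (e y) = 0 := fun x hx =>
    he.continuous.continuousAt.eventually
      (hχ0.filter_mono (nhds_le_nhdsSet (Set.mem_image_of_mem e hx)))
  have hχ1' : ∀ x ∈ K, ∀ᶠ y in 𝓝 x, χ (e y) = 1 := fun x hx =>
    he.continuous.continuousAt.eventually
      (hχ1.filter_mono (nhds_le_nhdsSet (Set.mem_image_of_mem e hx)))
  let w : N → EG := fun x => φ (f x) + χ (e x) • (F₁ (e x) - φ (f x))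
  have hw : ∀ x ∈ closure (W k), w x ∈ φ.target ∧
      ∀ i, x ∈ closure (W i) → φ.symm (w x) ∈ (extChartAt IG (c i)).source := by
    intro x hx
    refine hpert x hx _ ?_
    have h1 := hF₁ (e x)
    rw [hF₀' x hx, dist_eq_norm] at h1
    rw [norm_smul, Real.norm_of_nonneg (hχ _).1]
    exact (mul_le_of_le_one_left (norm_nonneg _) (hχ _).2).trans_lt h1
  let f' : N → G := fun x => if x ∈ W k then φ.symm (w x) else f x
  have hf'W : ∀ x ∈ W k, f' =ᶠ[𝓝 x] fun y => φ.symm (w y) := fun x hx => by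
    filter_upwards [(hWo k).mem_nhds hx] with y hy
    exact if_pos hy
  have hf'W' : ∀ x ∉ W k, f' =ᶠ[𝓝 x] f := fun x hx => by
    filter_upwards [hχ0' x hx] with y hy
    by_cases hyW : y ∈ W k
    · simp only [f', if_pos hyW, w, hy, zero_smul, add_zero]
      exact φ.left_inv (hfR k y (subset_closure hyW))
    · exact if_neg hyW
  have hsource : ∀ x ∈ W k, f x ∈ φ.source := fun x hx => hfR k x (subset_closure hx)
  refine ⟨f', continuous_iff_continuousAt.2 fun x => ?_, fun i x hx => ?_, fun x hx => if_neg hx,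
    fun x hx => ?_⟩
  · by_cases hxW : x ∈ W k
    · refine ContinuousAt.congr ?_ (hf'W x hxW).symm
      have h1 : ContinuousAt (fun y => φ (f y)) x :=
        ContinuousAt.comp (g := φ) (continuousAt_extChartAt' (hsource x hxW)) hf.continuousAt
      have h2 : ContinuousAt w x :=
        h1.add (((χ.contMDiff.continuous.comp he.continuous).continuousAt).smul
          (((F₁.contMDiff.continuous.comp he.continuous).continuousAt).sub h1))
      exact ContinuousAt.comp (g := φ.symm)
        ((continuousOn_extChartAt_symm (c k)).continuousAt
          (extChartAt_target_mem_nhds' (hw x (subset_closure hxW)).1)) h2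
    · exact hf.continuousAt.congr (hf'W' x hxW).symm
  · by_cases hxW : x ∈ W k
    · simp only [f', if_pos hxW]
      exact (hw x (subset_closure hxW)).2 i hx
    · simp only [f', if_neg hxW]
      exact hfR i x hx
  · by_cases hxW : x ∈ W k
    · refine SmoothAlong.congr hQc ?_ (hf'W x hxW)
      rintro m q hq z rfl
      have hsymm : ContMDiffAt 𝓘(ℝ, EG) IG ∞ φ.symm (w (q z)) :=
        (contMDiffOn_extChartAt_symm (c k)).contMDiffAt
          (extChartAt_target_mem_nhds' (hw _ (subset_closure hxW)).1)
      have hF₁q : ContMDiffAt (𝓘(ℝ, TestSpace m).prod 𝓘(ℝ, ℝ)) 𝓘(ℝ, EG) ∞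
        (fun z => F₁ (e (q z))) z := (F₁.contMDiff.comp (hQ m q hq)) z
      refine ContMDiffAt.comp (g := φ.symm) z hsymm ?_
      rcases hx with hxK | hx
      · refine hF₁q.congr_of_eventuallyEq ?_
        filter_upwards [(hQc m q hq).continuousAt.eventually (hχ1' _ hxK)] with z' hz'
        simp only [w, hz', one_smul, add_sub_cancel]
      · have h1 : ContMDiffAt (𝓘(ℝ, TestSpace m).prod 𝓘(ℝ, ℝ)) 𝓘(ℝ, EG) ∞
            (fun z => φ (f (q z))) z :=
          ContMDiffAt.comp (g := φ) z (contMDiffAt_extChartAt' (by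
            have := hsource _ hxW
            rwa [hφ, extChartAt_source] at this)) (hx m q hq z rfl)
        have hχq : ContMDiffAt (𝓘(ℝ, TestSpace m).prod 𝓘(ℝ, ℝ)) 𝓘(ℝ, ℝ) ∞
          (fun z => χ (e (q z))) z := (χ.contMDiff.comp (hQ m q hq)) z
        exact h1.add (hχq.smul (hF₁q.sub h1))
    · exact SmoothAlong.congr hQc (hx.resolve_left fun h => hxW (hKW h)) (hf'W' x hxW)

include he hQ in
/-- A continuous map that is smooth on a neighbourhood `O` of a closed set `C` agrees on `C` with a
smooth map. -/
theorem exists_smoothing {f : N → G} (hf : Continuous f) {O C : Set N} (hO : IsOpen O)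
    (hC : IsClosed C) (hCO : C ⊆ O) (hfO : ∀ x ∈ O, SmoothAlong IG Q f x) :
    ∃ f' : N → G, (∀ x, SmoothAlong IG Q f' x) ∧ ∀ x ∈ C, f' x = f x := by
  classical
  rcases isEmpty_or_nonempty N with hN | hN
  · exact ⟨f, fun x => hN.elim x, fun x => hN.elim x⟩
  have : LocallyCompactSpace 𝒴 := Manifold.locallyCompact_of_finiteDimensional I𝒴
  have : LocallyCompactSpace N := he.locallyCompactSpace
  have : SigmaCompactSpace N := he.sigmaCompactSpace
  have : T2Space N := he.isEmbedding.t2Space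
  have hQc : ∀ m, ∀ q ∈ Q m, Continuous q := fun m q hq =>
    he.isEmbedding.continuous_iff.2 (hQ m q hq).continuous
  -- small open sets, each of which lies in `O` or misses `C`
  have hV : ∀ x, ∃ V : Set N, IsOpen V ∧ x ∈ V ∧ IsCompact (closure V) ∧
      (∀ y ∈ closure V, f y ∈ (extChartAt IG (f x)).source) ∧ (V ⊆ O ∨ Disjoint V C) := by
    intro x
    have hU : ∃ U : Set N, IsOpen U ∧ x ∈ U ∧ (U ⊆ O ∨ Disjoint U C) := by
      by_cases hx : x ∈ O
      · exact ⟨O, hO, hx, Or.inl subset_rfl⟩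
      · exact ⟨Cᶜ, hC.isOpen_compl, fun h => hx (hCO h), Or.inr disjoint_compl_left⟩
    obtain ⟨U, hUo, hxU, hU⟩ := hU
    obtain ⟨V, hVo, hxV, hVc, hVK⟩ := exists_open_between_and_isCompact_closure
      (isCompact_singleton (x := x))
      (hUo.inter ((isOpen_extChartAt_source (I := IG) (f x)).preimage hf))
      (Set.singleton_subset_iff.2 ⟨hxU, mem_extChartAt_source (f x)⟩)
    refine ⟨V, hVo, hxV rfl, hVK, fun y hy => (hVc hy).2, ?_⟩
    have hVU : V ⊆ U := fun y hy => (hVc (subset_closure hy)).1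
    exact hU.imp hVU.trans fun h => h.mono_left hVU
  choose V hVo hxV hVc hVs hVC using hV
  obtain ⟨s, hs, hsV⟩ := countable_cover_nhds_of_sigmaCompact fun x => (hVo x).mem_nhds (hxV x)
  have hsne : s.Nonempty := by
    obtain ⟨x⟩ := hN
    obtain ⟨y, hy, -⟩ := Set.mem_iUnion₂.1 (hsV.symm ▸ Set.mem_univ x)
    exact ⟨y, hy⟩
  obtain ⟨c, rfl⟩ := hs.exists_eq_range hsne
  rw [Set.biUnion_range] at hsV
  obtain ⟨W, hWo, hWU, hW, hWV⟩ := precise_refinement (fun i => V (c i)) (fun i => hVo _) hsV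
  obtain ⟨K, hKU, hK, hKW⟩ := exists_iUnion_eq_closed_subset hWo hW.point_finite hWU
  -- the maps that occur during the procedure
  let Good : (N → G) → Prop := fun F => Continuous F ∧
    (∀ i, ∀ x ∈ closure (W i), F x ∈ (extChartAt IG (f (c i))).source) ∧
    (∀ x ∈ C, F x = f x) ∧ ∀ x ∈ O, SmoothAlong IG Q F x
  have step : ∀ (F : {F // Good F}) (k : ℕ), ∃ F' : {F // Good F},
      (∀ x ∉ W k, F'.1 x = F.1 x) ∧
      ∀ x, x ∈ K k ∨ SmoothAlong IG Q F.1 x → SmoothAlong IG Q F'.1 x := by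
    rintro ⟨F, hF, hFs, hFC, hFO⟩ k
    rcases hVC (c k) with hk | hk
    · refine ⟨⟨F, hF, hFs, hFC, hFO⟩, fun _ _ => rfl, fun x hx => ?_⟩
      exact hx.elim (fun h => hFO x (hk (hWV k (hKW k h)))) id
    · obtain ⟨F', h1, h2, h3, h4⟩ := exists_smoothing_step I𝒴 he hQ hW hWo (c := fun i => f (c i))
        hF hFs k ((hVc (c k)).of_isClosed_subset isClosed_closure (closure_mono (hWV k)))
        (hK k) (hKW k)
      exact ⟨⟨F', h1, h2, fun x hx => (h3 x fun hxW =>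
        Set.disjoint_left.1 hk (hWV k hxW) hx).trans (hFC x hx),
        fun x hx => h4 x (Or.inr (hFO x hx))⟩,
        h3, h4⟩
  choose next hnext hnext' using step
  let F : ℕ → {F // Good F} := fun k => Nat.rec
    ⟨f, hf, fun i x hx => hVs _ x (closure_mono (hWV i) hx), fun _ _ => rfl, hfO⟩
    (fun k F => next F k) k
  have hFsucc : ∀ k, F (k + 1) = next (F k) k := fun k => rfl
  -- the sequence is locally eventually constant
  have hstab : ∀ (x : N) (k : ℕ), (∀ j ≥ k, x ∉ W j) → ∀ j ≥ k, (F j).1 x = (F k).1 x := by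
    intro x k hk j hj
    induction j, hj using Nat.le_induction with
    | base => rfl
    | succ j hj ih => rw [hFsucc, hnext _ _ x (hk j hj), ih]
  have hbound : ∀ x : N, ∃ k, ∀ᶠ y in 𝓝 x, ∀ j ≥ k, y ∉ W j := by
    intro x
    obtain ⟨t, ht, htW⟩ := hW x
    obtain ⟨b, hb⟩ := htW.bddAbove
    refine ⟨b + 1, Filter.eventually_of_mem ht fun y hy j hj hyW => ?_⟩
    have := hb (show j ∈ {i | (W i ∩ t).Nonempty} from ⟨y, hyW, hy⟩)
    omega
  choose b hb using hbound
  have hF' : ∀ x k, b x ≤ k → (fun y => (F (b y)).1 y) =ᶠ[𝓝 x] (F k).1 := by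
    intro x k hk
    filter_upwards [hb x] with y hy
    rw [← hstab y (b y) (hb y).self_of_nhds (max (b y) k) (le_max_left _ _)]
    exact hstab y k (fun j hj => hy j (hk.trans hj)) _ (le_max_right _ _)
  have hmono : ∀ x k, SmoothAlong IG Q (F k).1 x → ∀ j ≥ k, SmoothAlong IG Q (F j).1 x := by
    intro x k hk j hj
    induction j, hj using Nat.le_induction with
    | base => exact hk
    | succ j hj ih => exact hnext' _ _ x (Or.inr ih)
  refine ⟨fun y => (F (b y)).1 y, fun x => ?_, fun x hx => (F (b x)).2.2.2.1 x hx⟩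
  obtain ⟨i, hi⟩ := Set.mem_iUnion.1 (hKU.symm ▸ Set.mem_univ x)
  refine SmoothAlong.congr hQc (hmono x (i + 1) (hnext' _ _ x (Or.inl hi)) (max (b x) (i + 1))
    (le_max_right _ _)) (hF' x _ (le_max_left _ _))

end

/-! ### Smooth maps on the double fibre product are continuous -/

section

variable {EX HX EY HY : Type*}
  [NormedAddCommGroup EX] [NormedSpace ℝ EX] [FiniteDimensional ℝ EX] [TopologicalSpace HX]
  [NormedAddCommGroup EY] [NormedSpace ℝ EY] [FiniteDimensional ℝ EY] [TopologicalSpace HY]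
  {IX : ModelWithCorners ℝ EX HX} [IX.Boundaryless]
  {IY : ModelWithCorners ℝ EY HY} [IY.Boundaryless]
  {X Y : Type*} [TopologicalSpace X] [ChartedSpace HX X] [IsManifold IX ∞ X]
  [TopologicalSpace Y] [ChartedSpace HY Y] [IsManifold IY ∞ Y] {σ : Y → X}
  {EG HG : Type*} [NormedAddCommGroup EG] [NormedSpace ℝ EG] [TopologicalSpace HG]
  {IG : ModelWithCorners ℝ EG HG}
  {G : Type*} [TopologicalSpace G] [ChartedSpace HG G]

/-- A smooth map on a fibre power is continuous at a point near which the fibre power has a smooth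
parametrisation `P` with a continuous inverse `s`. -/
lemma SmoothMap.continuousAt_of_param {V : Type*} [NormedAddCommGroup V] [NormedSpace ℝ V]
    [FiniteDimensional ℝ V] {n : ℕ} {f : FibrePower IY σ n → G} (hf : SmoothMap IG f)
    {y₀ : FibrePower IY σ n} {O : Set V} (hO : IsOpen O) {P : V → Fin n → Y}
    (hP : ∀ i, ContMDiffOn 𝓘(ℝ, V) IY ∞ (fun v => P v i) O)
    (hPσ : ∀ v ∈ O, ∀ i j, σ (P v i) = σ (P v j)) {s : FibrePower IY σ n → V}
    (hs : ContinuousAt s y₀) (hsO : s y₀ ∈ O) (hPs : ∀ᶠ y in 𝓝 y₀, P (s y) = y.1) :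
    ContinuousAt f y₀ := by
  let T : V ≃L[ℝ] TestSpace (Module.finrank ℝ V) := toEuclidean
  have hO' : IsOpen (T.symm ⁻¹' O) := hO.preimage T.symm.continuous
  obtain ⟨r, hr, hrO⟩ := Metric.isOpen_iff.1 hO' (T (s y₀)) (by simpa using hsO)
  -- Plots are defined on all of `ℝᵐ`, so a ball in `O` is parametrised by `ℝᵐ`.
  let β := OpenPartialHomeomorph.univBall (T (s y₀)) r
  have hβO : ∀ x, T.symm (β x) ∈ O := fun x => hrO (by
    have h := β.map_source (x := x) (by simp [β])
    rwa [OpenPartialHomeomorph.univBall_target _ hr] at h)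
  have hβ : ContMDiff 𝓘(ℝ, TestSpace (Module.finrank ℝ V)) 𝓘(ℝ, V) ∞ fun x => T.symm (β x) :=
    (T.symm.contDiff.comp (OpenPartialHomeomorph.contDiff_univBall (n := ⊤))).contMDiff
  let p : Plot (FibrePower IY σ n) (Module.finrank ℝ V) :=
    ⟨fun x => ⟨P (T.symm (β x)), hPσ _ (hβO x)⟩, fun i => (hP i).comp_contMDiff hβ hβO⟩
  have hball : T (s y₀) ∈ Metric.ball (T (s y₀)) r := Metric.mem_ball_self hr
  have h1 : ContinuousAt (fun y => β.symm (T (s y))) y₀ :=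
    ContinuousAt.comp (g := β.symm)
      ((OpenPartialHomeomorph.continuousOn_univBall_symm _ _).continuousAt
      (Metric.isOpen_ball.mem_nhds hball)) (T.continuous.continuousAt.comp hs)
  have h2 : ContinuousAt (fun y => f (p (β.symm (T (s y))))) y₀ :=
    ContinuousAt.comp (g := fun x => f (p x)) (hf _ p).continuous.continuousAt h1
  refine h2.congr ?_
  filter_upwards [hPs, (T.continuous.continuousAt.comp hs).eventually
    (Metric.isOpen_ball.mem_nhds hball)] with y hy hyr
  refine congrArg f (Subtype.ext ?_)
  change P (T.symm (β (β.symm (T (s y))))) = y.1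
  rw [β.right_inv (by rw [OpenPartialHomeomorph.univBall_target _ hr]; exact hyr),
    T.symm_apply_apply, hy]

/-- Near a pair `(a, b)`, the fibre product `Y ×_X Y` is parametrised by the coordinates of the
first entry and the fibre coordinates of the second one, in a chart adapted to the submersion at
`b`. -/
lemma SmoothMap.continuous (hσ : Manifold.IsSubmersion IY IX ∞ σ) {f : FibrePower IY σ 2 → G}
    (hf : SmoothMap IG f) : Continuous f := by
  refine continuous_iff_continuousAt.2 fun y₀ => ?_
  have h := hσ.isSubmersionAt (y₀.1 1)
  let φ := extChartAt IY (y₀.1 0)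
  let φ' := h.domChart.extend IY
  let ψ := h.codChart.extend IX
  let L := h.equiv
  have : FiniteDimensional ℝ (EX × h.complement) := L.toLinearEquiv.finiteDimensional
  have : FiniteDimensional ℝ h.complement :=
    Module.Finite.of_surjective (LinearMap.snd ℝ EX h.complement) Prod.snd_surjective
  have hcont0 : Continuous fun y : FibrePower IY σ 2 => y.1 0 :=
    (continuous_apply 0).comp continuous_subtype_val
  have hcont1 : Continuous fun y : FibrePower IY σ 2 => y.1 1 :=
    (continuous_apply 1).comp continuous_subtype_val
  have hφ' : ∀ y ∈ h.domChart.source, φ' y ∈ φ'.target := fun y hy =>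
    φ'.map_source (by rwa [OpenPartialHomeomorph.extend_source])
  have hleft' : ∀ y ∈ h.domChart.source, φ'.symm (φ' y) = y := fun y hy =>
    h.domChart.extend_left_inv hy
  have hψ : ∀ y ∈ h.domChart.source, ψ (σ y) = (L (φ' y)).1 := fun y hy => by
    have := h.writtenInCharts (hφ' y hy)
    simp only [Function.comp_apply] at this
    rw [← this]
    exact congrArg (fun z => ψ (σ z)) (hleft' y hy).symm
  let c : EY × h.complement → EY := fun v => L.symm (ψ (σ (φ.symm v.1)), v.2)
  let O₁ : Set (EY × h.complement) := {v | v.1 ∈ φ.target ∧ σ (φ.symm v.1) ∈ h.codChart.source}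
  have hφsymm : ContMDiffOn 𝓘(ℝ, EY × h.complement) IY ∞ (fun v => φ.symm v.1) O₁ :=
    (contMDiffOn_extChartAt_symm (y₀.1 0)).comp
      (contDiff_fst (𝕜 := ℝ) (E := EY) (F := h.complement)).contMDiff.contMDiffOn fun v hv => hv.1
  have hO₁ : IsOpen O₁ := by
    have h1 : IsOpen {v : EY × h.complement | v.1 ∈ φ.target} :=
      (isOpen_extChartAt_target (I := IY) (y₀.1 0)).preimage continuous_fst
    have h2 : ContinuousOn (fun v : EY × h.complement => σ (φ.symm v.1)) {v | v.1 ∈ φ.target} :=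
      hσ.contMDiff.continuous.comp_continuousOn
        ((continuousOn_extChartAt_symm (y₀.1 0)).comp continuous_fst.continuousOn fun v hv => hv)
    exact h2.isOpen_inter_preimage h1 h.codChart.open_source
  have hc : ContMDiffOn 𝓘(ℝ, EY × h.complement) 𝓘(ℝ, EY) ∞ c O₁ := by
    have h1 : ContMDiffOn 𝓘(ℝ, EY × h.complement) 𝓘(ℝ, EX) ∞ (fun v => ψ (σ (φ.symm v.1))) O₁ :=
      (OpenPartialHomeomorph.contMDiffOn_extend h.codChart_mem_maximalAtlas).comp
        (hσ.contMDiff.comp_contMDiffOn hφsymm) fun v hv => hv.2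
    exact L.symm.contDiff.contMDiff.comp_contMDiffOn
      (h1.prodMk_space (contDiff_snd (𝕜 := ℝ) (E := EY) (F := h.complement)).contMDiff.contMDiffOn)
  let O : Set (EY × h.complement) := O₁ ∩ c ⁻¹' φ'.target
  have hO : IsOpen O :=
    hc.continuousOn.isOpen_inter_preimage hO₁ h.domChart.isOpen_extend_target
  -- On the fibre product, `c` recovers the coordinates of the second entry.
  have hcs : ∀ y : FibrePower IY σ 2, y.1 0 ∈ φ.source → y.1 1 ∈ h.domChart.source →
      c (φ (y.1 0), (L (φ' (y.1 1))).2) = φ' (y.1 1) := fun y hy0 hy1 => by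
    simp only [c]
    rw [φ.left_inv hy0, y.2 0 1, hψ _ hy1, Prod.mk.eta, L.symm_apply_apply]
  have h0 : y₀.1 0 ∈ φ.source := mem_extChartAt_source _
  refine hf.continuousAt_of_param (V := EY × h.complement) hO
    (P := fun v => ![φ.symm v.1, φ'.symm (c v)])
    (s := fun y => (φ (y.1 0), (L (φ' (y.1 1))).2)) ?_ ?_ ?_ ?_ ?_
  · intro i
    fin_cases i
    · exact hφsymm.mono Set.inter_subset_left
    · refine (contMDiffOn_extend_symm h.domChart_mem_maximalAtlas).comp
        (hc.mono Set.inter_subset_left) fun v hv => ?_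
      rw [← OpenPartialHomeomorph.extend_target']
      exact hv.2
  · have key : ∀ v ∈ O, σ (φ.symm v.1) = σ (φ'.symm (c v)) := by
      intro v hv
      have h1 : φ'.symm (c v) ∈ h.domChart.source := by
        have := φ'.map_target hv.2
        rwa [OpenPartialHomeomorph.extend_source] at this
      have h2 : ψ (σ (φ'.symm (c v))) = ψ (σ (φ.symm v.1)) := by
        rw [hψ _ h1, φ'.right_inv hv.2]
        simp only [c, L.apply_symm_apply]
      refine (ψ.injOn ?_ ?_ h2).symm
      · rw [OpenPartialHomeomorph.extend_source]
        exact h.source_subset_preimage_source h1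
      · rw [OpenPartialHomeomorph.extend_source]
        exact hv.1.2
    intro v hv i j
    fin_cases i <;> fin_cases j
    · rfl
    · exact key v hv
    · exact (key v hv).symm
    · rfl
  · refine ContinuousAt.prodMk ?_ ?_
    · exact ContinuousAt.comp (g := φ) (continuousAt_extChartAt _) hcont0.continuousAt
    · refine (continuous_snd.comp L.continuous).continuousAt.comp ?_
      exact ContinuousAt.comp (g := φ') (h.domChart.continuousAt_extend h.mem_domChart_source)
        hcont1.continuousAt
  · refine ⟨⟨φ.map_source h0, ?_⟩, ?_⟩
    · change σ (φ.symm (φ (y₀.1 0))) ∈ _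
      rw [φ.left_inv h0, y₀.2 0 1]
      exact h.mem_codChart_source
    · rw [Set.mem_preimage, hcs y₀ h0 h.mem_domChart_source]
      exact hφ' _ h.mem_domChart_source
  · filter_upwards [hcont0.continuousAt.eventually (extChartAt_source_mem_nhds (I := IY) (y₀.1 0)),
      hcont1.continuousAt.eventually
        (h.domChart.open_source.mem_nhds h.mem_domChart_source)] with y hy0 hy1
    rw [hcs y hy0 hy1, hleft' _ hy1]
    funext i
    fin_cases i
    · exact φ.left_inv hy0
    · rfl

end

/-! ### Lifting along the endpoint evaluation -/

section

variable {EG HG : Type*} [NormedAddCommGroup EG] [NormedSpace ℝ EG] [TopologicalSpace HG]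
  {G : Type*} [TopologicalSpace G] [ChartedSpace HG G]

lemma pathConnectedSpace_of_boundaryless (IG : ModelWithCorners ℝ EG HG) [IG.Boundaryless]
    [ConnectedSpace G] : PathConnectedSpace G := by
  have : LocallyPathConnectedSpace HG := IG.toHomeomorph.isOpenEmbedding.locallyPathConnectedSpace
  have := ChartedSpace.locallyPathConnectedSpace HG G
  exact pathConnectedSpace_iff_connectedSpace.2 inferInstance

/-- On a contractible set, a map to a path-connected space can be deformed to a given constant map;
the deformation may be taken to be constant near both ends. -/
lemma exists_deformation {M : Type*} [TopologicalSpace M] [PathConnectedSpace G] {f : M → G}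
    (hf : Continuous f) (c : G) (U : Set M) [ContractibleSpace U] :
    ∃ H : M × ℝ → G, ContinuousOn H (U ×ˢ Set.univ) ∧
      ∀ y ∈ U, (∀ t ≤ 1 / 3, H (y, t) = c) ∧ ∀ t ≥ 2 / 3, H (y, t) = f y := by
  classical
  let fU : C(U, G) := ⟨fun y => f y, hf.comp continuous_subtype_val⟩
  obtain ⟨x, hx⟩ := (id_nullhomotopic U).comp_right fU
  have h1 : (ContinuousMap.const U c).Homotopic fU := by
    refine ContinuousMap.Homotopic.trans ?_ hx.symm
    exact ContinuousMap.homotopic_const_iff.2 (PathConnectedSpace.joined c x)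
  obtain ⟨F⟩ := h1
  let r : ℝ → unitInterval := fun t => Set.projIcc 0 1 zero_le_one (3 * t - 1)
  have hr : Continuous r := continuous_projIcc.comp (by fun_prop)
  refine ⟨fun z => if h : z.1 ∈ U then F (r z.2, ⟨z.1, h⟩) else c, ?_, fun y hy => ⟨?_, ?_⟩⟩
  · rw [continuousOn_iff_continuous_domRestrict]
    have h2 : Continuous fun z : (U ×ˢ Set.univ : Set (M × ℝ)) =>
        F (r z.1.2, ⟨z.1.1, z.2.1⟩) :=
      F.continuous.comp ((hr.comp (continuous_snd.comp continuous_subtype_val)).prodMk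
        ((continuous_fst.comp continuous_subtype_val).subtype_mk _))
    refine h2.congr fun z => ?_
    simp only [Set.domRestrict_apply, dif_pos z.2.1]
  · intro t ht
    have h2 : r t = 0 := Set.projIcc_of_le_left _ (by linarith)
    simp only [dif_pos hy, h2]
    exact F.apply_zero _
  · intro t ht
    have h2 : r t = 1 := Set.projIcc_of_right_le _ (by linarith)
    simp only [dif_pos hy, h2]
    exact F.apply_one _

/-- The deformations over the components of a disjoint union of contractible spaces. -/
lemma IsDisjointUnionOfContractibles.exists_deformation {M : Type*} [TopologicalSpace M]
    (hM : IsDisjointUnionOfContractibles M) [PathConnectedSpace G] {f : M → G}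
    (hf : Continuous f) (c : G) :
    ∃ H : M × ℝ → G, Continuous H ∧
      ∀ y, (∀ t ≤ 1 / 3, H (y, t) = c) ∧ ∀ t ≥ 2 / 3, H (y, t) = f y := by
  obtain ⟨𝒰, h𝒰, hdisj, hcover⟩ := hM
  have h1 : ∀ U ∈ 𝒰, ∃ H : M × ℝ → G, ContinuousOn H (U ×ˢ Set.univ) ∧
      ∀ y ∈ U, (∀ t ≤ 1 / 3, H (y, t) = c) ∧ ∀ t ≥ 2 / 3, H (y, t) = f y := fun U hU => by
    have := (h𝒰 U hU).2
    exact LoopBundle.exists_deformation hf c U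
  choose! H hH hH' using h1
  have h2 : ∀ y, ∃ U ∈ 𝒰, y ∈ U := fun y => Set.mem_sUnion.1 (hcover.symm ▸ Set.mem_univ y)
  choose U hU hyU using h2
  have huniq : ∀ y, ∀ V ∈ 𝒰, y ∈ V → U y = V := fun y V hV hy => by
    by_contra hne
    exact Set.disjoint_left.1 (hdisj (hU y) hV hne) (hyU y) hy
  refine ⟨fun z => H (U z.1) z, continuous_iff_continuousAt.2 fun z => ?_,
    fun y => hH' _ (hU y) y (hyU y)⟩
  have hnhds : U z.1 ×ˢ Set.univ ∈ 𝓝 z :=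
    ((h𝒰 _ (hU z.1)).1.prod isOpen_univ).mem_nhds ⟨hyU z.1, trivial⟩
  refine ((hH _ (hU z.1)).continuousAt hnhds).congr ?_
  filter_upwards [hnhds] with z' hz'
  rw [huniq z'.1 _ (hU z.1) hz'.1]

end

section

variable {EX HX EY HY : Type*}
  [NormedAddCommGroup EX] [NormedSpace ℝ EX] [FiniteDimensional ℝ EX] [TopologicalSpace HX]
  [NormedAddCommGroup EY] [NormedSpace ℝ EY] [FiniteDimensional ℝ EY] [TopologicalSpace HY]
  {IX : ModelWithCorners ℝ EX HX} [IX.Boundaryless]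
  {IY : ModelWithCorners ℝ EY HY} [IY.Boundaryless]
  {X Y : Type*}
  [TopologicalSpace X] [ChartedSpace HX X] [IsManifold IX ∞ X] [T2Space X]
  [TopologicalSpace Y] [ChartedSpace HY Y] [IsManifold IY ∞ Y] [T2Space Y] [SigmaCompactSpace Y]
  {σ : Y → X}
  {EG HG : Type*} [NormedAddCommGroup EG] [NormedSpace ℝ EG] [FiniteDimensional ℝ EG]
  [TopologicalSpace HG] {IG : ModelWithCorners ℝ EG HG} [IG.Boundaryless]
  {G : Type*} [TopologicalSpace G] [ChartedSpace HG G] [Group G] [LieGroup IG ∞ G]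
  [ConnectedSpace G]

lemma isClosedEmbedding_fibrePower_two (hσ : Continuous σ) :
    IsClosedEmbedding fun z : FibrePower IY σ 2 × ℝ => ((z.1.1 0, z.1.1 1), z.2) := by
  have h1 : IsClosed {y : Fin 2 → Y | ∀ i j, σ (y i) = σ (y j)} := by
    simp only [Set.ofPred_forall]
    exact isClosed_iInter fun i => isClosed_iInter fun j =>
      isClosed_eq (hσ.comp (continuous_apply i)) (hσ.comp (continuous_apply j))
  have h2 : IsClosedEmbedding fun y : FibrePower IY σ 2 => (y.1 0, y.1 1) :=
    (Homeomorph.finTwoArrow (X := Y)).isClosedEmbedding.comp h1.isClosedEmbedding_subtypeVal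
  exact h2.prodMap IsClosedEmbedding.id

/-- Over the double fibre product of a good cover, every smooth map to a connected Lie group lifts
along `♭`: it is homotopic to a constant map, and the homotopy can be made smooth. -/
theorem exists_smoothPathMap_two (hσ : IsGoodCover IY IX σ) {g : FibrePower IY σ 2 → G}
    (hg : SmoothMap IG g) :
    ∃ g' : FibrePower IY σ 2 → PathGroup IG G, SmoothPathMap IG g' ∧
      ∀ y, flat IG G (g' y) = g y := by
  have : PathConnectedSpace G := pathConnectedSpace_of_boundaryless IG
  obtain ⟨H, hH, hH'⟩ := (hσ.contractible 2 (by norm_num)).exists_deformation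
    (SmoothMap.continuous hσ.submersion hg) (1 : G)
  let Q : ∀ m, Set (TestSpace m × ℝ → FibrePower IY σ 2 × ℝ) := fun m =>
    {q | ∃ p : Plot (FibrePower IY σ 2) m, q = fun z => (p z.1, z.2)}
  have hQ : ∀ m, ∀ q ∈ Q m, ContMDiff (𝓘(ℝ, TestSpace m).prod 𝓘(ℝ, ℝ))
      ((IY.prod IY).prod 𝓘(ℝ, ℝ)) ∞ (fun z => (((q z).1.1 0, (q z).1.1 1), (q z).2)) := by
    rintro m _ ⟨p, rfl⟩
    exact (((p.2 0).comp contMDiff_fst).prodMk ((p.2 1).comp contMDiff_fst)).prodMk contMDiff_snd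
  have hO : IsOpen {z : FibrePower IY σ 2 × ℝ | z.2 < 1 / 3 ∨ 2 / 3 < z.2} :=
    (isOpen_lt continuous_snd continuous_const).union (isOpen_lt continuous_const continuous_snd)
  have hC : IsClosed {z : FibrePower IY σ 2 × ℝ | z.2 ≤ 0 ∨ 1 ≤ z.2} :=
    (isClosed_le continuous_snd continuous_const).union
      (isClosed_le continuous_const continuous_snd)
  obtain ⟨γ, hγ, hγ'⟩ := exists_smoothing ((IY.prod IY).prod 𝓘(ℝ, ℝ)) (IG := IG)
    (isClosedEmbedding_fibrePower_two hσ.submersion.contMDiff.continuous) hQ hH hO hC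
    (fun z hz => hz.imp (fun h => by linarith) fun h => by linarith) (by
      rintro z hz m _ ⟨p, rfl⟩ z' rfl
      rcases hz with hz | hz
      · refine (contMDiffAt_const (c := (1 : G))).congr_of_eventuallyEq ?_
        filter_upwards [continuous_snd.continuousAt.eventually (gt_mem_nhds hz)] with w hw
        exact (hH' _).1 _ hw.le
      · refine ContMDiffAt.congr_of_eventuallyEq (((hg m p).comp contMDiff_fst) z') ?_
        filter_upwards [continuous_snd.continuousAt.eventually (lt_mem_nhds hz)] with w hw
        exact (hH' _).2 _ hw.le)
  have hjoint : ∀ (m : ℕ) (p : Plot (FibrePower IY σ 2) m),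
      ContMDiff (𝓘(ℝ, TestSpace m).prod (𝓡∂ 1)) IG ∞
        fun z : TestSpace m × unitInterval => γ (p z.1, z.2) := fun m p => by
    have h1 : ContMDiff (𝓘(ℝ, TestSpace m).prod 𝓘(ℝ, ℝ)) IG ∞
        fun z : TestSpace m × ℝ => γ (p z.1, z.2) := fun z => hγ _ m _ ⟨p, rfl⟩ z rfl
    exact h1.comp (contMDiff_fst.prodMk (contMDiff_subtypeVal_Icc.comp contMDiff_snd))
  refine ⟨fun y => ⟨fun t => γ (y, t), ?_, ?_⟩, hjoint, fun y => ?_⟩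
  · let p : Plot (FibrePower IY σ 2) 0 := ⟨fun _ => y, fun _ => contMDiff_const⟩
    exact (hjoint 0 p).comp ((contMDiff_const (c := (0 : TestSpace 0))).prodMk contMDiff_id)
  · exact (hγ' (y, 0) (Or.inl le_rfl)).trans ((hH' y).1 0 (by norm_num))
  · exact (hγ' (y, 1) (Or.inr le_rfl)).trans ((hH' y).2 1 (by norm_num))

/-- The analogous statement over `Y`, which is the diagonal of `Y ×_X Y`. -/
theorem exists_smoothPathMap_one (hσ : IsGoodCover IY IX σ) {a : FibrePower IY σ 1 → G}
    (ha : SmoothMap IG a) :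
    ∃ a' : FibrePower IY σ 1 → PathGroup IG G, SmoothPathMap IG a' ∧
      ∀ y, flat IG G (a' y) = a y := by
  obtain ⟨g', hg', h⟩ := exists_smoothPathMap_two (IG := IG) hσ (g := fun y => a (y.sub ![0]))
    fun m p => ha m (p.sub ![0])
  refine ⟨fun y => g' (y.sub ![0, 0]), hg'.pull ![0, 0], fun y => ?_⟩
  rw [h, FibrePower.sub_sub]
  have e : (![0, 0] ∘ ![0] : Fin 1 → Fin 1) = ![0] := by decide
  rw [e, FibrePower.sub_zero]

end

end LoopBundle

end

theorem mainTheorem2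
    -- the cover `σ : Y → X` of smooth manifolds
    {EX HX EY HY : Type*}
    [NormedAddCommGroup EX] [NormedSpace ℝ EX] [FiniteDimensional ℝ EX] [TopologicalSpace HX]
    [NormedAddCommGroup EY] [NormedSpace ℝ EY] [FiniteDimensional ℝ EY] [TopologicalSpace HY]
    (IX : ModelWithCorners ℝ EX HX) [IX.Boundaryless]
    (IY : ModelWithCorners ℝ EY HY) [IY.Boundaryless]
    {X Y : Type*}
    [TopologicalSpace X] [ChartedSpace HX X] [IsManifold IX ∞ X] [T2Space X] [SigmaCompactSpace X]
    [TopologicalSpace Y] [ChartedSpace HY Y] [IsManifold IY ∞ Y] [T2Space Y] [SigmaCompactSpace Y]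
    (σ : Y → X) (hσ : LoopBundle.IsGoodCover IY IX σ)
    -- the connected Lie group `G`
    {EG HG : Type*}
    [NormedAddCommGroup EG] [NormedSpace ℝ EG] [FiniteDimensional ℝ EG] [TopologicalSpace HG]
    (IG : ModelWithCorners ℝ EG HG) [IG.Boundaryless]
    {G : Type*} [TopologicalSpace G] [ChartedSpace HG G] [Group G] [LieGroup IG ∞ G]
    [T2Space G] [ConnectedSpace G]
    -- the function `℘ : [0,1] → ℝ`
    (wp : unitInterval → ℝ) (hwp : ContMDiff (𝓡∂ 1) 𝓘(ℝ, ℝ) ∞ wp)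
    (hwp0 : wp 0 = 0) (hwp1 : wp 1 = 1) :
    -- Every `g` lifts along `♭`, and every lift `g°` extends uniquely to lifted descent data, which
    -- satisfies the adjusted fake-curvature condition.
    (∀ D : LoopBundle.BundleData IY σ IG G,
      (∃ g' : LoopBundle.FibrePower IY σ 2 → LoopBundle.PathGroup IG G,
        LoopBundle.SmoothPathMap IG g' ∧ ∀ y, LoopBundle.flat IG G (g' y) = D.g y) ∧
      ∀ g' : LoopBundle.FibrePower IY σ 2 → LoopBundle.PathGroup IG G,
        LoopBundle.SmoothPathMap IG g' → (∀ y, LoopBundle.flat IG G (g' y) = D.g y) →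
        ∃ D' : LoopBundle.AdjustedData IY σ IG G wp,
          D'.g = g' ∧ LoopBundle.IsLift D D' ∧ D'.FakeFlat ∧
          ∀ D'' : LoopBundle.AdjustedData IY σ IG G wp,
            D''.g = g' → LoopBundle.IsLift D D'' → D'' = D') ∧
    -- Conversely, endpoint evaluation projects to descent data of ordinary bundles.
    (∀ D' : LoopBundle.AdjustedData IY σ IG G wp, D'.FakeFlat →
      ∃! D : LoopBundle.BundleData IY σ IG G, LoopBundle.IsProjection D' D) ∧
    -- Projecting after lifting is the identity.
    (∀ (D : LoopBundle.BundleData IY σ IG G) (D' : LoopBundle.AdjustedData IY σ IG G wp),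
      LoopBundle.IsLift D D' → LoopBundle.IsProjection D' D) ∧
    -- Lifting after projecting is the identity up to the gauge transformation
    -- `a = 1`, `b = g̃° (g°)⁻¹`, `l = (id - ℘ · ♭)(A°)`.
    (∀ (D' : LoopBundle.AdjustedData IY σ IG G wp) (D : LoopBundle.BundleData IY σ IG G)
        (D'' : LoopBundle.AdjustedData IY σ IG G wp),
      D'.FakeFlat → LoopBundle.IsProjection D' D → LoopBundle.IsLift D D'' →
      ∃ c : LoopBundle.AdjustedGauge D' D'',
        (∀ y, c.a y = 1) ∧
        (∀ y, (c.b y : LoopBundle.PathGroup IG G) = D''.g y * (D'.g y)⁻¹) ∧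
        ∀ (m : ℕ) (p : LoopBundle.Plot (LoopBundle.FibrePower IY σ 1) m)
          (u : LoopBundle.TestSpace m) (t : unitInterval),
          c.l t p u = D'.A t p u - wp t • D'.A 1 p u) ∧
    -- Gauge transformations and higher gauge transformations.
    (∀ (D₁' D₂' : LoopBundle.AdjustedData IY σ IG G wp) (D₁ D₂ : LoopBundle.BundleData IY σ IG G),
      D₁'.FakeFlat → D₂'.FakeFlat →
      LoopBundle.IsProjection D₁' D₁ → LoopBundle.IsProjection D₂' D₂ →
      -- gauge equivalence classes correspond to gauge equivalence classes
      (Nonempty (LoopBundle.AdjustedGauge D₁' D₂') ↔ Nonempty (LoopBundle.BundleGauge D₁ D₂)) ∧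
      -- gauge transformations project along `♭`
      (∀ c : LoopBundle.AdjustedGauge D₁' D₂',
        ∃ α : LoopBundle.BundleGauge D₁ D₂, ∀ y, α.a y = LoopBundle.flat IG G (c.a y)) ∧
      -- gauge transformations lift, and each lift `a°` of `a` determines `b°` and `l°`
      (∀ α : LoopBundle.BundleGauge D₁ D₂,
        (∃ a' : LoopBundle.FibrePower IY σ 1 → LoopBundle.PathGroup IG G,
          LoopBundle.SmoothPathMap IG a' ∧ ∀ y, LoopBundle.flat IG G (a' y) = α.a y) ∧
        ∀ a' : LoopBundle.FibrePower IY σ 1 → LoopBundle.PathGroup IG G,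
          LoopBundle.SmoothPathMap IG a' → (∀ y, LoopBundle.flat IG G (a' y) = α.a y) →
          ∃ c : LoopBundle.AdjustedGauge D₁' D₂',
            c.a = a' ∧
            (∀ y, (c.b y : LoopBundle.PathGroup IG G) =
              a' (y.sub ![0]) * D₂'.g y * (a' (y.sub ![1]))⁻¹ * (D₁'.g y)⁻¹) ∧
            (∀ (m : ℕ) (p : LoopBundle.Plot (LoopBundle.FibrePower IY σ 1) m)
              (u : LoopBundle.TestSpace m) (t : unitInterval),
              c.l t p u =
                LoopBundle.gaugeTransform IG (fun u => (a' (p u)).1 t) (D₁'.A t p) u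
                  - D₂'.A t p u) ∧
            ∀ c' : LoopBundle.AdjustedGauge D₁' D₂', c'.a = a' → c' = c) ∧
      -- two gauge transformations have the same projection iff they are linked by a higher gauge
      -- transformation, which is then `ã° (a°)⁻¹`
      ∀ c c' : LoopBundle.AdjustedGauge D₁' D₂',
        ((∀ y, LoopBundle.flat IG G (c.a y) = LoopBundle.flat IG G (c'.a y)) ↔
          ∃ n, LoopBundle.IsHigherGauge c c' n) ∧
        ∀ n, LoopBundle.IsHigherGauge c c' n →
          ∀ y, (n y : LoopBundle.PathGroup IG G) = c'.a y * (c.a y)⁻¹) := by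
  refine ⟨fun D => ⟨LoopBundle.exists_smoothPathMap_two hσ D.smooth_g, fun g' hg' hflat => ?_⟩,
    fun D' _ => LoopBundle.existsUnique_isProjection D', fun D D' h => h.isProjection hwp1,
    fun D' D D'' hF h h' => ?_, fun D₁' D₂' D₁ D₂ hF₁ hF₂ h₁ h₂ => ?_⟩
  · have h := LoopBundle.isLift_liftData D hwp hwp0 hwp1 g' hg' hflat
    exact ⟨_, rfl, h, h.fakeFlat hwp1, fun D'' hg h'' => h.unique h'' hg⟩
  · -- a lift of the trivial gauge transformation of `D`
    obtain ⟨c, ha⟩ : ∃ c : LoopBundle.AdjustedGauge D' D'', c.a = fun _ => 1 :=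
      ⟨LoopBundle.liftGauge hF (h'.fakeFlat hwp1) h (h'.isProjection hwp1) (.refl D) (fun _ => 1)
        (fun _ _ => contMDiff_const) fun _ => rfl, rfl⟩
    refine ⟨c, congrFun ha, fun y => ?_, fun m p u t => ?_⟩
    · rw [c.b_eq, ha]
      group
    · rw [c.l_eq, ha, h'.A_eq, h.A_eq]
      exact congrArg (· - _) (LoopBundle.gaugeTransform_one _ _)
  · have hlift : ∀ α : LoopBundle.BundleGauge D₁ D₂,
        ∃ a' : LoopBundle.FibrePower IY σ 1 → LoopBundle.PathGroup IG G,
          LoopBundle.SmoothPathMap IG a' ∧ ∀ y, LoopBundle.flat IG G (a' y) = α.a y :=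
      fun α => LoopBundle.exists_smoothPathMap_one hσ α.smooth_a
    refine ⟨⟨fun ⟨c⟩ => ⟨c.proj h₁ h₂⟩, fun ⟨α⟩ => ?_⟩, fun c => ⟨c.proj h₁ h₂, fun _ => rfl⟩,
      fun α => ⟨hlift α, fun a' ha' hflat => ?_⟩, fun c c' =>
        ⟨⟨fun h => ⟨_, LoopBundle.isHigherGauge_of_flat_eq h⟩, fun ⟨_, h⟩ => h.flat_eq⟩,
          fun n h y => ?_⟩⟩
    · obtain ⟨a', ha', hflat⟩ := hlift α
      exact ⟨LoopBundle.liftGauge hF₁ hF₂ h₁ h₂ α a' ha' hflat⟩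
    · obtain ⟨c, rfl⟩ : ∃ c : LoopBundle.AdjustedGauge D₁' D₂', c.a = a' :=
        ⟨LoopBundle.liftGauge hF₁ hF₂ h₁ h₂ α a' ha' hflat, rfl⟩
      exact ⟨c, rfl, c.b_eq, fun m p u t => c.l_eq p u t,
        fun c' h => LoopBundle.AdjustedGauge.eq_of_a_eq h⟩
    · rw [h.rel_a, mul_inv_cancel_right]
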